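/- Let $p>1$. For $f\in L^2(\mathbb R)$ (complex-valued) let $$\mathcal E_p(f)(x,t)=\int_{\mathbb R}e^{ixy}e^{it|y|^p}|y|^{\frac{p-2}6}f(y)\,dy,\qquad (x,t)\in\mathbb R^2,$$ be the Fourier extension operator on the curve $s=|y|^p$, the integral being understood as the limit in $L^6(\mathbb R^2)$, as $R\to\infty$, of the integrals over $[-R,R]$. Let $$\mathbf E_p=\sup_{0\ne f\in L^2(\mathbb R)}\frac{\|\mathcal E_p(f)\|_{L^6(\mathbb R^2)}}{\|f\|_{L^2(\mathbb R)}}$$ be the optimal constant in the inequality $\|\mathcal E_p(f)\|_{L^6(\mathbb R^2)}\le\mathbf E_p\|f\|_{L^2(\mathbb R)}$. If $f$ is an extremizer of this inequality, that is, $0\neq f\in L^2(\mathbb R)$ and $\|\mathcal E_p(f)\|_{L^6(\mathbb R^2)}=\mathbf E_p\|f\|_{L^2(\mathbb R)}$, then there exists $\mu_0>0$ (which may depend on $f$) such that $$x\mapsto e^{\mu_0|x|^p}f(x)\in L^2(\mathbb R).$$ In particular, $f$ is integrable and its Fourier transform $\widehat f(\xi)=\int_{\mathbb R}e^{-ix\xi}f(x)\,dx$,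 $\xi\in\mathbb R$, can be extended to an entire function on $\mathbb C$. -/

import Mathlib

open MeasureTheory Filter Topology
open scoped ENNReal

noncomputable section

namespace PowerCurve

/-- The integral `∫ e^{ixy} e^{it|y|^p} |y|^{(p-2)/6} g(y) dy`, used only for square integrable
functions `g` that vanish outside a bounded set. For these and for `p > 1` the integrand is
integrable, since `|y|^{(p-2)/3}` is locally integrable. -/
def extIntegral (p : ℝ) (g : ℝ → ℂ) (z : ℝ × ℝ) : ℂ :=
  ∫ y : ℝ, Complex.exp (Complex.I * (z.1 * y : ℝ)) * Complex.exp (Complex.I * (z.2 * |y| ^ p : ℝ)) *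
    ((|y| ^ ((p - 2) / 6) : ℝ) : ℂ) * g y

/-- `F` is (a representative of) the Fourier extension `E_p f`: as the integral need not converge
absolutely for `f ∈ L²(ℝ)`, it is the limit in `L⁶(ℝ²)` of the integrals over `[-R, R]`, `R → ∞`. -/
def IsExtension (p : ℝ) (f : ℝ → ℂ) (F : ℝ × ℝ → ℂ) : Prop :=
  MemLp F 6 volume ∧
    Tendsto (fun R : ℝ =>
      eLpNorm (fun z => extIntegral p ((Set.Icc (-R) R).indicator f) z - F z) 6 volume)
      atTop (𝓝 0)

/-- The norm `‖E_p f‖` in `L⁶(ℝ²)`. All functions `F` with `IsExtension p f F` have the same norm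
(see `extNorm_eq`); the value is `∞` if there is none. -/
def extNorm (p : ℝ) (f : ℝ → ℂ) : ℝ≥0∞ :=
  ⨅ (F : ℝ × ℝ → ℂ) (_ : IsExtension p f F), eLpNorm F 6 volume

/-- The optimal constant of the extension inequality,
the supremum of `‖E_p f‖_{L⁶} / ‖f‖_{L²}` over `0 ≠ f ∈ L²(ℝ)`. -/
def optConst (p : ℝ) : ℝ≥0∞ :=
  ⨆ (f : ℝ → ℂ) (_ : MemLp f 2 volume) (_ : ¬ f =ᵐ[volume] 0),
    extNorm p f / eLpNorm f 2 volume

/-- `f` is an extremizer of the extension inequality: a nonzero element of `L²(ℝ)` for which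
equality holds with the optimal constant. -/
def IsExtremizer (p : ℝ) (f : ℝ → ℂ) : Prop :=
  MemLp f 2 volume ∧ ¬ f =ᵐ[volume] 0 ∧ extNorm p f = optConst p * eLpNorm f 2 volume

/-- The Fourier transform `∫ e^{-ixξ} f(x) dx` of an integrable function. -/
def fourier (f : ℝ → ℂ) (ξ : ℝ) : ℂ :=
  ∫ x : ℝ, Complex.exp (-Complex.I * (x * ξ : ℝ)) * f x

theorem aestronglyMeasurable_extIntegral (p : ℝ) {g : ℝ → ℂ}
    (hg : AEStronglyMeasurable g volume) :
    AEStronglyMeasurable (extIntegral p g) volume := by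
  unfold extIntegral
  apply AEStronglyMeasurable.integral_prod_right' (μ := (volume : Measure (ℝ × ℝ)))
    (ν := (volume : Measure ℝ))
    (f := fun w : (ℝ × ℝ) × ℝ => Complex.exp (Complex.I * (w.1.1 * w.2 : ℝ)) *
      Complex.exp (Complex.I * (w.1.2 * |w.2| ^ p : ℝ)) *
      ((|w.2| ^ ((p - 2) / 6) : ℝ) : ℂ) * g w.2)
  refine AEStronglyMeasurable.mul ?_ hg.comp_snd
  refine Measurable.aestronglyMeasurable ?_
  fun_prop

theorem IsExtension.ae_eq {p : ℝ} {f : ℝ → ℂ} (hf : AEStronglyMeasurable f volume)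
    {F G : ℝ × ℝ → ℂ} (hF : IsExtension p f F) (hG : IsExtension p f G) :
    F =ᵐ[volume] G := by
  have key : ∀ R : ℝ, eLpNorm (F - G) 6 volume ≤
      eLpNorm (fun z => extIntegral p ((Set.Icc (-R) R).indicator f) z - G z) 6 volume +
      eLpNorm (fun z => extIntegral p ((Set.Icc (-R) R).indicator f) z - F z) 6 volume := by
    intro R
    have hm := aestronglyMeasurable_extIntegral p
      (hf.indicator (measurableSet_Icc (a := -R) (b := R)))
    refine le_trans (le_of_eq ?_) (eLpNorm_sub_le (hm.sub hG.1.1) (hm.sub hF.1.1) (by norm_num))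
    congr 1
    ext z
    simp
  have h0 : eLpNorm (F - G) 6 volume ≤ 0 := by
    have := ge_of_tendsto' (hG.2.add hF.2) key
    simpa using this
  have h1 := (eLpNorm_eq_zero_iff (hF.1.1.sub hG.1.1) (by norm_num)).1 (le_antisymm h0 bot_le)
  filter_upwards [h1] with z hz
  exact sub_eq_zero.1 hz

theorem extNorm_eq {p : ℝ} {f : ℝ → ℂ} (hf : AEStronglyMeasurable f volume)
    {F : ℝ × ℝ → ℂ} (hF : IsExtension p f F) : extNorm p f = eLpNorm F 6 volume :=
  le_antisymm (iInf₂_le F hF)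
    (le_iInf₂ fun _ hG => (eLpNorm_congr_ae (hF.ae_eq hf hG)).le)

end PowerCurve

end

/-!
The cube of the extension of `f` is the inverse Fourier transform of the pushforward of
`f ⊗ f ⊗ f`, times the weight `|y₁ y₂ y₃| ^ ((p - 2) / 6)`, under the sum map
`(y₁, y₂, y₃) ↦ (∑ yᵢ, ∑ |yᵢ| ^ p)`. By Plancherel's theorem (`eLpNorm_extIntegral_cube`,
`extNorm_cube`) the cube of the extension norm of `f` is therefore `‖T (f ⊗ f ⊗ f)‖`, with an
operator `T` (`pushL`) from `L²` of triples to `L²` of the plane. Three properties of `T` are used.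

* `T` is bounded, and its norm on functions supported where one of the variables is at most `ε`
  times another is at most a constant times a positive power of `ε` (`norm_pushL_gap_le`). By
  duality this is the bound `curveMass_gap_le` on the density of the threefold convolution of the
  weighted measure on the curve. For triples whose largest entry is in `[1, 2]` it follows from the
  strict convexity of `|y| ^ p` on each plane `∑ yᵢ = ξ` (`slice_le`); homogeneity gives it for
  all dyadic shells, and the images of the shells overlap boundedly often.
* A factor that depends only on `∑ |yᵢ| ^ p` can be moved from one argument of `⟪T k₁, T k₂⟫` to
  the other (`inner_pushL_transfer`).
* `T` is invariant under permutations of the three variables (`pushL_eq_of_symm`).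

An extremizer `f` maximizes `‖T (f ⊗ f ⊗ f)‖ / ‖f‖ ^ 3`, hence satisfies the Euler–Lagrange
equation `ω Re ⟪f, g⟫ = Re ⟪T (f ⊗ f ⊗ f), T (g ⊗ f ⊗ f)⟫` for all `g`, with `ω > 0`
(`IsExtremizer.exists_euler_lagrange`). It is tested against `g = a ^ 2 f` on `|y| > N s`, where
`a` is a bounded version of `exp (μ |y| ^ p)`, see `damp`. Such a weight is submultiplicative in
`∑ |yᵢ| ^ p`, so that `a (∑ |yᵢ| ^ p)` can be moved to `f ⊗ f ⊗ f` and be distributed over its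
factors. The outcome (`IsExtremizer.exists_bootstrap`) bounds the weighted tail `X` of `f` by a
multiple of `N ^ (-γ) + (small + X) ^ 2`. As `X` is continuous in `μ` and small for `μ = 0`, it
stays small up to `μ = (N s) ^ (-p)`, uniformly in the cutoff of the weight
(`IsExtremizer.exists_tail_le`). Fatou's lemma removes the cutoff and gives the exponential decay.

Since `p > 1`, the factor `exp (-μ |x| ^ p)` beats every `exp (r |x|)`, and the Fourier integral
converges for all complex frequencies to a holomorphic function.
-/

noncomputable section

namespace PowerCurve

/-! ### One-dimensional estimates -/

/-- A weighted one-dimensional change of variables: a weight supported in a set on which `g` is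
injective and dominated there by `c |g'|` costs at most the factor `c`. -/
theorem lintegral_mul_comp_le {I : Set ℝ} (hI : MeasurableSet I) {g g' : ℝ → ℝ}
    (hg : ∀ x ∈ I, HasDerivAt g (g' x) x) (hinj : Set.InjOn g I) {h : ℝ → ℝ≥0∞} {c : ℝ≥0∞}
    (hh : ∀ x ∈ I, h x ≤ c * ENNReal.ofReal |g' x|) (h0 : ∀ x ∉ I, h x = 0)
    {ψ : ℝ → ℝ≥0∞} (hg' : Measurable g') (hgm : Measurable g) (hψ : Measurable ψ) :
    ∫⁻ x, h x * ψ (g x) ≤ c * ∫⁻ t, ψ t := by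
  calc ∫⁻ x, h x * ψ (g x) = ∫⁻ x in I, h x * ψ (g x) := by
        rw [setLIntegral_eq_of_support_subset]
        intro x hx
        by_contra hxI
        simp [h0 x hxI] at hx
    _ ≤ ∫⁻ x in I, c * (ENNReal.ofReal |g' x| * ψ (g x)) := by
        refine setLIntegral_mono ?_ fun x hx => ?_
        · fun_prop
        · rw [← mul_assoc]
          gcongr
          exact hh x hx
    _ = c * ∫⁻ x in I, ENNReal.ofReal |g' x| * ψ (g x) := by
        rw [lintegral_const_mul]
        fun_prop
    _ = c * ∫⁻ t in g '' I, ψ t := by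
        rw [lintegral_image_eq_lintegral_abs_deriv_mul hI
          (fun x hx => (hg x hx).hasDerivWithinAt) hinj]
    _ ≤ c * ∫⁻ t, ψ t := by
        gcongr
        exact Measure.restrict_le_self

theorem lintegral_abs_rpow_indicator {r a : ℝ} (hr : -1 < r) (ha : 0 ≤ a) :
    ∫⁻ x, (Set.Icc (-a) a).indicator (fun x => ENNReal.ofReal (|x| ^ r)) x =
      ENNReal.ofReal (2 / (r + 1) * a ^ (r + 1)) := by
  have hr1 : 0 < r + 1 := by linarith
  have hi : IntegrableOn (fun x : ℝ => x ^ r) (Set.Ioc 0 a) := by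
    have := (intervalIntegral.intervalIntegrable_rpow' (a := 0) (b := a) hr)
    rwa [intervalIntegrable_iff_integrableOn_Ioc_of_le ha] at this
  have hpos : ∫⁻ x in Set.Ioc 0 a, ENNReal.ofReal (|x| ^ r) =
      ENNReal.ofReal (a ^ (r + 1) / (r + 1)) := by
    rw [setLIntegral_congr_fun measurableSet_Ioc (g := fun x => ENNReal.ofReal (x ^ r))
      (fun x hx => by simp only [abs_of_pos hx.1]), ← ofReal_integral_eq_lintegral_ofReal hi
      ((ae_restrict_iff' measurableSet_Ioc).2 (Eventually.of_forall fun x hx =>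
        Real.rpow_nonneg hx.1.le _)), ← intervalIntegral.integral_of_le ha,
      integral_rpow (Or.inl hr), Real.zero_rpow hr1.ne', sub_zero]
  have hneg : ∫⁻ x in Set.Ico (-a) 0, ENNReal.ofReal (|x| ^ r) =
      ENNReal.ofReal (a ^ (r + 1) / (r + 1)) := by
    rw [← hpos, ← lintegral_indicator measurableSet_Ico, ← lintegral_indicator measurableSet_Ioc,
      ← lintegral_neg_eq_self]
    congr 1
    ext x
    by_cases hx : x ∈ Set.Ioc 0 a
    · rw [Set.indicator_of_mem hx, Set.indicator_of_mem, abs_neg]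
      exact ⟨by linarith [hx.2], by linarith [hx.1]⟩
    · rw [Set.indicator_of_notMem hx, Set.indicator_of_notMem]
      exact fun h => hx ⟨by linarith [h.2], by linarith [h.1]⟩
  have hset : (Set.Icc (-a) a) =ᵐ[volume] (Set.Ico (-a) 0 ∪ Set.Ioc 0 a : Set ℝ) := by
    have h1 : Set.Icc (-a) a = Set.Ico (-a) 0 ∪ Set.Icc 0 a :=
      (Set.Ico_union_Icc_eq_Icc (by linarith) ha).symm
    rw [h1]
    exact ae_eq_set_union (ae_eq_refl _) Ioc_ae_eq_Icc.symm
  rw [lintegral_indicator measurableSet_Icc, setLIntegral_congr hset,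
    lintegral_union measurableSet_Ioc, hpos, hneg, ← ENNReal.ofReal_add (by positivity)
      (by positivity)]
  · congr 1; ring
  · rw [Set.disjoint_left]
    intro x hx hx'
    linarith [hx.2, hx'.1]

/-- The derivative of `y ↦ |y| ^ p`. -/
def dpow (p y : ℝ) : ℝ := p * |y| ^ (p - 2) * y

theorem hasDerivAt_abs_rpow_dpow {p : ℝ} (hp : 1 < p) (y : ℝ) :
    HasDerivAt (fun y : ℝ => |y| ^ p) (dpow p y) y :=
  hasDerivAt_abs_rpow y hp

theorem measurable_dpow (p : ℝ) : Measurable (dpow p) := by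
  unfold dpow
  fun_prop

theorem dpow_of_nonneg {p : ℝ} (hp : 1 < p) {y : ℝ} (hy : 0 ≤ y) : dpow p y = p * y ^ (p - 1) := by
  rcases hy.eq_or_lt with rfl | hy
  · simp [dpow, Real.zero_rpow (by linarith : p - 1 ≠ 0)]
  · rw [dpow, abs_of_pos hy, mul_assoc, ← Real.rpow_add_one hy.ne']
    ring_nf

theorem dpow_neg (p y : ℝ) : dpow p (-y) = -dpow p y := by
  simp [dpow]

theorem dpow_mono {p : ℝ} (hp : 1 < p) : Monotone (dpow p) := by
  have h0 : ∀ y, 0 ≤ y → 0 ≤ dpow p y := fun y hy => by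
    rw [dpow_of_nonneg hp hy]
    have := Real.rpow_nonneg hy (p - 1)
    positivity
  have h1 : ∀ x y, 0 ≤ x → x ≤ y → dpow p x ≤ dpow p y := fun x y hx hxy => by
    rw [dpow_of_nonneg hp hx, dpow_of_nonneg hp (hx.trans hxy)]
    gcongr
  intro x y hxy
  rcases le_total 0 x with hx | hx
  · exact h1 x y hx hxy
  · rcases le_total 0 y with hy | hy
    · have := h0 (-x) (by linarith)
      rw [dpow_neg] at this
      linarith [h0 y hy]
    · have := h1 (-y) (-x) (by linarith) (by linarith)
      rw [dpow_neg, dpow_neg] at this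
      linarith

/-- Strict convexity of `|y| ^ p`, made quantitative on a compact interval away from the origin. -/
theorem exists_dpow_sub_ge {p : ℝ} (hp : 1 < p) : ∃ κ : ℝ, 0 < κ ∧
    ∀ x y, 1 / 4 ≤ x → x ≤ y → y ≤ 2 → κ * (y - x) ≤ dpow p y - dpow p x := by
  have hc : ContinuousOn (fun y : ℝ => p * ((p - 1) * y ^ (p - 2))) (Set.Icc (1 / 4) 2) := by
    refine continuousOn_const.mul (continuousOn_const.mul ?_)
    exact ContinuousOn.rpow_const continuousOn_id fun x hx => Or.inl (by
      have := hx.1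
      linarith)
  obtain ⟨x₀, hx₀, hmin⟩ := isCompact_Icc.exists_isMinOn
    (Set.nonempty_Icc.2 (by norm_num : (1 / 4 : ℝ) ≤ 2)) hc
  refine ⟨p * ((p - 1) * x₀ ^ (p - 2)), ?_, fun x y hx hxy hy => ?_⟩
  · have : 0 < x₀ := by linarith [hx₀.1]
    have : 0 < p - 1 := by linarith
    positivity
  have hd : ∀ z ∈ Set.Icc (1 / 4 : ℝ) 2,
      HasDerivAt (fun y : ℝ => p * y ^ (p - 1)) (p * ((p - 1) * z ^ (p - 2))) z := by
    intro z hz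
    have := (Real.hasDerivAt_rpow_const (x := z) (p := p - 1)
      (Or.inl (by linarith [hz.1]))).const_mul p
    rwa [show p - 1 - 1 = p - 2 by ring] at this
  rw [dpow_of_nonneg hp (by linarith), dpow_of_nonneg hp (by linarith)]
  refine Convex.mul_sub_le_image_sub_of_le_deriv (convex_Icc (1 / 4 : ℝ) 2)
    (f := fun y : ℝ => p * y ^ (p - 1))
    (fun z hz => (hd z hz).continuousAt.continuousWithinAt)
    (fun z hz => (hd z (interior_subset hz)).differentiableAt.differentiableWithinAt)
    (fun z hz => ?_) x ⟨hx, by linarith⟩ y ⟨by linarith, hy⟩ hxy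
  rw [(hd z (interior_subset hz)).deriv]
  exact hmin (interior_subset hz)

/-! ### The weight -/

/-- The weight `|y₁ y₂ y₃| ^ ((p - 2) / 3)`, the square of the product of the three weights
`|y| ^ ((p - 2) / 6)` of the extension operator. -/
def sqWeight (p : ℝ) (y : ℝ × ℝ × ℝ) : ℝ≥0∞ :=
  ENNReal.ofReal (|y.1| ^ ((p - 2) / 3) * |y.2.1| ^ ((p - 2) / 3) * |y.2.2| ^ ((p - 2) / 3))

theorem measurable_sqWeight (p : ℝ) : Measurable (sqWeight p) := by
  unfold sqWeight
  fun_prop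

/-- The exponent `min ((p - 2) / 3) 0` of the singularity of the weight. -/
def singExp (p : ℝ) : ℝ := min ((p - 2) / 3) 0

theorem singExp_gt {p : ℝ} (hp : 1 < p) : -1 / 3 < singExp p :=
  lt_min (by linarith) (by norm_num)

theorem singExp_le (p : ℝ) : singExp p ≤ 0 := min_le_right _ _

/-- One factor of the weight, compared with the smallest variable. -/
theorem rpow_weight_le {p a b : ℝ} (ha : 0 < a) (hab : a ≤ b) (hb : b ≤ 2) :
    b ^ ((p - 2) / 3) ≤ 2 ^ |(p - 2) / 3| * a ^ singExp p := by
  rcases le_total 0 ((p - 2) / 3) with h | h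
  · rw [singExp, min_eq_right h, Real.rpow_zero, mul_one, abs_of_nonneg h]
    exact Real.rpow_le_rpow (by linarith) hb h
  · rw [singExp, min_eq_left h]
    calc b ^ ((p - 2) / 3) ≤ a ^ ((p - 2) / 3) := Real.rpow_le_rpow_of_nonpos ha hab h
      _ ≤ 2 ^ |(p - 2) / 3| * a ^ ((p - 2) / 3) :=
        le_mul_of_one_le_left (by positivity)
          (Real.one_le_rpow (by norm_num) (abs_nonneg _))

theorem rpow_weight_le' {p b : ℝ} (h1 : 1 / 4 ≤ b) (hb : b ≤ 2) :
    b ^ ((p - 2) / 3) ≤ 4 ^ |(p - 2) / 3| := by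
  rcases le_total 0 ((p - 2) / 3) with h | h
  · rw [abs_of_nonneg h]
    exact Real.rpow_le_rpow (by linarith) (by linarith) h
  · rw [abs_of_nonpos h, Real.rpow_neg (by norm_num), ← Real.inv_rpow (by norm_num)]
    exact Real.rpow_le_rpow_of_nonpos (by norm_num) (by linarith) h

/-- The weight where only the largest variable is bounded below. -/
theorem weight_le_two {p y₁ y₂ y₃ : ℝ} (h0 : y₁ ≠ 0) (h12 : |y₁| ≤ |y₂|) (h23 : |y₂| ≤ y₃)
    (h1 : 1 ≤ y₃) (h2 : y₃ ≤ 2) :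
    |y₁| ^ ((p - 2) / 3) * |y₂| ^ ((p - 2) / 3) * |y₃| ^ ((p - 2) / 3) ≤
      16 ^ |(p - 2) / 3| * |y₁| ^ (2 * singExp p) := by
  have h0' : 0 < |y₁| := abs_pos.2 h0
  calc |y₁| ^ ((p - 2) / 3) * |y₂| ^ ((p - 2) / 3) * |y₃| ^ ((p - 2) / 3)
      ≤ (2 ^ |(p - 2) / 3| * |y₁| ^ singExp p) * (2 ^ |(p - 2) / 3| * |y₁| ^ singExp p) *
          4 ^ |(p - 2) / 3| := by
        have h3' : 0 ≤ y₃ := by linarith [abs_nonneg y₂]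
        rw [abs_of_nonneg h3']
        gcongr
        · exact rpow_weight_le h0' le_rfl (by linarith)
        · exact rpow_weight_le h0' h12 (by linarith)
        · exact rpow_weight_le' (by linarith) h2
    _ = 16 ^ |(p - 2) / 3| * |y₁| ^ (2 * singExp p) := by
        rw [two_mul, Real.rpow_add h0', show (16 : ℝ) = 2 * 2 * 4 by norm_num,
          Real.mul_rpow (by norm_num) (by norm_num), Real.mul_rpow (by norm_num) (by norm_num)]
        ring

/-- The weight where the two larger variables are bounded below. -/
theorem weight_le_one {p y₁ y₂ y₃ : ℝ} (h0 : y₁ ≠ 0) (h12 : |y₁| ≤ |y₂|) (h23 : |y₂| ≤ y₃)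
    (h2 : 1 / 4 ≤ |y₂|) (h3 : y₃ ≤ 2) :
    |y₁| ^ ((p - 2) / 3) * |y₂| ^ ((p - 2) / 3) * |y₃| ^ ((p - 2) / 3) ≤
      32 ^ |(p - 2) / 3| * |y₁| ^ singExp p := by
  have h0' : 0 < |y₁| := abs_pos.2 h0
  calc |y₁| ^ ((p - 2) / 3) * |y₂| ^ ((p - 2) / 3) * |y₃| ^ ((p - 2) / 3)
      ≤ (2 ^ |(p - 2) / 3| * |y₁| ^ singExp p) * 4 ^ |(p - 2) / 3| * 4 ^ |(p - 2) / 3| := by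
        have h3' : 0 ≤ y₃ := by linarith [abs_nonneg y₂]
        rw [abs_of_nonneg h3']
        gcongr
        · exact rpow_weight_le h0' le_rfl (by linarith)
        · exact rpow_weight_le' h2 (by linarith)
        · exact rpow_weight_le' (by linarith) h3
    _ = 32 ^ |(p - 2) / 3| * |y₁| ^ singExp p := by
        rw [show (32 : ℝ) = 2 * 4 * 4 by norm_num,
          Real.mul_rpow (by norm_num) (by norm_num), Real.mul_rpow (by norm_num) (by norm_num)]
        ring

theorem weight_le_const {p y₁ y₂ y₃ : ℝ} (h1 : 1 / 4 ≤ |y₁|) (h12 : |y₁| ≤ |y₂|)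
    (h23 : |y₂| ≤ y₃) (h3 : y₃ ≤ 2) :
    |y₁| ^ ((p - 2) / 3) * |y₂| ^ ((p - 2) / 3) * |y₃| ^ ((p - 2) / 3) ≤
      4 ^ |(p - 2) / 3| * 4 ^ |(p - 2) / 3| * 4 ^ |(p - 2) / 3| := by
  have h3' : 0 ≤ y₃ := by linarith [abs_nonneg y₂]
  rw [abs_of_nonneg h3']
  gcongr
  · exact rpow_weight_le' h1 (by linarith)
  · exact rpow_weight_le' (by linarith) (by linarith)
  · exact rpow_weight_le' (by linarith) h3

/-! ### Slices of the constraint set at a fixed sum -/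

/-- Triples ordered by absolute value with positive largest entry in `[1, 2]`, and whose smallest
entry is at most `ε` times the largest. -/
def ordReg (ε : ℝ) : Set (ℝ × ℝ × ℝ) :=
  {y | |y.1| ≤ |y.2.1| ∧ |y.2.1| ≤ y.2.2 ∧ 1 ≤ y.2.2 ∧ y.2.2 ≤ 2 ∧ |y.1| ≤ ε * y.2.2}

theorem measurableSet_ordReg (ε : ℝ) : MeasurableSet (ordReg ε) := by
  unfold ordReg
  simp only [measurableSet_setOfPred]
  fun_prop

/-- The value of `∑ |yᵢ| ^ p` when `y₃ = ξ - y₁ - y₂`. -/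
def sumPow (p ξ y₁ y₂ : ℝ) : ℝ := |y₁| ^ p + |y₂| ^ p + |ξ - y₁ - y₂| ^ p

/-- The part of a slice with `y₂ ≤ y₃ / 2`. There the derivative of `∑ |yᵢ| ^ p` in `y₂` at fixed
`y₁` is bounded away from zero, and the singularity `|y₁| ^ (2 * singExp p)` of the weight is
integrable because `singExp p > -1 / 2`. -/
theorem slice_transversal {p : ℝ} (hp : 1 < p) : ∃ C : ℝ, 0 ≤ C ∧ ∀ ε : ℝ, 0 < ε → ε ≤ 1 →
    ∀ (ξ : ℝ) (ψ : ℝ → ℝ≥0∞), Measurable ψ →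
      ∫⁻ y₁, ∫⁻ y₂, (ordReg ε ∩ {y | y.2.1 ≤ y.2.2 / 2}).indicator (sqWeight p)
        (y₁, y₂, ξ - y₁ - y₂) * ψ (sumPow p ξ y₁ y₂) ≤
      ENNReal.ofReal (C * ε ^ (1 / 2 + singExp p)) * ∫⁻ t, ψ t := by
  obtain ⟨κ, hκ, hκm⟩ := exists_dpow_sub_ge hp
  have ha := singExp_gt hp
  have ha' := singExp_le p
  have ha1 : 0 < 2 * singExp p + 1 := by linarith
  refine ⟨2 / κ * 16 ^ |(p - 2) / 3| * (2 / (2 * singExp p + 1) * 2 ^ (2 * singExp p + 1)),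
    by positivity, fun ε hε hε1 ξ ψ hψ => ?_⟩
  calc _ ≤ ∫⁻ y₁, (ENNReal.ofReal (2 / κ * 16 ^ |(p - 2) / 3|) *
        (Set.Icc (-(2 * ε)) (2 * ε)).indicator
          (fun x => ENNReal.ofReal (|x| ^ (2 * singExp p))) y₁) * ∫⁻ t, ψ t := by
        refine lintegral_mono_ae ?_
        filter_upwards [compl_mem_ae_iff.2 (measure_singleton (0 : ℝ))] with y₁ hy₁
        replace hy₁ : y₁ ≠ 0 := hy₁
        set I : Set ℝ := {y₂ | 1 ≤ ξ - y₁ - y₂ ∧ ξ - y₁ - y₂ ≤ 2 ∧ y₂ ≤ (ξ - y₁ - y₂) / 2}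
        have hIconv : Convex ℝ I := by
          intro x hx y hy s t hs ht hst
          obtain rfl : t = 1 - s := by linarith
          simp only [I, Set.mem_ofPred_eq, smul_eq_mul] at hx hy ⊢
          refine ⟨?_, ?_, ?_⟩ <;> nlinarith
        have hImeas : MeasurableSet I := by
          simp only [I, measurableSet_setOfPred]
          fun_prop
        have hd : ∀ y₂, HasDerivAt (fun y₂ => sumPow p ξ y₁ y₂)
            (dpow p y₂ - dpow p (ξ - y₁ - y₂)) y₂ := fun y₂ => by
          have h3 := (hasDerivAt_abs_rpow_dpow hp (ξ - y₁ - y₂)).comp y₂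
            ((hasDerivAt_id y₂).const_sub (ξ - y₁))
          have := ((hasDerivAt_const y₂ (|y₁| ^ p)).add (hasDerivAt_abs_rpow_dpow hp y₂)).add h3
          convert! this using 1
          ring
        have hlow : ∀ y₂ ∈ I, dpow p y₂ - dpow p (ξ - y₁ - y₂) ≤ -(κ / 2) := fun y₂ hy => by
          obtain ⟨h1, h2, h3⟩ := hy
          have e1 := dpow_mono hp h3
          have e2 := hκm ((ξ - y₁ - y₂) / 2) (ξ - y₁ - y₂) (by linarith) (by linarith) h2
          nlinarith
        have hinj : Set.InjOn (fun y₂ => sumPow p ξ y₁ y₂) I := by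
          refine (strictAntiOn_of_deriv_neg hIconv
            (fun x _ => (hd x).continuousAt.continuousWithinAt) fun x hx => ?_).injOn
          rw [(hd x).deriv]
          linarith [hlow x (interior_subset hx)]
        refine lintegral_mul_comp_le hImeas (fun x _ => hd x) hinj (fun y₂ hy₂ => ?_)
          (fun y₂ hy₂ => ?_) ?_ ?_ hψ
        · by_cases hm : (y₁, y₂, ξ - y₁ - y₂) ∈ ordReg ε ∩ {y | y.2.1 ≤ y.2.2 / 2}
          · rw [Set.indicator_of_mem hm]
            obtain ⟨⟨h12, h23, h1, h2, he⟩, -⟩ := hm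
            dsimp only at h12 h23 h1 h2 he
            have hmem : y₁ ∈ Set.Icc (-(2 * ε)) (2 * ε) := by
              exact abs_le.1 (by nlinarith)
            rw [Set.indicator_of_mem hmem, ← ENNReal.ofReal_mul (by positivity),
              ← ENNReal.ofReal_mul (by positivity)]
            refine ENNReal.ofReal_le_ofReal ((weight_le_two hy₁ h12 h23 h1 h2).trans ?_)
            have habs : κ / 2 ≤ |dpow p y₂ - dpow p (ξ - y₁ - y₂)| := by
              rw [le_abs]; right; linarith [hlow y₂ hy₂]
            calc (16 : ℝ) ^ |(p - 2) / 3| * |y₁| ^ (2 * singExp p) =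
                2 / κ * 16 ^ |(p - 2) / 3| * |y₁| ^ (2 * singExp p) * (κ / 2) := by
                  field_simp
              _ ≤ _ := by gcongr
          · rw [Set.indicator_of_notMem hm]
            exact zero_le
        · refine Set.indicator_of_notMem (fun hm => hy₂ ?_) _
          exact ⟨hm.1.2.2.1, hm.1.2.2.2.1, hm.2⟩
        · have := measurable_dpow p
          fun_prop
        · unfold sumPow; fun_prop
    _ = ENNReal.ofReal (2 / κ * 16 ^ |(p - 2) / 3|) * ENNReal.ofReal
        (2 / (2 * singExp p + 1) * (2 * ε) ^ (2 * singExp p + 1)) * ∫⁻ t, ψ t := by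
        rw [lintegral_mul_const, lintegral_const_mul, lintegral_abs_rpow_indicator (by linarith)
          (by linarith)]
        · exact Measurable.indicator (by fun_prop) measurableSet_Icc
        · exact (Measurable.indicator (by fun_prop) measurableSet_Icc).const_mul _
    _ ≤ _ := by
        rw [← ENNReal.ofReal_mul (by positivity)]
        gcongr ENNReal.ofReal ?_ * _
        rw [Real.mul_rpow (by norm_num) hε.le]
        have : ε ^ (2 * singExp p + 1) ≤ ε ^ (1 / 2 + singExp p) :=
          Real.rpow_le_rpow_of_exponent_ge hε hε1 (by linarith)
        calc _ = 2 / κ * 16 ^ |(p - 2) / 3| * (2 / (2 * singExp p + 1) * 2 ^ (2 * singExp p + 1)) *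
              ε ^ (2 * singExp p + 1) := by ring
          _ ≤ _ := by gcongr

/-- Radial derivative of `∑ |yᵢ| ^ p` in polar coordinates centred at the point `(m, m, m)` of the
plane `∑ yᵢ = 3 m`: by convexity it grows at least linearly in the radius. -/
theorem radial_deriv_ge {p κ : ℝ} (hκ : 0 < κ)
    (hκm : ∀ x y, 1 / 4 ≤ x → x ≤ y → y ≤ 2 → κ * (y - x) ≤ dpow p y - dpow p x)
    {m r a b ξ : ℝ} (hξ : ξ = 3 * m) (hr : 0 < r) (hab : a ^ 2 + b ^ 2 = 1)
    (h1 : 1 / 4 ≤ r * a + m) (h1' : r * a + m ≤ 2) (h2 : 1 / 4 ≤ r * b + m) (h2' : r * b + m ≤ 2)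
    (h3 : 1 / 4 ≤ ξ - (r * a + m) - (r * b + m)) (h3' : ξ - (r * a + m) - (r * b + m) ≤ 2) :
    κ * r ≤ dpow p (r * a + m) * a + dpow p (r * b + m) * b +
      dpow p (ξ - (r * a + m) - (r * b + m)) * (-a - b) := by
  have hmono : ∀ x y, 1 / 4 ≤ x → x ≤ 2 → 1 / 4 ≤ y → y ≤ 2 →
      κ * (x - y) ^ 2 ≤ (dpow p x - dpow p y) * (x - y) := by
    intro x y hx hx' hy hy'
    rcases le_total x y with h | h
    · nlinarith [hκm x y hx h hy']
    · nlinarith [hκm y x hy h hx']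
  have e1 := hmono (r * a + m) m h1 h1' (by linarith) (by linarith)
  have e2 := hmono (r * b + m) m h2 h2' (by linarith) (by linarith)
  have e3 := hmono (ξ - (r * a + m) - (r * b + m)) m h3 h3' (by linarith) (by linarith)
  have h0 : 0 ≤ κ * (-(r * (a + b))) ^ 2 := by positivity
  have t3 : (ξ - (r * a + m) - (r * b + m)) - m = -(r * (a + b)) := by rw [hξ]; ring
  have t1 : r * a + m - m = r * a := by ring
  have t2 : r * b + m - m = r * b := by ring
  rw [t1] at e1
  rw [t2] at e2
  rw [t3] at e3
  have key : κ * (r * a) ^ 2 + κ * (r * b) ^ 2 = κ * r * r := by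
    calc _ = κ * r * r * (a ^ 2 + b ^ 2) := by ring
      _ = _ := by rw [hab, mul_one]
  refine le_of_mul_le_mul_right ?_ hr
  calc κ * r * r ≤ (dpow p (r * a + m) - dpow p m) * (r * a) +
      (dpow p (r * b + m) - dpow p m) * (r * b) +
      (dpow p (ξ - (r * a + m) - (r * b + m)) - dpow p m) * -(r * (a + b)) := by linarith
    _ = _ := by ring

set_option maxHeartbeats 800000 in
/-- The part of a slice with `y₁`, `y₂`, `y₃` comparable and positive. Near the minimum of
`∑ |yᵢ| ^ p` on the slice, at `y₁ = y₂ = y₃`, no coordinate derivative is bounded below, but in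
polar coordinates about it the Jacobian `r` is dominated by the radial derivative. The region is
empty unless `ε ≥ 1 / 4`, so the power of `ε` is of no account. -/
theorem slice_elliptic {p : ℝ} (hp : 1 < p) : ∃ C : ℝ, 0 ≤ C ∧ ∀ ε : ℝ, 0 < ε → ε ≤ 1 →
    ∀ (ξ : ℝ) (ψ : ℝ → ℝ≥0∞), Measurable ψ →
      ∫⁻ y₁, ∫⁻ y₂, (ordReg ε ∩ {y | y.2.2 / 2 ≤ y.2.1 ∧ y.2.2 / 4 ≤ y.1}).indicator (sqWeight p)
        (y₁, y₂, ξ - y₁ - y₂) * ψ (sumPow p ξ y₁ y₂) ≤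
      ENNReal.ofReal (C * ε ^ (1 / 2 + singExp p)) * ∫⁻ t, ψ t := by
  obtain ⟨κ, hκ, hκm⟩ := exists_dpow_sub_ge hp
  have ha := singExp_gt hp
  set W : ℝ := 4 ^ |(p - 2) / 3| * 4 ^ |(p - 2) / 3| * 4 ^ |(p - 2) / 3|
  have hW : 0 < W := by positivity
  refine ⟨W / κ * (2 * Real.pi) * 4 ^ (1 / 2 + singExp p), by positivity, fun ε hε hε1 ξ ψ hψ => ?_⟩
  -- The region is empty for small `ε`.
  rcases lt_or_ge ε (1 / 4) with hε4 | hε4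
  · have : ordReg ε ∩ {y | y.2.2 / 2 ≤ y.2.1 ∧ y.2.2 / 4 ≤ y.1} = ∅ := by
      ext y
      simp only [ordReg, Set.mem_inter_iff, Set.mem_ofPred_eq, Set.mem_empty_iff_false, iff_false]
      rintro ⟨⟨-, -, h1, -, he⟩, -, h4⟩
      nlinarith [le_abs_self y.1]
    simp [this]
  set m := ξ / 3 with hm
  have hξ : ξ = 3 * m := by rw [hm]; ring
  set B : Set (ℝ × ℝ × ℝ) := ordReg ε ∩ {y | y.2.2 / 2 ≤ y.2.1 ∧ y.2.2 / 4 ≤ y.1}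
  have hB : MeasurableSet B := by
    refine (measurableSet_ordReg ε).inter ?_
    simp only [measurableSet_setOfPred]
    fun_prop
  have hind : Measurable (B.indicator (sqWeight p)) := (measurable_sqWeight p).indicator hB
  have hsm : Measurable fun z : ℝ × ℝ => sumPow p ξ z.1 z.2 := by unfold sumPow; fun_prop
  set G : ℝ × ℝ → ℝ≥0∞ := fun z => B.indicator (sqWeight p) (z.1, z.2, ξ - z.1 - z.2) *
    ψ (sumPow p ξ z.1 z.2) with hG
  have hGm : Measurable G := by
    refine Measurable.mul (hind.comp (by fun_prop)) (hψ.comp hsm)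
  calc ∫⁻ y₁, ∫⁻ y₂, G (y₁, y₂) = ∫⁻ z : ℝ × ℝ, G z := (lintegral_prod _ hGm.aemeasurable).symm
    _ = ∫⁻ z : ℝ × ℝ, G (z + (m, m)) := (lintegral_add_right_eq_self G (m, m)).symm
    _ = ∫⁻ q in polarCoord.target, ENNReal.ofReal q.1 • G (polarCoord.symm q + (m, m)) :=
        (lintegral_comp_polarCoord_symm fun z => G (z + (m, m))).symm
    _ = ∫⁻ q : ℝ × ℝ, polarCoord.target.indicator (fun q => ENNReal.ofReal q.1 *
          G (q.1 * Real.cos q.2 + m, q.1 * Real.sin q.2 + m)) q := by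
        rw [lintegral_indicator polarCoord.open_target.measurableSet]
        simp [polarCoord_symm_apply]
    _ = ∫⁻ θ, ∫⁻ r, polarCoord.target.indicator (fun q => ENNReal.ofReal q.1 *
          G (q.1 * Real.cos q.2 + m, q.1 * Real.sin q.2 + m)) (r, θ) := by
        rw [Measure.volume_eq_prod, lintegral_prod_symm]
        refine Measurable.aemeasurable (Measurable.indicator ?_ polarCoord.open_target.measurableSet)
        fun_prop
    _ ≤ ∫⁻ θ, (Set.Ioo (-Real.pi) Real.pi).indicator
          (fun _ => ENNReal.ofReal (W / κ) * ∫⁻ t, ψ t) θ := by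
        refine lintegral_mono fun θ => ?_
        by_cases hθ : θ ∈ Set.Ioo (-Real.pi) Real.pi
        swap
        · rw [Set.indicator_of_notMem hθ]
          refine le_of_eq (lintegral_eq_zero_of_ae_eq_zero (Eventually.of_forall fun r => ?_))
          refine Set.indicator_of_notMem (fun h => hθ ?_) _
          rw [polarCoord_target] at h
          exact h.2
        rw [Set.indicator_of_mem hθ]
        set a := Real.cos θ
        set b := Real.sin θ
        have hab : a ^ 2 + b ^ 2 = 1 := Real.cos_sq_add_sin_sq θ
        set g : ℝ → ℝ := fun r => sumPow p ξ (r * a + m) (r * b + m)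
        set g' : ℝ → ℝ := fun r => dpow p (r * a + m) * a + dpow p (r * b + m) * b +
          dpow p (ξ - (r * a + m) - (r * b + m)) * (-a - b)
        have hd : ∀ r, HasDerivAt g (g' r) r := fun r => by
          have l1 : HasDerivAt (fun r => r * a + m) a r := by
            simpa using ((hasDerivAt_id r).mul_const a).add_const m
          have l2 : HasDerivAt (fun r => r * b + m) b r := by
            simpa using ((hasDerivAt_id r).mul_const b).add_const m
          have l3 : HasDerivAt (fun r => ξ - (r * a + m) - (r * b + m)) (-a - b) r := by
            exact (l1.const_sub ξ).sub l2
          exact (((hasDerivAt_abs_rpow_dpow hp (r * a + m)).comp r l1).add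
            ((hasDerivAt_abs_rpow_dpow hp (r * b + m)).comp r l2)).add
            ((hasDerivAt_abs_rpow_dpow hp _).comp r l3)
        set I : Set ℝ := {r | 0 < r ∧ (1 / 4 ≤ r * a + m ∧ r * a + m ≤ 2) ∧
          (1 / 4 ≤ r * b + m ∧ r * b + m ≤ 2) ∧
          (1 / 4 ≤ ξ - (r * a + m) - (r * b + m) ∧ ξ - (r * a + m) - (r * b + m) ≤ 2)}
        have hImeas : MeasurableSet I := by
          simp only [I, measurableSet_setOfPred]
          fun_prop
        have hIconv : Convex ℝ I := by
          intro x hx y hy s t hs ht hst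
          obtain rfl : t = 1 - s := by linarith
          simp only [I, Set.mem_ofPred_eq, smul_eq_mul] at hx hy ⊢
          refine ⟨?_, ⟨?_, ?_⟩, ⟨?_, ?_⟩, ?_, ?_⟩
          · rcases hs.eq_or_lt with rfl | hs
            · linarith
            · nlinarith [mul_pos hs hx.1, mul_nonneg ht hy.1.le]
          all_goals nlinarith
        have hlow : ∀ r ∈ I, κ * r ≤ g' r := by
          rintro r ⟨hr, ⟨h1, h1'⟩, ⟨h2, h2'⟩, h3, h3'⟩
          exact radial_deriv_ge hκ hκm hξ hr hab h1 h1' h2 h2' h3 h3'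
        have hinj : Set.InjOn g I := by
          refine (strictMonoOn_of_deriv_pos hIconv
            (fun x _ => (hd x).continuousAt.continuousWithinAt) fun x hx => ?_).injOn
          rw [(hd x).deriv]
          have := (interior_subset hx).1
          exact lt_of_lt_of_le (by positivity) (hlow x (interior_subset hx))
        have hmain := lintegral_mul_comp_le hImeas (g := g) (g' := g') (fun x _ => hd x) hinj
          (h := fun r => polarCoord.target.indicator (fun q => ENNReal.ofReal q.1 *
            B.indicator (sqWeight p) (q.1 * a + m, q.1 * b + m,
              ξ - (q.1 * a + m) - (q.1 * b + m))) (r, θ))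
          (c := ENNReal.ofReal (W / κ)) (fun r hr => ?_) (fun r hr => ?_)
          (ψ := ψ) ?_ ?_ hψ
        · refine le_trans (le_of_eq (lintegral_congr fun r => ?_)) hmain
          by_cases hq : (r, θ) ∈ polarCoord.target
          · rw [Set.indicator_of_mem hq, Set.indicator_of_mem hq]
            simp only [hG, g, mul_assoc, a, b]
          · rw [Set.indicator_of_notMem hq, Set.indicator_of_notMem hq, zero_mul]
        · refine (Set.indicator_le_self _ _ _).trans ?_
          have hw : B.indicator (sqWeight p) (r * a + m, r * b + m,
              ξ - (r * a + m) - (r * b + m)) ≤ ENNReal.ofReal W := by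
            refine Set.indicator_le' (g := fun _ => ENNReal.ofReal W) (fun y hy => ?_)
              (fun _ _ => zero_le) _
            obtain ⟨⟨h12, h23, h1, h2, -⟩, h3, h4⟩ := hy
            refine ENNReal.ofReal_le_ofReal (weight_le_const ?_ h12 h23 h2)
            linarith [le_abs_self y.1]
          calc _ ≤ ENNReal.ofReal r * ENNReal.ofReal W := by gcongr
            _ = ENNReal.ofReal (W / κ) * ENNReal.ofReal (κ * r) := by
              rw [← ENNReal.ofReal_mul hr.1.le, ← ENNReal.ofReal_mul (by positivity)]
              congr 1
              field_simp
            _ ≤ _ := by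
              gcongr
              exact (hlow r hr).trans (le_abs_self _)
        · by_cases hq : (r, θ) ∈ polarCoord.target
          · rw [Set.indicator_of_mem hq]
            have hr0 : 0 < r := by
              rw [polarCoord_target] at hq
              exact hq.1
            dsimp only
            rw [Set.indicator_of_notMem, mul_zero]
            rintro ⟨⟨h12, h23, h1, h2, -⟩, h3, h4⟩
            dsimp only at h12 h23 h1 h2 h3 h4
            refine hr ⟨hr0, ⟨by linarith, ?_⟩, ⟨by linarith, ?_⟩, by linarith, h2⟩
            · linarith [le_abs_self (r * a + m)]
            · linarith [le_abs_self (r * b + m)]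
          · rw [Set.indicator_of_notMem hq]
        · have := measurable_dpow p
          fun_prop
        · simp only [g, sumPow]; fun_prop
    _ = ENNReal.ofReal (W / κ * (2 * Real.pi)) * ∫⁻ t, ψ t := by
        rw [lintegral_indicator measurableSet_Ioo, setLIntegral_const, Real.volume_Ioo,
          ENNReal.ofReal_mul (by positivity)]
        rw [show Real.pi - -Real.pi = 2 * Real.pi by ring]
        ring
    _ ≤ _ := by
        gcongr ENNReal.ofReal ?_ * _
        rw [mul_assoc (W / κ * (2 * Real.pi))]
        refine le_mul_of_one_le_right (by positivity) ?_
        rw [← Real.mul_rpow (by norm_num) hε.le]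
        exact Real.one_le_rpow (by linarith) (by linarith)

set_option maxHeartbeats 800000 in
/-- The part of a slice with `y₂`, `y₃` comparable and `y₁` smaller (or negative). With
`2 d = y₃ - y₂`, the derivative of `∑ |yᵢ| ^ p` in `d` is at least a multiple of `d`, and its
derivative in `y₁` at fixed `d` is bounded away from zero. The first is used where `|y₁| ≤ d ^ 2`,
the second where `d ^ 2 < |y₁|`; the remaining integrals are `∫ |y₁| ^ (singExp p - 1 / 2)` over
`|y₁| ≤ 2 ε` and `∫ |d| ^ (2 * singExp p)` over `d ^ 2 ≤ 2 ε`, and both converge because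
`singExp p > -1 / 3`. -/
theorem slice_parabolic {p : ℝ} (hp : 1 < p) : ∃ C : ℝ, 0 ≤ C ∧ ∀ ε : ℝ, 0 < ε → ε ≤ 1 →
    ∀ (ξ : ℝ) (ψ : ℝ → ℝ≥0∞), Measurable ψ →
      ∫⁻ y₁, ∫⁻ y₂, (ordReg ε ∩ {y | y.2.2 / 2 ≤ y.2.1 ∧ y.1 ≤ y.2.2 / 4}).indicator (sqWeight p)
        (y₁, y₂, ξ - y₁ - y₂) * ψ (sumPow p ξ y₁ y₂) ≤
      ENNReal.ofReal (C * ε ^ (1 / 2 + singExp p)) * ∫⁻ t, ψ t := by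
  obtain ⟨κ, hκ, hκm⟩ := exists_dpow_sub_ge hp
  have ha := singExp_gt hp
  have ha' := singExp_le p
  have ha1 : 0 < 2 * singExp p + 1 := by linarith
  have ha2 : 0 < 1 / 2 + singExp p := by linarith
  set α := singExp p
  set W : ℝ := 32 ^ |(p - 2) / 3| with hWdef
  have hW : 0 < W := by positivity
  refine ⟨W / (2 * κ) * (2 / (1 / 2 + α) * 2 ^ (1 / 2 + α)) +
    4 * W / κ * (2 / (2 * α + 1) * 2 ^ (1 / 2 + α)), by positivity, fun ε hε hε1 ξ ψ hψ => ?_⟩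
  set B : Set (ℝ × ℝ × ℝ) := ordReg ε ∩ {y | y.2.2 / 2 ≤ y.2.1 ∧ y.1 ≤ y.2.2 / 4} with hBdef
  have hB : MeasurableSet B := by
    refine (measurableSet_ordReg ε).inter ?_
    simp only [measurableSet_setOfPred]
    fun_prop
  have hind : Measurable (B.indicator (sqWeight p)) := (measurable_sqWeight p).indicator hB
  -- The symmetric coordinates are `y₂ = (ξ - y₁) / 2 - d`, `y₃ = (ξ - y₁) / 2 + d`.
  set P : ℝ → ℝ → ℝ × ℝ × ℝ := fun y₁ d => (y₁, (ξ - y₁) / 2 - d, (ξ - y₁) / 2 + d) with hP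
  set σ : ℝ → ℝ → ℝ := fun y₁ d => |y₁| ^ p + |(ξ - y₁) / 2 - d| ^ p + |(ξ - y₁) / 2 + d| ^ p
    with hσ
  have hPm : Measurable (Function.uncurry P) := by simp only [hP]; fun_prop
  have hσm : Measurable (Function.uncurry σ) := by simp only [hσ]; fun_prop
  set S : Set (ℝ × ℝ) := {z | |z.1| ≤ z.2 ^ 2} with hS
  have hSm : MeasurableSet S := by
    simp only [hS, measurableSet_setOfPred]
    fun_prop
  set F : ℝ × ℝ → ℝ≥0∞ := fun z => B.indicator (sqWeight p) (P z.1 z.2) with hF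
  have hFm : Measurable F := hind.comp hPm
  have hdpm := measurable_dpow p
  have hwt : ∀ y₁ d, y₁ ≠ 0 → P y₁ d ∈ B →
      B.indicator (sqWeight p) (P y₁ d) ≤ ENNReal.ofReal (W * |y₁| ^ α) := by
    intro y₁ d hy₁ hm
    rw [Set.indicator_of_mem hm]
    obtain ⟨⟨h12, h23, h1, h2, he⟩, h3, h4⟩ := hm
    refine ENNReal.ofReal_le_ofReal (weight_le_one hy₁ h12 h23 ?_ h2)
    linarith [le_abs_self ((P y₁ d).2.1)]
  have hsmall : ∀ y₁ d, P y₁ d ∈ B → |y₁| ≤ 2 * ε := by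
    rintro y₁ d ⟨⟨-, -, h1, h2, he⟩, -⟩
    simp only [hP] at h1 h2 he
    nlinarith
  -- Where `d ^ 2` dominates `|y₁|`, the inner integral is over `d`.
  have part1 : ∫⁻ y₁, ∫⁻ d, S.indicator F (y₁, d) * ψ (σ y₁ d) ≤
      ENNReal.ofReal (W / (2 * κ) * (2 / (1 / 2 + α) * 2 ^ (1 / 2 + α)) * ε ^ (1 / 2 + α)) *
        ∫⁻ t, ψ t := by
    calc _ ≤ ∫⁻ y₁, (ENNReal.ofReal (W / (2 * κ)) *
          (Set.Icc (-(2 * ε)) (2 * ε)).indicator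
            (fun x => ENNReal.ofReal (|x| ^ (α - 1 / 2))) y₁) * ∫⁻ t, ψ t := by
          refine lintegral_mono_ae ?_
          filter_upwards [compl_mem_ae_iff.2 (measure_singleton (0 : ℝ))] with y₁ hy₁
          replace hy₁ : y₁ ≠ 0 := hy₁
          have hy₁' : 0 < |y₁| := abs_pos.2 hy₁
          set I : Set ℝ := {d | 0 ≤ d ∧ (ξ - y₁) / 2 + d ≤ 2 ∧ 1 / 2 ≤ (ξ - y₁) / 2 - d}
          have hIconv : Convex ℝ I := by
            intro x hx y hy s t hs ht hst
            obtain rfl : t = 1 - s := by linarith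
            simp only [I, Set.mem_ofPred_eq, smul_eq_mul] at hx hy ⊢
            refine ⟨?_, ?_, ?_⟩ <;> nlinarith
          have hImeas : MeasurableSet I := by
            simp only [I, measurableSet_setOfPred]
            fun_prop
          have hd : ∀ d, HasDerivAt (fun d => σ y₁ d)
              (dpow p ((ξ - y₁) / 2 + d) - dpow p ((ξ - y₁) / 2 - d)) d := fun d => by
            have h2 := (hasDerivAt_abs_rpow_dpow hp ((ξ - y₁) / 2 - d)).comp d
              ((hasDerivAt_id d).const_sub ((ξ - y₁) / 2))
            have h3 := (hasDerivAt_abs_rpow_dpow hp ((ξ - y₁) / 2 + d)).comp d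
              ((hasDerivAt_id d).const_add ((ξ - y₁) / 2))
            have := ((hasDerivAt_const d (|y₁| ^ p)).add h2).add h3
            convert! this using 1
            ring
          have hlow : ∀ d ∈ I, 2 * κ * d ≤
              dpow p ((ξ - y₁) / 2 + d) - dpow p ((ξ - y₁) / 2 - d) := fun d hdI => by
            obtain ⟨h0, h1, h2⟩ := hdI
            have := hκm _ _ (by linarith) (by linarith : (ξ - y₁) / 2 - d ≤ (ξ - y₁) / 2 + d) h1
            linarith
          have hinj : Set.InjOn (fun d => σ y₁ d) I := by
            refine (strictMonoOn_of_deriv_pos hIconv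
              (fun x _ => (hd x).continuousAt.continuousWithinAt) fun x hx => ?_).injOn
            rw [(hd x).deriv]
            have hx0 : 0 < x := by
              have : x ∈ interior (Set.Ici (0 : ℝ)) := interior_mono (fun d hd => hd.1) hx
              rwa [interior_Ici] at this
            exact lt_of_lt_of_le (by positivity) (hlow x (interior_subset hx))
          refine lintegral_mul_comp_le hImeas (fun x _ => hd x) hinj (fun d hdI => ?_)
            (fun d hdI => ?_) ?_ ?_ hψ
          · by_cases hm : (y₁, d) ∈ S ∧ P y₁ d ∈ B
            swap
            · rw [Set.indicator_apply]
              split_ifs with h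
              · rw [hF]
                simp only
                rw [Set.indicator_of_notMem fun hb => hm ⟨h, hb⟩]
                exact zero_le
              · exact zero_le
            obtain ⟨hmS, hmB⟩ := hm
            rw [Set.indicator_of_mem hmS]
            refine (hwt y₁ d hy₁ hmB).trans ?_
            have hmem : y₁ ∈ Set.Icc (-(2 * ε)) (2 * ε) := abs_le.1 (hsmall y₁ d hmB)
            rw [Set.indicator_of_mem hmem, ← ENNReal.ofReal_mul (by positivity),
              ← ENNReal.ofReal_mul (by positivity)]
            refine ENNReal.ofReal_le_ofReal ?_
            have hd1 : |y₁| ^ (1 / 2 : ℝ) ≤ d := by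
              rw [← Real.sqrt_eq_rpow]
              exact Real.sqrt_le_iff.2 ⟨hdI.1, hmS⟩
            have habs : 2 * κ * |y₁| ^ (1 / 2 : ℝ) ≤
                |dpow p ((ξ - y₁) / 2 + d) - dpow p ((ξ - y₁) / 2 - d)| :=
              le_trans (by gcongr) ((hlow d hdI).trans (le_abs_self _))
            calc W * |y₁| ^ α = W / (2 * κ) * |y₁| ^ (α - 1 / 2) *
                (2 * κ * |y₁| ^ (1 / 2 : ℝ)) := by
                  have : |y₁| ^ α = |y₁| ^ (α - 1 / 2) * |y₁| ^ (1 / 2 : ℝ) := by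
                    rw [← Real.rpow_add hy₁']; ring_nf
                  rw [this]
                  field_simp
              _ ≤ _ := by gcongr
          · rw [Set.indicator_apply]
            split_ifs with h
            · refine Set.indicator_of_notMem (fun hm => hdI ?_) _
              obtain ⟨⟨h12, h23, h1, h2, he⟩, h3, h4⟩ := hm
              simp only [hP] at h12 h23 h1 h2 he h3 h4
              refine ⟨?_, h2, by linarith⟩
              linarith [le_abs_self ((ξ - y₁) / 2 - d)]
            · rfl
          · fun_prop
          · exact hσm.comp (by fun_prop : Measurable fun d : ℝ => (y₁, d))
      _ = ENNReal.ofReal (W / (2 * κ)) * ENNReal.ofReal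
          (2 / (α - 1 / 2 + 1) * (2 * ε) ^ (α - 1 / 2 + 1)) * ∫⁻ t, ψ t := by
          rw [lintegral_mul_const, lintegral_const_mul, lintegral_abs_rpow_indicator (by linarith)
            (by linarith)]
          · exact Measurable.indicator (by fun_prop) measurableSet_Icc
          · exact (Measurable.indicator (by fun_prop) measurableSet_Icc).const_mul _
      _ ≤ _ := by
          rw [← ENNReal.ofReal_mul (by positivity)]
          gcongr ENNReal.ofReal ?_ * _
          rw [show α - 1 / 2 + 1 = 1 / 2 + α by ring, Real.mul_rpow (by norm_num) hε.le]
          exact le_of_eq (by ring)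
  -- Where `|y₁|` dominates `d ^ 2`, the inner integral is over `y₁`.
  have part2 : ∫⁻ d, ∫⁻ y₁, Sᶜ.indicator F (y₁, d) * ψ (σ y₁ d) ≤
      ENNReal.ofReal (4 * W / κ * (2 / (2 * α + 1) * 2 ^ (1 / 2 + α)) * ε ^ (1 / 2 + α)) *
        ∫⁻ t, ψ t := by
    calc _ ≤ ∫⁻ d, (ENNReal.ofReal (4 * W / κ) *
          (Set.Icc (-√(2 * ε)) (√(2 * ε))).indicator
            (fun x => ENNReal.ofReal (|x| ^ (2 * α))) d) * ∫⁻ t, ψ t := by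
          refine lintegral_mono_ae ?_
          filter_upwards [compl_mem_ae_iff.2 (measure_singleton (0 : ℝ))] with d hd0
          replace hd0 : d ≠ 0 := hd0
          have hd0' : 0 < |d| := abs_pos.2 hd0
          set I : Set ℝ := {y₁ | 1 ≤ (ξ - y₁) / 2 + d ∧ (ξ - y₁) / 2 + d ≤ 2 ∧
            ((ξ - y₁) / 2 + d) / 2 ≤ (ξ - y₁) / 2 - d ∧ y₁ ≤ ((ξ - y₁) / 2 + d) / 4}
          have hIconv : Convex ℝ I := by
            intro x hx y hy s t hs ht hst
            obtain rfl : t = 1 - s := by linarith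
            simp only [I, Set.mem_ofPred_eq, smul_eq_mul] at hx hy ⊢
            refine ⟨?_, ?_, ?_, ?_⟩ <;> nlinarith
          have hImeas : MeasurableSet I := by
            simp only [I, measurableSet_setOfPred]
            fun_prop
          have hd : ∀ y₁, HasDerivAt (fun y₁ => σ y₁ d)
              (dpow p y₁ - dpow p ((ξ - y₁) / 2 - d) / 2 - dpow p ((ξ - y₁) / 2 + d) / 2) y₁ :=
            fun y₁ => by
              have l : HasDerivAt (fun y₁ : ℝ => (ξ - y₁) / 2) (-1 / 2) y₁ :=
                ((hasDerivAt_id y₁).const_sub ξ).div_const 2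
              have h2 := (hasDerivAt_abs_rpow_dpow hp ((ξ - y₁) / 2 - d)).comp y₁
                (l.sub_const d)
              have h3 := (hasDerivAt_abs_rpow_dpow hp ((ξ - y₁) / 2 + d)).comp y₁
                (l.add_const d)
              have := ((hasDerivAt_abs_rpow_dpow hp y₁).add h2).add h3
              convert! this using 1
              ring
          have hlow : ∀ y₁ ∈ I, dpow p y₁ - dpow p ((ξ - y₁) / 2 - d) / 2 -
              dpow p ((ξ - y₁) / 2 + d) / 2 ≤ -(κ / 4) := fun y₁ hyI => by
            obtain ⟨h1, h2, h3, h4⟩ := hyI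
            have e1 := dpow_mono hp h4
            have e2 := dpow_mono hp h3
            have e3 := dpow_mono hp
              (by linarith : ((ξ - y₁) / 2 + d) / 2 ≤ (ξ - y₁) / 2 + d)
            have e4 := hκm (((ξ - y₁) / 2 + d) / 4) (((ξ - y₁) / 2 + d) / 2) (by linarith)
              (by linarith) (by linarith)
            nlinarith
          have hinj : Set.InjOn (fun y₁ => σ y₁ d) I := by
            refine (strictAntiOn_of_deriv_neg hIconv
              (fun x _ => (hd x).continuousAt.continuousWithinAt) fun x hx => ?_).injOn
            rw [(hd x).deriv]
            linarith [hlow x (interior_subset hx)]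
          refine lintegral_mul_comp_le hImeas (fun x _ => hd x) hinj (fun y₁ hyI => ?_)
            (fun y₁ hyI => ?_) ?_ ?_ hψ
          · by_cases hm : (y₁, d) ∉ S ∧ P y₁ d ∈ B
            swap
            · rw [Set.indicator_apply]
              split_ifs with h
              · rw [hF]
                simp only
                rw [Set.indicator_of_notMem fun hb => hm ⟨h, hb⟩]
                exact zero_le
              · exact zero_le
            obtain ⟨hmS, hmB⟩ := hm
            rw [Set.indicator_of_mem (Set.mem_compl hmS)]
            have hdy : d ^ 2 < |y₁| := not_le.1 hmS
            have hy₁' : 0 < |y₁| := lt_of_le_of_lt (sq_nonneg d) hdy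
            refine (hwt y₁ d (abs_pos.1 hy₁') hmB).trans ?_
            have hmem : d ∈ Set.Icc (-√(2 * ε)) (√(2 * ε)) :=
              abs_le.1 (Real.abs_le_sqrt (hdy.le.trans (hsmall y₁ d hmB)))
            rw [Set.indicator_of_mem hmem, ← ENNReal.ofReal_mul (by positivity),
              ← ENNReal.ofReal_mul (by positivity)]
            refine ENNReal.ofReal_le_ofReal ?_
            have habs : κ / 4 ≤ |dpow p y₁ - dpow p ((ξ - y₁) / 2 - d) / 2 -
                dpow p ((ξ - y₁) / 2 + d) / 2| := by
              rw [le_abs]; right; linarith [hlow y₁ hyI]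
            have hpow : |y₁| ^ α ≤ |d| ^ (2 * α) := by
              rw [Real.rpow_mul (abs_nonneg d), Real.rpow_two, sq_abs]
              exact Real.rpow_le_rpow_of_nonpos (by positivity) hdy.le ha'
            calc W * |y₁| ^ α ≤ W * |d| ^ (2 * α) := by gcongr
              _ = 4 * W / κ * |d| ^ (2 * α) * (κ / 4) := by field_simp
              _ ≤ _ := by gcongr
          · rw [Set.indicator_apply]
            split_ifs with h
            · refine Set.indicator_of_notMem (fun hm => hyI ?_) _
              obtain ⟨⟨h12, h23, h1, h2, he⟩, h3, h4⟩ := hm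
              exact ⟨h1, h2, h3, h4⟩
            · rfl
          · fun_prop
          · exact hσm.comp (by fun_prop : Measurable fun y₁ : ℝ => (y₁, d))
      _ = ENNReal.ofReal (4 * W / κ) * ENNReal.ofReal
          (2 / (2 * α + 1) * √(2 * ε) ^ (2 * α + 1)) * ∫⁻ t, ψ t := by
          rw [lintegral_mul_const, lintegral_const_mul, lintegral_abs_rpow_indicator (by linarith)
            (by positivity)]
          · exact Measurable.indicator (by fun_prop) measurableSet_Icc
          · exact (Measurable.indicator (by fun_prop) measurableSet_Icc).const_mul _
      _ ≤ _ := by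
          rw [← ENNReal.ofReal_mul (by positivity)]
          gcongr ENNReal.ofReal ?_ * _
          rw [Real.sqrt_eq_rpow, ← Real.rpow_mul (by positivity),
            show 1 / 2 * (2 * α + 1) = 1 / 2 + α by ring, Real.mul_rpow (by norm_num) hε.le]
          exact le_of_eq (by ring)
  have hm1 : Measurable fun z : ℝ × ℝ => S.indicator F z * ψ (σ z.1 z.2) :=
    (hFm.indicator hSm).mul (hψ.comp hσm)
  have hm2 : Measurable fun z : ℝ × ℝ => Sᶜ.indicator F z * ψ (σ z.1 z.2) :=
    (hFm.indicator hSm.compl).mul (hψ.comp hσm)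
  calc _ = ∫⁻ y₁, ∫⁻ d, (S.indicator F (y₁, d) * ψ (σ y₁ d) +
        Sᶜ.indicator F (y₁, d) * ψ (σ y₁ d)) := by
        refine lintegral_congr fun y₁ => ?_
        rw [← lintegral_sub_left_eq_self _ ((ξ - y₁) / 2)]
        refine lintegral_congr fun d => ?_
        rw [← add_mul, ← Pi.add_apply, Set.indicator_self_add_compl]
        have : ξ - y₁ - ((ξ - y₁) / 2 - d) = (ξ - y₁) / 2 + d := by ring
        simp only [hF, hP, hσ, sumPow, this]
    _ = (∫⁻ y₁, ∫⁻ d, S.indicator F (y₁, d) * ψ (σ y₁ d)) +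
        ∫⁻ y₁, ∫⁻ d, Sᶜ.indicator F (y₁, d) * ψ (σ y₁ d) := by
        rw [← lintegral_add_left]
        · refine lintegral_congr fun y₁ => ?_
          rw [lintegral_add_left]
          exact hm1.comp (by fun_prop : Measurable fun d : ℝ => (y₁, d))
        · exact Measurable.lintegral_prod_right hm1
    _ = (∫⁻ y₁, ∫⁻ d, S.indicator F (y₁, d) * ψ (σ y₁ d)) +
        ∫⁻ d, ∫⁻ y₁, Sᶜ.indicator F (y₁, d) * ψ (σ y₁ d) := by
        congr 1
        exact lintegral_lintegral_swap hm2.aemeasurable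
    _ ≤ _ := add_le_add part1 part2
    _ = _ := by
        rw [← add_mul, ← ENNReal.ofReal_add (by positivity) (by positivity), ← add_mul]

/-! ### The convolution estimate -/

/-- The map `(y₁, y₂, y₃) ↦ (∑ yᵢ, ∑ |yᵢ| ^ p)`, the sum of three points of the curve. -/
def curveSum (p : ℝ) (y : ℝ × ℝ × ℝ) : ℝ × ℝ :=
  (y.1 + y.2.1 + y.2.2, |y.1| ^ p + |y.2.1| ^ p + |y.2.2| ^ p)

theorem measurable_curveSum (p : ℝ) : Measurable (curveSum p) := by
  unfold curveSum
  fun_prop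

/-- On the plane `∑ yᵢ = ξ`, the distribution of `∑ |yᵢ| ^ p` with respect to the weight has a
density bounded uniformly in `ξ`, with a gain as `ε → 0`. -/
theorem slice_le {p : ℝ} (hp : 1 < p) : ∃ C : ℝ, 0 ≤ C ∧ ∀ ε : ℝ, 0 < ε → ε ≤ 1 →
    ∀ (ξ : ℝ) (ψ : ℝ → ℝ≥0∞), Measurable ψ →
      ∫⁻ y₁, ∫⁻ y₂, (ordReg ε).indicator (sqWeight p) (y₁, y₂, ξ - y₁ - y₂) *
        ψ (sumPow p ξ y₁ y₂) ≤
      ENNReal.ofReal (C * ε ^ (1 / 2 + singExp p)) * ∫⁻ t, ψ t := by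
  obtain ⟨C₁, h₁, H₁⟩ := slice_transversal hp
  obtain ⟨C₂, h₂, H₂⟩ := slice_elliptic hp
  obtain ⟨C₃, h₃, H₃⟩ := slice_parabolic hp
  refine ⟨C₁ + C₂ + C₃, by positivity, fun ε hε hε1 ξ ψ hψ => ?_⟩
  set A : Set (ℝ × ℝ × ℝ) := ordReg ε ∩ {y | y.2.1 ≤ y.2.2 / 2} with hA
  set B : Set (ℝ × ℝ × ℝ) := ordReg ε ∩ {y | y.2.2 / 2 ≤ y.2.1 ∧ y.2.2 / 4 ≤ y.1} with hB
  set D : Set (ℝ × ℝ × ℝ) := ordReg ε ∩ {y | y.2.2 / 2 ≤ y.2.1 ∧ y.1 ≤ y.2.2 / 4} with hD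
  have hAm : MeasurableSet A := by
    refine (measurableSet_ordReg ε).inter ?_
    simp only [measurableSet_setOfPred]
    fun_prop
  have hBm : MeasurableSet B := by
    refine (measurableSet_ordReg ε).inter ?_
    simp only [measurableSet_setOfPred]
    fun_prop
  have hm : ∀ s : Set (ℝ × ℝ × ℝ), MeasurableSet s → Measurable fun z : ℝ × ℝ =>
      s.indicator (sqWeight p) (z.1, z.2, ξ - z.1 - z.2) * ψ (sumPow p ξ z.1 z.2) := by
    intro s hs
    refine (((measurable_sqWeight p).indicator hs).comp (by fun_prop)).mul (hψ.comp ?_)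
    unfold sumPow
    fun_prop
  have hpt : ∀ y, (ordReg ε).indicator (sqWeight p) y ≤ A.indicator (sqWeight p) y +
      B.indicator (sqWeight p) y + D.indicator (sqWeight p) y := by
    intro y
    by_cases hy : y ∈ ordReg ε
    swap
    · rw [Set.indicator_of_notMem hy]; exact zero_le
    rw [Set.indicator_of_mem hy]
    rcases le_total y.2.1 (y.2.2 / 2) with h | h
    · rw [Set.indicator_of_mem (s := A) ⟨hy, h⟩, add_assoc]
      exact le_self_add
    · rcases le_total (y.2.2 / 4) y.1 with h' | h'
      · rw [Set.indicator_of_mem (s := B) ⟨hy, h, h'⟩, add_right_comm]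
        exact le_add_self
      · rw [Set.indicator_of_mem (s := D) ⟨hy, h, h'⟩]
        exact le_add_self
  calc _ ≤ ∫⁻ y₁, ∫⁻ y₂, (A.indicator (sqWeight p) (y₁, y₂, ξ - y₁ - y₂) *
          ψ (sumPow p ξ y₁ y₂) + B.indicator (sqWeight p) (y₁, y₂, ξ - y₁ - y₂) *
          ψ (sumPow p ξ y₁ y₂) + D.indicator (sqWeight p) (y₁, y₂, ξ - y₁ - y₂) *
          ψ (sumPow p ξ y₁ y₂)) := by
        refine lintegral_mono fun y₁ => lintegral_mono fun y₂ => ?_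
        dsimp only
        rw [← add_mul, ← add_mul]
        gcongr
        exact hpt _
    _ = (∫⁻ y₁, ∫⁻ y₂, A.indicator (sqWeight p) (y₁, y₂, ξ - y₁ - y₂) *
          ψ (sumPow p ξ y₁ y₂)) + (∫⁻ y₁, ∫⁻ y₂, B.indicator (sqWeight p)
          (y₁, y₂, ξ - y₁ - y₂) * ψ (sumPow p ξ y₁ y₂)) +
          ∫⁻ y₁, ∫⁻ y₂, D.indicator (sqWeight p) (y₁, y₂, ξ - y₁ - y₂) *
          ψ (sumPow p ξ y₁ y₂) := by
        rw [← lintegral_add_left (hm A hAm).lintegral_prod_right,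
          ← lintegral_add_left]
        · refine lintegral_congr fun y₁ => ?_
          have hy : Measurable fun d : ℝ => (y₁, d) := by fun_prop
          rw [lintegral_add_left, lintegral_add_left]
          · exact (hm A hAm).comp hy
          · exact ((hm A hAm).comp hy).add ((hm B hBm).comp hy)
        · exact (hm A hAm).lintegral_prod_right.add (hm B hBm).lintegral_prod_right
    _ ≤ _ := add_le_add (add_le_add (H₁ ε hε hε1 ξ ψ hψ) (H₂ ε hε hε1 ξ ψ hψ))
        (H₃ ε hε hε1 ξ ψ hψ)
    _ = _ := by
        rw [← add_mul, ← add_mul, ← ENNReal.ofReal_add (by positivity) (by positivity),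
          ← ENNReal.ofReal_add (by positivity) (by positivity), ← add_mul, ← add_mul]

/-- The mass, with respect to the weight, that `Ψ` pulled back by `curveSum` gives to a set. -/
def curveMass (p : ℝ) (Ψ : ℝ × ℝ → ℝ≥0∞) (s : Set (ℝ × ℝ × ℝ)) : ℝ≥0∞ :=
  ∫⁻ y in s, sqWeight p y * Ψ (curveSum p y)

theorem curveMass_mono (p : ℝ) (Ψ : ℝ × ℝ → ℝ≥0∞) {s t : Set (ℝ × ℝ × ℝ)} (h : s ⊆ t) :
    curveMass p Ψ s ≤ curveMass p Ψ t :=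
  lintegral_mono_set h

theorem curveMass_union_le (p : ℝ) (Ψ : ℝ × ℝ → ℝ≥0∞) (s t : Set (ℝ × ℝ × ℝ)) :
    curveMass p Ψ (s ∪ t) ≤ curveMass p Ψ s + curveMass p Ψ t :=
  lintegral_union_le _ s t

/-- The bound for the slices, integrated over the sum `ξ = ∑ yᵢ`. -/
theorem curveMass_ordReg_le {p : ℝ} (hp : 1 < p) : ∃ C : ℝ, 0 ≤ C ∧ ∀ ε : ℝ, 0 < ε → ε ≤ 1 →
    ∀ Ψ : ℝ × ℝ → ℝ≥0∞, Measurable Ψ → curveMass p Ψ (ordReg ε) ≤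
      ENNReal.ofReal (C * ε ^ (1 / 2 + singExp p)) * ∫⁻ z, Ψ z := by
  obtain ⟨C, hC, H⟩ := slice_le hp
  refine ⟨C, hC, fun ε hε hε1 Ψ hΨ => ?_⟩
  have hKm : Measurable fun y => (ordReg ε).indicator (sqWeight p) y * Ψ (curveSum p y) :=
    ((measurable_sqWeight p).indicator (measurableSet_ordReg ε)).mul
      (hΨ.comp (measurable_curveSum p))
  set K : ℝ × ℝ × ℝ → ℝ≥0∞ := fun y => (ordReg ε).indicator (sqWeight p) y * Ψ (curveSum p y)
  calc curveMass p Ψ (ordReg ε) = ∫⁻ y, K y := by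
        rw [curveMass, ← lintegral_indicator (measurableSet_ordReg ε)]
        refine lintegral_congr fun y => ?_
        simp only [K]
        rw [Set.indicator_mul_left]
    _ = ∫⁻ y₁, ∫⁻ y₂, ∫⁻ y₃, K (y₁, y₂, y₃) := by
        rw [Measure.volume_eq_prod, lintegral_prod _ hKm.aemeasurable]
        refine lintegral_congr fun y₁ => ?_
        rw [Measure.volume_eq_prod, lintegral_prod]
        exact (hKm.comp (by fun_prop : Measurable fun z : ℝ × ℝ => (y₁, z))).aemeasurable
    _ = ∫⁻ y₁, ∫⁻ y₂, ∫⁻ ξ, K (y₁, y₂, ξ - y₁ - y₂) := by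
        refine lintegral_congr fun y₁ => lintegral_congr fun y₂ => ?_
        rw [← lintegral_sub_right_eq_self _ (y₁ + y₂)]
        simp only [sub_sub]
    _ = ∫⁻ y₁, ∫⁻ ξ, ∫⁻ y₂, K (y₁, y₂, ξ - y₁ - y₂) := by
        refine lintegral_congr fun y₁ => lintegral_lintegral_swap ?_
        exact (hKm.comp (by fun_prop :
          Measurable fun z : ℝ × ℝ => (y₁, z.1, z.2 - y₁ - z.1))).aemeasurable
    _ = ∫⁻ ξ, ∫⁻ y₁, ∫⁻ y₂, K (y₁, y₂, ξ - y₁ - y₂) := by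
        refine lintegral_lintegral_swap (Measurable.aemeasurable ?_)
        exact Measurable.lintegral_prod_right (hKm.comp (by fun_prop :
          Measurable fun z : (ℝ × ℝ) × ℝ => (z.1.1, z.2, z.1.2 - z.1.1 - z.2)))
    _ ≤ ∫⁻ ξ, ENNReal.ofReal (C * ε ^ (1 / 2 + singExp p)) * ∫⁻ t, Ψ (ξ, t) := by
        refine lintegral_mono fun ξ => ?_
        refine le_trans (le_of_eq ?_) (H ε hε hε1 ξ (fun t => Ψ (ξ, t)) (by fun_prop))
        refine lintegral_congr fun y₁ => lintegral_congr fun y₂ => ?_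
        simp only [K, curveSum, sumPow]
        congr 3
        ring
    _ = _ := by
        rw [lintegral_const_mul _ hΨ.lintegral_prod_right', Measure.volume_eq_prod,
          lintegral_prod _ hΨ.aemeasurable]

/-- Exchange of the first two coordinates. -/
def swapFst : (ℝ × ℝ × ℝ) ≃ᵐ (ℝ × ℝ × ℝ) where
  toFun y := (y.2.1, y.1, y.2.2)
  invFun y := (y.2.1, y.1, y.2.2)
  left_inv _ := rfl
  right_inv _ := rfl
  measurable_toFun := by dsimp; fun_prop
  measurable_invFun := by dsimp; fun_prop

/-- Exchange of the last two coordinates. -/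
def swapSnd : (ℝ × ℝ × ℝ) ≃ᵐ (ℝ × ℝ × ℝ) :=
  (MeasurableEquiv.refl ℝ).prodCongr MeasurableEquiv.prodComm

theorem measurePreserving_swapSnd : MeasurePreserving swapSnd :=
  (MeasurePreserving.id volume).prod Measure.measurePreserving_swap

theorem measurePreserving_swapFst : MeasurePreserving swapFst := by
  have h1 := volume_preserving_prodAssoc (α₁ := ℝ) (β₁ := ℝ) (γ₁ := ℝ)
  have h2 : MeasurePreserving (Prod.map Prod.swap id : (ℝ × ℝ) × ℝ → (ℝ × ℝ) × ℝ) :=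
    Measure.measurePreserving_swap.prod (MeasurePreserving.id volume)
  exact (h1.comp h2).comp h1.symm

theorem curveMass_preimage_swapFst (p : ℝ) (Ψ : ℝ × ℝ → ℝ≥0∞) (s : Set (ℝ × ℝ × ℝ)) :
    curveMass p Ψ (swapFst ⁻¹' s) = curveMass p Ψ s := by
  rw [curveMass, curveMass, ← measurePreserving_swapFst.setLIntegral_comp_preimage_emb
    swapFst.measurableEmbedding]
  refine lintegral_congr fun y => ?_
  simp only [sqWeight, curveSum, swapFst, MeasurableEquiv.coe_mk, Equiv.coe_fn_mk]
  congr 2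
  · ring
  · congr 1 <;> ring

theorem curveMass_preimage_swapSnd (p : ℝ) (Ψ : ℝ × ℝ → ℝ≥0∞) (s : Set (ℝ × ℝ × ℝ)) :
    curveMass p Ψ (swapSnd ⁻¹' s) = curveMass p Ψ s := by
  rw [curveMass, curveMass, ← measurePreserving_swapSnd.setLIntegral_comp_preimage_emb
    swapSnd.measurableEmbedding]
  refine lintegral_congr fun y => ?_
  have : swapSnd y = (y.1, y.2.2, y.2.1) := rfl
  simp only [sqWeight, curveSum, this]
  congr 2
  · ring
  · congr 1 <;> ring

/-- Instance search does not unfold `volume` on triples to a product measure. -/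
instance isAddHaarMeasure_volume_triple :
    (volume : Measure (ℝ × ℝ × ℝ)).IsAddHaarMeasure :=
  Measure.prod.instIsAddHaarMeasure (volume : Measure ℝ) (volume : Measure (ℝ × ℝ))

theorem curveMass_preimage_neg (p : ℝ) (Ψ : ℝ × ℝ → ℝ≥0∞) (s : Set (ℝ × ℝ × ℝ)) :
    curveMass p Ψ (Neg.neg ⁻¹' s) = curveMass p (fun z => Ψ (-z.1, z.2)) s := by
  have h := (Measure.measurePreserving_neg
    (volume : Measure (ℝ × ℝ × ℝ))).setLIntegral_comp_preimage_emb
    (MeasurableEquiv.neg (ℝ × ℝ × ℝ)).measurableEmbedding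
    (fun y => sqWeight p y * Ψ (curveSum p y)) (Neg.neg ⁻¹' s)
  rw [curveMass, curveMass, ← h, ← Set.preimage_comp, neg_comp_neg, Set.preimage_id]
  refine lintegral_congr fun y => ?_
  simp only [sqWeight, curveSum, Prod.fst_neg, Prod.snd_neg, abs_neg]
  congr 3
  ring

/-- The largest absolute value of the coordinates. -/
def maxAbs (y : ℝ × ℝ × ℝ) : ℝ := max |y.1| (max |y.2.1| |y.2.2|)

/-- The smallest absolute value of the coordinates. -/
def minAbs (y : ℝ × ℝ × ℝ) : ℝ := min |y.1| (min |y.2.1| |y.2.2|)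

/-- The twelve images of `ordReg ε` under reflection and permutations of the coordinates cover the
shell. -/
theorem curveMass_shell_le {p : ℝ} (hp : 1 < p) : ∃ C : ℝ, 0 ≤ C ∧ ∀ ε : ℝ, 0 < ε → ε ≤ 1 →
    ∀ Ψ : ℝ × ℝ → ℝ≥0∞, Measurable Ψ →
      curveMass p Ψ {y | 1 ≤ maxAbs y ∧ maxAbs y ≤ 2 ∧ minAbs y ≤ ε * maxAbs y} ≤
      ENNReal.ofReal (C * ε ^ (1 / 2 + singExp p)) * ∫⁻ z, Ψ z := by
  obtain ⟨C, hC, H⟩ := curveMass_ordReg_le hp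
  refine ⟨12 * C, by positivity, fun ε hε hε1 Ψ hΨ => ?_⟩
  set b := ENNReal.ofReal (C * ε ^ (1 / 2 + singExp p)) * ∫⁻ z, Ψ z with hb
  set D₂ : Set (ℝ × ℝ × ℝ) := {y | |y.1| ≤ |y.2.1| ∧ |y.2.1| ≤ |y.2.2| ∧ 1 ≤ |y.2.2| ∧
    |y.2.2| ≤ 2 ∧ |y.1| ≤ ε * |y.2.2|}
  set D₃ : Set (ℝ × ℝ × ℝ) := {y | |y.1| ≤ |y.2.2| ∧ |y.2.1| ≤ |y.2.2| ∧ 1 ≤ |y.2.2| ∧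
    |y.2.2| ≤ 2 ∧ (|y.1| ≤ ε * |y.2.2| ∨ |y.2.1| ≤ ε * |y.2.2|)}
  have hnegint : ∫⁻ z : ℝ × ℝ, Ψ (-z.1, z.2) = ∫⁻ z, Ψ z := by
    rw [Measure.volume_eq_prod, lintegral_prod_symm' _ (by fun_prop), lintegral_prod_symm' _ hΨ]
    refine lintegral_congr fun t => ?_
    exact lintegral_neg_eq_self (μ := volume) fun x => Ψ (x, t)
  have h₂ : curveMass p Ψ D₂ ≤ b + b := by
    have hsub : D₂ ⊆ ordReg ε ∪ Neg.neg ⁻¹' ordReg ε := by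
      rintro y ⟨h1, h2, h3, h4, h5⟩
      rcases abs_cases y.2.2 with ⟨h, -⟩ | ⟨h, -⟩
      · rw [h] at h2 h3 h4 h5
        exact Or.inl ⟨h1, h2, h3, h4, h5⟩
      · rw [h] at h2 h3 h4 h5
        refine Or.inr ?_
        simp only [ordReg, Set.mem_preimage, Set.mem_ofPred_eq, Prod.fst_neg, Prod.snd_neg,
          abs_neg]
        exact ⟨h1, h2, h3, h4, h5⟩
    refine ((curveMass_mono p Ψ hsub).trans (curveMass_union_le _ _ _ _)).trans
      (add_le_add (H ε hε hε1 Ψ hΨ) ?_)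
    rw [curveMass_preimage_neg, hb, ← hnegint]
    exact H ε hε hε1 _ (by fun_prop)
  have h₃ : curveMass p Ψ D₃ ≤ (b + b) + (b + b) := by
    have hsub : D₃ ⊆ D₂ ∪ swapFst ⁻¹' D₂ := by
      rintro y ⟨h1, h2, h3, h4, h5⟩
      rcases le_total |y.1| |y.2.1| with h | h
      · refine Or.inl ⟨h, h2, h3, h4, ?_⟩
        rcases h5 with h5 | h5
        · exact h5
        · exact h.trans h5
      · refine Or.inr ⟨h, h1, h3, h4, ?_⟩
        rcases h5 with h5 | h5
        · exact h.trans h5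
        · exact h5
    refine ((curveMass_mono p Ψ hsub).trans (curveMass_union_le _ _ _ _)).trans
      (add_le_add h₂ ?_)
    rw [curveMass_preimage_swapFst]
    exact h₂
  have hsub : {y | 1 ≤ maxAbs y ∧ maxAbs y ≤ 2 ∧ minAbs y ≤ ε * maxAbs y} ⊆
      D₃ ∪ (swapSnd ⁻¹' D₃ ∪ swapFst ⁻¹' (swapSnd ⁻¹' D₃)) := by
    rintro ⟨y₁, y₂, y₃⟩ ⟨h1, h2, h3⟩
    have hor : minAbs (y₁, y₂, y₃) = |y₁| ∨ minAbs (y₁, y₂, y₃) = |y₂| ∨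
        minAbs (y₁, y₂, y₃) = |y₃| := by
      unfold minAbs
      rcases min_choice |y₁| (min |y₂| |y₃|) with h | h
      · exact Or.inl h
      · rcases min_choice |y₂| |y₃| with h' | h' <;> simp_all
    have ha : |y₁| ≤ maxAbs (y₁, y₂, y₃) := le_max_left _ _
    have hb : |y₂| ≤ maxAbs (y₁, y₂, y₃) := (le_max_left _ _).trans (le_max_right _ _)
    have hc : |y₃| ≤ maxAbs (y₁, y₂, y₃) := (le_max_right _ _).trans (le_max_right _ _)
    have ha' : minAbs (y₁, y₂, y₃) ≤ |y₁| := min_le_left _ _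
    have hb' : minAbs (y₁, y₂, y₃) ≤ |y₂| := (min_le_right _ _).trans (min_le_left _ _)
    have hc' : minAbs (y₁, y₂, y₃) ≤ |y₃| := (min_le_right _ _).trans (min_le_right _ _)
    have hor' : maxAbs (y₁, y₂, y₃) = |y₃| ∨ maxAbs (y₁, y₂, y₃) = |y₂| ∨
        maxAbs (y₁, y₂, y₃) = |y₁| := by
      unfold maxAbs
      rcases max_choice |y₁| (max |y₂| |y₃|) with h | h
      · exact Or.inr (Or.inr h)
      · rcases max_choice |y₂| |y₃| with h' | h' <;> simp_all
    rcases hor' with h | h | h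
    · refine Or.inl ?_
      rw [h] at ha hb hc h1 h2 h3
      refine ⟨ha, hb, h1, h2, ?_⟩
      dsimp only
      rcases hor with h' | h' | h' <;> rw [h'] at h3
      · exact Or.inl h3
      · exact Or.inr h3
      · exact Or.inl (ha.trans h3)
    · refine Or.inr (Or.inl ?_)
      rw [h] at ha hb hc h1 h2 h3
      refine ⟨ha, hc, h1, h2, ?_⟩
      change |y₁| ≤ ε * |y₂| ∨ |y₃| ≤ ε * |y₂|
      rcases hor with h' | h' | h' <;> rw [h'] at h3
      · exact Or.inl h3
      · exact Or.inl (ha.trans h3)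
      · exact Or.inr h3
    · refine Or.inr (Or.inr ?_)
      rw [h] at ha hb hc h1 h2 h3
      refine ⟨hb, hc, h1, h2, ?_⟩
      change |y₂| ≤ ε * |y₁| ∨ |y₃| ≤ ε * |y₁|
      rcases hor with h' | h' | h' <;> rw [h'] at h3
      · exact Or.inl (hb.trans h3)
      · exact Or.inl h3
      · exact Or.inr h3
  calc _ ≤ curveMass p Ψ D₃ + (curveMass p Ψ (swapSnd ⁻¹' D₃) +
        curveMass p Ψ (swapFst ⁻¹' (swapSnd ⁻¹' D₃))) :=
        (curveMass_mono p Ψ hsub).trans ((curveMass_union_le _ _ _ _).trans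
          (add_le_add_right (curveMass_union_le _ _ _ _) _))
    _ ≤ ((b + b) + (b + b)) + (((b + b) + (b + b)) + ((b + b) + (b + b))) := by
        rw [curveMass_preimage_swapFst, curveMass_preimage_swapSnd]
        gcongr
    _ = 12 * b := by ring
    _ = _ := by
        rw [hb, ← mul_assoc, mul_assoc (12 : ℝ), ENNReal.ofReal_mul (p := 12) (by norm_num)]
        norm_num

theorem lintegral_comp_mul_left {r : ℝ} (hr : 0 < r) {f : ℝ → ℝ≥0∞} (hf : Measurable f) :
    ∫⁻ x, f (r * x) = ENNReal.ofReal r⁻¹ * ∫⁻ x, f x := by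
  rw [← lintegral_map hf (by fun_prop), Real.map_volume_mul_left hr.ne', lintegral_smul_measure,
    abs_of_pos (inv_pos.2 hr), smul_eq_mul]

theorem maxAbs_smul {r : ℝ} (hr : 0 < r) (y : ℝ × ℝ × ℝ) : maxAbs (r • y) = r * maxAbs y := by
  simp only [maxAbs, Prod.smul_fst, Prod.smul_snd, smul_eq_mul, abs_mul, abs_of_pos hr,
    mul_max_of_nonneg _ _ hr.le]

theorem minAbs_smul {r : ℝ} (hr : 0 < r) (y : ℝ × ℝ × ℝ) : minAbs (r • y) = r * minAbs y := by
  simp only [minAbs, Prod.smul_fst, Prod.smul_snd, smul_eq_mul, abs_mul, abs_of_pos hr,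
    mul_min_of_nonneg _ _ hr.le]

theorem measurable_maxAbs : Measurable maxAbs := by unfold maxAbs; fun_prop

theorem measurable_minAbs : Measurable minAbs := by unfold minAbs; fun_prop

/-- The curve and the weight are homogeneous, so the estimate for the shell `1 ≤ maxAbs y ≤ 2`
holds with the same constant on all its dilates. -/
theorem curveMass_dilate_shell_le {p : ℝ} (hp : 1 < p) :
    ∃ C : ℝ, 0 ≤ C ∧ ∀ ε : ℝ, 0 < ε → ε ≤ 1 → ∀ r : ℝ, 0 < r →
    ∀ Ψ : ℝ × ℝ → ℝ≥0∞, Measurable Ψ →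
      curveMass p Ψ {y | r ≤ maxAbs y ∧ maxAbs y ≤ 2 * r ∧ minAbs y ≤ ε * maxAbs y} ≤
      ENNReal.ofReal (C * ε ^ (1 / 2 + singExp p)) * ∫⁻ z, Ψ z := by
  obtain ⟨C, hC, H⟩ := curveMass_shell_le hp
  refine ⟨C, hC, fun ε hε hε1 r hr Ψ hΨ => ?_⟩
  have hrp : 0 < r ^ p := Real.rpow_pos_of_pos hr p
  set s : Set (ℝ × ℝ × ℝ) := {y | r ≤ maxAbs y ∧ maxAbs y ≤ 2 * r ∧ minAbs y ≤ ε * maxAbs y}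
    with hs
  have hsm : MeasurableSet s := by
    have := measurable_maxAbs
    have := measurable_minAbs
    simp only [hs, measurableSet_setOfPred]
    fun_prop
  have hpre : (fun y : ℝ × ℝ × ℝ => r • y) ⁻¹' s =
      {y | 1 ≤ maxAbs y ∧ maxAbs y ≤ 2 ∧ minAbs y ≤ ε * maxAbs y} := by
    ext y
    simp only [hs, Set.mem_preimage, Set.mem_ofPred_eq, maxAbs_smul hr, minAbs_smul hr]
    refine and_congr ?_ (and_congr ?_ ?_)
    · exact le_mul_iff_one_le_right hr
    · rw [mul_comm 2 r]; exact mul_le_mul_iff_right₀ hr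
    · rw [mul_left_comm]; exact mul_le_mul_iff_right₀ hr
  have hKm : Measurable fun y => sqWeight p y * Ψ (curveSum p y) :=
    (measurable_sqWeight p).mul (hΨ.comp (measurable_curveSum p))
  have hfin : Module.finrank ℝ (ℝ × ℝ × ℝ) = 3 := by simp
  have hscale : ∀ y : ℝ × ℝ × ℝ, sqWeight p (r • y) = ENNReal.ofReal (r ^ (p - 2)) *
      sqWeight p y := by
    intro y
    simp only [sqWeight, Prod.smul_fst, Prod.smul_snd, smul_eq_mul, abs_mul, abs_of_pos hr]
    rw [← ENNReal.ofReal_mul (by positivity)]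
    congr 1
    rw [Real.mul_rpow hr.le (abs_nonneg _), Real.mul_rpow hr.le (abs_nonneg _),
      Real.mul_rpow hr.le (abs_nonneg _), show r ^ (p - 2) = r ^ ((p - 2) / 3) *
      r ^ ((p - 2) / 3) * r ^ ((p - 2) / 3) by
        rw [← Real.rpow_add hr, ← Real.rpow_add hr]; ring_nf]
    ring
  have hcurve : ∀ y : ℝ × ℝ × ℝ, curveSum p (r • y) =
      (r * (curveSum p y).1, r ^ p * (curveSum p y).2) := by
    intro y
    simp only [curveSum, Prod.smul_fst, Prod.smul_snd, smul_eq_mul, abs_mul, abs_of_pos hr]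
    rw [Real.mul_rpow hr.le (abs_nonneg _), Real.mul_rpow hr.le (abs_nonneg _),
      Real.mul_rpow hr.le (abs_nonneg _)]
    congr 1 <;> ring
  have h1 : ENNReal.ofReal (r ^ 3)⁻¹ * curveMass p Ψ s = ENNReal.ofReal (r ^ (p - 2)) *
      curveMass p (fun z => Ψ (r * z.1, r ^ p * z.2))
        {y | 1 ≤ maxAbs y ∧ maxAbs y ≤ 2 ∧ minAbs y ≤ ε * maxAbs y} := by
    have hmap := Measure.map_addHaar_smul (volume : Measure (ℝ × ℝ × ℝ)) hr.ne'
    rw [hfin, abs_of_pos (by positivity)] at hmap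
    have hmeas : Measurable fun y : ℝ × ℝ × ℝ => r • y := measurable_const_smul r
    calc _ = ∫⁻ y in s, sqWeight p y * Ψ (curveSum p y) ∂(Measure.map (r • ·) volume) := by
          rw [hmap, Measure.restrict_smul, lintegral_smul_measure, curveMass, smul_eq_mul]
      _ = ∫⁻ y in (fun y : ℝ × ℝ × ℝ => r • y) ⁻¹' s,
            sqWeight p (r • y) * Ψ (curveSum p (r • y)) := by
          rw [setLIntegral_map hsm hKm hmeas]
      _ = _ := by
          rw [hpre, curveMass, ← lintegral_const_mul]
          · refine lintegral_congr fun y => ?_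
            rw [hscale, hcurve, mul_assoc]
          · have := measurable_curveSum p
            have := measurable_sqWeight p
            fun_prop
  have h2 : ∫⁻ z : ℝ × ℝ, Ψ (r * z.1, r ^ p * z.2) =
      ENNReal.ofReal r⁻¹ * (ENNReal.ofReal (r ^ p)⁻¹ * ∫⁻ z, Ψ z) := by
    rw [Measure.volume_eq_prod, lintegral_prod _ (by fun_prop), lintegral_prod _ (by fun_prop)]
    calc _ = ∫⁻ x : ℝ, ENNReal.ofReal (r ^ p)⁻¹ * ∫⁻ t, Ψ (r * x, t) := by
          refine lintegral_congr fun x => ?_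
          exact lintegral_comp_mul_left hrp (f := fun t => Ψ (r * x, t)) (by fun_prop)
      _ = ∫⁻ x : ℝ, (fun x => ENNReal.ofReal (r ^ p)⁻¹ * ∫⁻ t, Ψ (x, t)) (r * x) := rfl
      _ = _ := by
          refine (lintegral_comp_mul_left hr (hΨ.lintegral_prod_right'.const_mul _)).trans ?_
          rw [lintegral_const_mul _ hΨ.lintegral_prod_right']
  have h3 := H ε hε hε1 (fun z => Ψ (r * z.1, r ^ p * z.2)) (by fun_prop)
  have hr3 : ENNReal.ofReal (r ^ 3) * ENNReal.ofReal (r ^ 3)⁻¹ = 1 := by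
    rw [← ENNReal.ofReal_mul (by positivity), mul_inv_cancel₀ (by positivity), ENNReal.ofReal_one]
  calc curveMass p Ψ s = ENNReal.ofReal (r ^ 3) * (ENNReal.ofReal (r ^ 3)⁻¹ * curveMass p Ψ s) := by
        rw [← mul_assoc, hr3, one_mul]
    _ ≤ ENNReal.ofReal (r ^ 3) * (ENNReal.ofReal (r ^ (p - 2)) *
          (ENNReal.ofReal (C * ε ^ (1 / 2 + singExp p)) *
          (ENNReal.ofReal r⁻¹ * (ENNReal.ofReal (r ^ p)⁻¹ * ∫⁻ z, Ψ z)))) := by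
        rw [h1, ← h2]
        gcongr
    _ = (ENNReal.ofReal (r ^ 3) * ENNReal.ofReal (r ^ (p - 2)) * ENNReal.ofReal r⁻¹ *
          ENNReal.ofReal (r ^ p)⁻¹) *
          (ENNReal.ofReal (C * ε ^ (1 / 2 + singExp p)) * ∫⁻ z, Ψ z) := by ring
    _ = _ := by
        rw [← ENNReal.ofReal_mul (by positivity), ← ENNReal.ofReal_mul (by positivity),
          ← ENNReal.ofReal_mul (by positivity)]
        have : r ^ 3 * r ^ (p - 2) * r⁻¹ * (r ^ p)⁻¹ = 1 := by
          rw [Real.rpow_sub hr, Real.rpow_two]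
          field_simp
        rw [this, ENNReal.ofReal_one, one_mul]

/-- The images of the dyadic shells under `curveSum` overlap at most three times. This is what
makes the bounds for the single shells summable. -/
theorem tsum_dyadic_indicator_le {p : ℝ} (hp : 1 < p) (Ψ : ℝ × ℝ → ℝ≥0∞) (z : ℝ × ℝ) :
    ∑' n : ℤ, {z : ℝ × ℝ | ((2 : ℝ) ^ n) ^ p ≤ z.2 ∧ z.2 ≤ 3 * (2 * (2 : ℝ) ^ n) ^ p}.indicator
      Ψ z ≤ 3 * Ψ z := by
  have hp0 : 0 < p := by linarith
  rcases le_or_gt z.2 0 with h0 | h0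
  · rw [ENNReal.tsum_eq_zero.2]
    · exact zero_le
    · refine fun n => Set.indicator_of_notMem (fun h => ?_) _
      have : 0 < ((2 : ℝ) ^ n) ^ p := by positivity
      linarith [h.1]
  obtain ⟨N, hN1, hN2⟩ := exists_mem_Ico_zpow (x := z.2 ^ (1 / p)) (y := 2) (by positivity)
    (by norm_num)
  have hroot : ∀ x : ℝ, 0 ≤ x → (x ^ p) ^ (1 / p) = x := fun x hx => by
    rw [← Real.rpow_mul hx, mul_one_div_cancel hp0.ne', Real.rpow_one]
  rw [tsum_eq_sum (s := Finset.Icc (N - 2) N)]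
  · calc _ ≤ ∑ n ∈ Finset.Icc (N - 2) N, Ψ z :=
          Finset.sum_le_sum fun n _ => Set.indicator_le_self _ _ _
      _ = 3 * Ψ z := by
          rw [Finset.sum_const, Int.card_Icc, show N + 1 - (N - 2) = 3 by ring]
          simp
  · intro n hn
    refine Set.indicator_of_notMem (fun h => hn ?_) _
    obtain ⟨h1, h2⟩ := h
    rw [Finset.mem_Icc]
    constructor
    · have e : z.2 ^ (1 / p) ≤ 3 * (2 * (2 : ℝ) ^ n) := by
        calc z.2 ^ (1 / p) ≤ (3 * (2 * (2 : ℝ) ^ n) ^ p) ^ (1 / p) := by gcongr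
          _ = 3 ^ (1 / p) * (2 * (2 : ℝ) ^ n) := by
            rw [Real.mul_rpow (by norm_num) (by positivity), hroot _ (by positivity)]
          _ ≤ 3 ^ (1 : ℝ) * (2 * (2 : ℝ) ^ n) := by
            gcongr
            · norm_num
            · rw [div_le_one hp0]; exact hp.le
          _ = _ := by rw [Real.rpow_one]
      have e2 : (2 : ℝ) ^ N < 2 ^ (n + 3) := by
        rw [zpow_add₀ (by norm_num)]
        have : (0 : ℝ) < 2 ^ n := by positivity
        norm_num
        linarith
      have := (zpow_lt_zpow_iff_right₀ (by norm_num : (1 : ℝ) < 2)).1 e2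
      linarith
    · have e : (2 : ℝ) ^ n ≤ z.2 ^ (1 / p) := by
        rw [← hroot ((2 : ℝ) ^ n) (by positivity)]
        gcongr
      have := (zpow_lt_zpow_iff_right₀ (by norm_num : (1 : ℝ) < 2)).1 (e.trans_lt hN2)
      linarith

/-- The threefold convolution of the weighted measure on the curve has bounded density, and the
part of it coming from triples with one entry much smaller than another has small density. -/
theorem curveMass_gap_le {p : ℝ} (hp : 1 < p) : ∃ C : ℝ, 0 ≤ C ∧ ∀ ε : ℝ, 0 < ε → ε ≤ 1 →
    ∀ Ψ : ℝ × ℝ → ℝ≥0∞, Measurable Ψ → curveMass p Ψ {y | minAbs y ≤ ε * maxAbs y} ≤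
      ENNReal.ofReal (C * ε ^ (1 / 2 + singExp p)) * ∫⁻ z, Ψ z := by
  obtain ⟨C, hC, H⟩ := curveMass_dilate_shell_le hp
  refine ⟨3 * C, by positivity, fun ε hε hε1 Ψ hΨ => ?_⟩
  have hp0 : 0 < p := by linarith
  set s : ℤ → Set (ℝ × ℝ × ℝ) := fun n =>
    {y | (2 : ℝ) ^ n ≤ maxAbs y ∧ maxAbs y ≤ 2 * (2 : ℝ) ^ n ∧ minAbs y ≤ ε * maxAbs y} with hs
  set J : ℤ → Set (ℝ × ℝ) := fun n =>
    {z | ((2 : ℝ) ^ n) ^ p ≤ z.2 ∧ z.2 ≤ 3 * (2 * (2 : ℝ) ^ n) ^ p} with hJ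
  have hsm : ∀ n, MeasurableSet (s n) := fun n => by
    have := measurable_maxAbs
    have := measurable_minAbs
    simp only [hs, measurableSet_setOfPred]
    fun_prop
  have hJm : ∀ n, MeasurableSet (J n) := fun n => by
    simp only [hJ, measurableSet_setOfPred]
    fun_prop
  have hnull : volume ({0} : Set (ℝ × ℝ × ℝ)) = 0 := measure_singleton 0
  have hcover : {y | minAbs y ≤ ε * maxAbs y} ⊆ {0} ∪ ⋃ n, s n := by
    intro y hy
    rcases (le_trans (abs_nonneg _) (le_max_left _ _) : 0 ≤ maxAbs y).eq_or_lt with h | h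
    · left
      have h1 : |y.1| ≤ 0 := by rw [h]; exact le_max_left _ _
      have h2 : |y.2.1| ≤ 0 := by rw [h]; exact (le_max_left _ _).trans (le_max_right _ _)
      have h3 : |y.2.2| ≤ 0 := by rw [h]; exact (le_max_right _ _).trans (le_max_right _ _)
      rw [abs_nonpos_iff] at h1 h2 h3
      exact Prod.ext h1 (Prod.ext h2 h3)
    · right
      obtain ⟨n, hn1, hn2⟩ := exists_mem_Ico_zpow h (by norm_num : (1 : ℝ) < 2)
      refine Set.mem_iUnion.2 ⟨n, hn1, ?_, hy⟩
      rw [zpow_add_one₀ (by norm_num)] at hn2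
      linarith
  have hloc : ∀ n, curveMass p Ψ (s n) = curveMass p ((J n).indicator Ψ) (s n) := by
    intro n
    refine setLIntegral_congr_fun (hsm n) fun y hy => ?_
    rw [Set.indicator_of_mem]
    obtain ⟨h1, h2, -⟩ := hy
    have hmax : maxAbs y = |y.1| ∨ maxAbs y = |y.2.1| ∨ maxAbs y = |y.2.2| := by
      unfold maxAbs
      rcases max_choice |y.1| (max |y.2.1| |y.2.2|) with h | h
      · exact Or.inl h
      · rcases max_choice |y.2.1| |y.2.2| with h' | h' <;> simp_all
    have n1 : 0 ≤ |y.1| ^ p := by positivity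
    have n2 : 0 ≤ |y.2.1| ^ p := by positivity
    have n3 : 0 ≤ |y.2.2| ^ p := by positivity
    have hmono : ∀ x : ℝ, 0 ≤ x → x ≤ maxAbs y → x ^ p ≤ (2 * (2 : ℝ) ^ n) ^ p := fun x hx hx' =>
      Real.rpow_le_rpow hx (hx'.trans h2) hp0.le
    constructor
    · calc ((2 : ℝ) ^ n) ^ p ≤ maxAbs y ^ p := by gcongr
        _ ≤ (curveSum p y).2 := by
          simp only [curveSum]
          rcases hmax with h | h | h <;> rw [h] <;> linarith
    · have e1 := hmono |y.1| (abs_nonneg _) (le_max_left _ _)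
      have e2 := hmono |y.2.1| (abs_nonneg _) ((le_max_left _ _).trans (le_max_right _ _))
      have e3 := hmono |y.2.2| (abs_nonneg _) ((le_max_right _ _).trans (le_max_right _ _))
      simp only [curveSum]
      linarith
  calc curveMass p Ψ {y | minAbs y ≤ ε * maxAbs y}
      ≤ curveMass p Ψ {0} + curveMass p Ψ (⋃ n, s n) :=
        (curveMass_mono p Ψ hcover).trans (curveMass_union_le _ _ _ _)
    _ = curveMass p Ψ (⋃ n, s n) := by
        rw [curveMass, setLIntegral_measure_zero _ _ hnull, zero_add]
    _ ≤ ∑' n, curveMass p Ψ (s n) := lintegral_iUnion_le _ _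
    _ ≤ ∑' n, ENNReal.ofReal (C * ε ^ (1 / 2 + singExp p)) * ∫⁻ z, (J n).indicator Ψ z := by
        refine ENNReal.tsum_le_tsum fun n => ?_
        rw [hloc n]
        exact H ε hε hε1 _ (by positivity) _ (hΨ.indicator (hJm n))
    _ = ENNReal.ofReal (C * ε ^ (1 / 2 + singExp p)) * ∫⁻ z, ∑' n, (J n).indicator Ψ z := by
        rw [ENNReal.tsum_mul_left, lintegral_tsum fun n => (hΨ.indicator (hJm n)).aemeasurable]
    _ ≤ ENNReal.ofReal (C * ε ^ (1 / 2 + singExp p)) * ∫⁻ z, 3 * Ψ z := by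
        gcongr with z
        exact tsum_dyadic_indicator_le hp Ψ z
    _ = _ := by
        rw [lintegral_const_mul _ hΨ, ← mul_assoc, mul_comm _ (3 : ℝ≥0∞), mul_assoc (3 : ℝ),
          ENNReal.ofReal_mul (p := 3) (by norm_num)]
        norm_num

/-! ### The adjoint restriction operator on triples -/

/-- The weight `|y₁ y₂ y₃| ^ ((p - 2) / 6)`. -/
def tripleWeight (p : ℝ) (y : ℝ × ℝ × ℝ) : ℝ :=
  |y.1| ^ ((p - 2) / 6) * |y.2.1| ^ ((p - 2) / 6) * |y.2.2| ^ ((p - 2) / 6)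

theorem measurable_tripleWeight (p : ℝ) : Measurable (tripleWeight p) := by
  unfold tripleWeight
  fun_prop

theorem tripleWeight_nonneg (p : ℝ) (y : ℝ × ℝ × ℝ) : 0 ≤ tripleWeight p y := by
  unfold tripleWeight
  positivity

/-- The sum of three points of the curve, as a complex number; the factor `1 / (2 π)` adapts it
to the normalization of the Fourier transform. -/
def freq (p : ℝ) (y : ℝ × ℝ × ℝ) : ℂ :=
  ⟨(curveSum p y).1 / (2 * Real.pi), (curveSum p y).2 / (2 * Real.pi)⟩

theorem measurable_complex_mk : Measurable fun z : ℝ × ℝ => (⟨z.1, z.2⟩ : ℂ) :=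
  Complex.measurableEquivRealProd.symm.measurable

theorem measurable_freq (p : ℝ) : Measurable (freq p) := by
  have := measurable_curveSum p
  exact measurable_complex_mk.comp (by fun_prop :
    Measurable fun y => ((curveSum p y).1 / (2 * Real.pi), (curveSum p y).2 / (2 * Real.pi)))

theorem enorm_tripleWeight_mul_sq (p : ℝ) (y : ℝ × ℝ × ℝ) (c : ℂ) :
    ‖(tripleWeight p y : ℂ) * c‖ₑ ^ 2 = sqWeight p y * ‖c‖ₑ ^ 2 := by
  have hsq : ∀ x : ℝ, (|x| ^ ((p - 2) / 6)) ^ 2 = |x| ^ ((p - 2) / 3) := fun x => by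
    rw [← Real.rpow_natCast, ← Real.rpow_mul (abs_nonneg x)]
    congr 1
    push_cast
    ring
  rw [enorm_mul, mul_pow]
  congr 1
  rw [← ofReal_norm, Complex.norm_real, Real.norm_of_nonneg (tripleWeight_nonneg p y),
    ← ENNReal.ofReal_pow (tripleWeight_nonneg p y), sqWeight, tripleWeight, mul_pow, mul_pow,
    hsq, hsq, hsq]

theorem lintegral_gap_freq_le {p : ℝ} (hp : 1 < p) : ∃ C : ℝ, 0 ≤ C ∧ ∀ ε : ℝ, 0 < ε → ε ≤ 1 →
    ∀ Ψ : ℂ → ℝ≥0∞, Measurable Ψ →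
      ∫⁻ y in {y | minAbs y ≤ ε * maxAbs y}, sqWeight p y * Ψ (freq p y) ≤
      ENNReal.ofReal (C * ε ^ (1 / 2 + singExp p)) * ∫⁻ z, Ψ z := by
  obtain ⟨C, hC, H⟩ := curveMass_gap_le hp
  refine ⟨C * (2 * Real.pi) ^ 2, by positivity, fun ε hε hε1 Ψ hΨ => ?_⟩
  have hpi : (0 : ℝ) < (2 * Real.pi)⁻¹ := by positivity
  have hΨ' : Measurable fun z : ℝ × ℝ => Ψ ⟨z.1, z.2⟩ := hΨ.comp measurable_complex_mk
  have hΨ'' : Measurable fun z : ℝ × ℝ => Ψ ⟨z.1 / (2 * Real.pi), z.2 / (2 * Real.pi)⟩ :=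
    hΨ'.comp (by fun_prop : Measurable fun z : ℝ × ℝ =>
      (z.1 / (2 * Real.pi), z.2 / (2 * Real.pi)))
  refine (H ε hε hε1 _ hΨ'').trans (le_of_eq ?_)
  have e1 : ∫⁻ z : ℝ × ℝ, Ψ ⟨z.1 / (2 * Real.pi), z.2 / (2 * Real.pi)⟩ =
      ENNReal.ofReal ((2 * Real.pi) ^ 2) * ∫⁻ z : ℝ × ℝ, Ψ ⟨z.1, z.2⟩ := by
    rw [Measure.volume_eq_prod, lintegral_prod _ hΨ''.aemeasurable,
      lintegral_prod _ hΨ'.aemeasurable]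
    calc _ = ∫⁻ x : ℝ, (fun x => ENNReal.ofReal ((2 * Real.pi)⁻¹)⁻¹ * ∫⁻ t, Ψ ⟨x, t⟩)
          ((2 * Real.pi)⁻¹ * x) := by
          refine lintegral_congr fun x => ?_
          have := lintegral_comp_mul_left hpi (f := fun t => Ψ ⟨(2 * Real.pi)⁻¹ * x, t⟩)
            (hΨ'.comp (by fun_prop : Measurable fun t : ℝ => ((2 * Real.pi)⁻¹ * x, t)))
          dsimp only
          rw [← this]
          refine lintegral_congr fun t => ?_
          simp only [div_eq_inv_mul]
      _ = _ := by
          refine (lintegral_comp_mul_left hpi (hΨ'.lintegral_prod_right'.const_mul _)).trans ?_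
          rw [lintegral_const_mul _ hΨ'.lintegral_prod_right', ← mul_assoc,
            ← ENNReal.ofReal_mul (by positivity), inv_inv, sq]
  have e2 : ∫⁻ z : ℝ × ℝ, Ψ ⟨z.1, z.2⟩ = ∫⁻ z, Ψ z :=
    Complex.volume_preserving_equiv_real_prod.symm.lintegral_comp hΨ
  rw [e1, e2, ← mul_assoc, ← ENNReal.ofReal_mul (by positivity)]
  congr 2
  ring

theorem gap_one : {y : ℝ × ℝ × ℝ | minAbs y ≤ 1 * maxAbs y} = Set.univ := by
  ext y
  simp only [one_mul, Set.mem_ofPred_eq, Set.mem_univ, iff_true]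
  exact (min_le_left _ _).trans (le_max_left _ _)

/-- Almost everywhere statements on the plane pull back to triples. -/
theorem ae_freq {p : ℝ} (hp : 1 < p) {P : ℂ → Prop} (h : ∀ᵐ z, P z) :
    ∀ᵐ y : ℝ × ℝ × ℝ, tripleWeight p y ≠ 0 → P (freq p y) := by
  obtain ⟨C, hC, H⟩ := lintegral_gap_freq_le hp
  set N := toMeasurable volume {z | ¬ P z} with hN
  have hN0 : volume N = 0 := by rw [hN, measure_toMeasurable]; exact h
  have hNm : MeasurableSet N := measurableSet_toMeasurable _ _
  have h1 := H 1 one_pos le_rfl (N.indicator fun _ => 1) (measurable_const.indicator hNm)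
  rw [gap_one, setLIntegral_univ, lintegral_indicator_const hNm, hN0, mul_zero, mul_zero,
    nonpos_iff_eq_zero, lintegral_eq_zero_iff] at h1
  · filter_upwards [h1] with y hy hw
    by_contra hP
    have hmem : freq p y ∈ N := subset_toMeasurable _ _ hP
    simp only [Set.indicator_of_mem hmem, mul_one, Pi.zero_apply] at hy
    have := enorm_tripleWeight_mul_sq p y 1
    rw [hy] at this
    simp [hw] at this
  · exact (measurable_sqWeight p).mul ((measurable_const.indicator hNm).comp (measurable_freq p))

/-- The square-integrable complex-valued functions on triples of real numbers. -/
abbrev L2Triple := Lp ℂ 2 (volume : Measure (ℝ × ℝ × ℝ))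

/-- The square-integrable complex-valued functions on the plane. -/
abbrev L2Plane := Lp ℂ 2 (volume : Measure ℂ)

/-- The pullback of a function on the plane to triples, times the weight. -/
def pullback (p : ℝ) (ψ : ℂ → ℂ) (y : ℝ × ℝ × ℝ) : ℂ := (tripleWeight p y : ℂ) * ψ (freq p y)

theorem aestronglyMeasurable_pullback (p : ℝ) {ψ : ℂ → ℂ} (hψ : StronglyMeasurable ψ) :
    AEStronglyMeasurable (pullback p ψ) volume := by
  refine AEStronglyMeasurable.mul ?_ (hψ.comp_measurable (measurable_freq p)).aestronglyMeasurable
  have := measurable_tripleWeight p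
  exact Measurable.aestronglyMeasurable (by fun_prop)

theorem pullback_ae_congr {p : ℝ} (hp : 1 < p) {ψ χ : ℂ → ℂ} (h : ψ =ᵐ[volume] χ) :
    pullback p ψ =ᵐ[volume] pullback p χ := by
  filter_upwards [ae_freq hp h] with y hy
  by_cases hw : tripleWeight p y = 0
  · simp [pullback, hw]
  · simp only [pullback, hy hw]

theorem eLpNorm_two_sq {α : Type*} [MeasurableSpace α] {μ : Measure α} (f : α → ℂ) :
    eLpNorm f 2 μ ^ 2 = ∫⁻ x, ‖f x‖ₑ ^ 2 ∂μ := by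
  have := eLpNorm_nnreal_pow_eq_lintegral (μ := μ) (f := f) (p := 2) (by norm_num)
  simpa using this

/-- The pullback of `ψ` is square integrable, by `curveMass_gap_le` applied to `|ψ| ^ 2`, and small
on the triples with one entry much smaller than another. -/
theorem eLpNorm_indicator_pullback_le {p : ℝ} (hp : 1 < p) : ∃ C : ℝ, 0 ≤ C ∧
    ∀ ε : ℝ, 0 < ε → ε ≤ 1 → ∀ ψ : ℂ → ℂ, StronglyMeasurable ψ →
      eLpNorm ({y | minAbs y ≤ ε * maxAbs y}.indicator (pullback p ψ)) 2 volume ≤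
        ENNReal.ofReal (C * ε ^ ((1 / 2 + singExp p) / 2)) * eLpNorm ψ 2 volume := by
  obtain ⟨C, hC, H⟩ := lintegral_gap_freq_le hp
  refine ⟨√C, by positivity, fun ε hε hε1 ψ hψ => ?_⟩
  have hm : MeasurableSet {y : ℝ × ℝ × ℝ | minAbs y ≤ ε * maxAbs y} :=
    measurableSet_le measurable_minAbs (measurable_maxAbs.const_mul ε)
  rw [← ENNReal.pow_le_pow_left_iff two_ne_zero, mul_pow, eLpNorm_two_sq, eLpNorm_two_sq]
  · have e : ENNReal.ofReal (√C * ε ^ ((1 / 2 + singExp p) / 2)) ^ 2 =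
        ENNReal.ofReal (C * ε ^ (1 / 2 + singExp p)) := by
      rw [← ENNReal.ofReal_pow (by positivity), mul_pow, Real.sq_sqrt hC, ← Real.rpow_natCast,
        ← Real.rpow_mul hε.le]
      congr 3
      push_cast
      ring
    rw [e]
    refine le_trans (le_of_eq ?_) (H ε hε hε1 (fun z => ‖ψ z‖ₑ ^ 2)
      (hψ.measurable.enorm.pow_const 2))
    rw [← lintegral_indicator hm]
    refine lintegral_congr fun y => ?_
    by_cases hy : y ∈ {y : ℝ × ℝ × ℝ | minAbs y ≤ ε * maxAbs y}
    · rw [Set.indicator_of_mem hy, Set.indicator_of_mem hy, pullback, enorm_tripleWeight_mul_sq]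
    · rw [Set.indicator_of_notMem hy, Set.indicator_of_notMem hy]
      simp

theorem memLp_pullback {p : ℝ} (hp : 1 < p) {ψ : ℂ → ℂ} (hψ : StronglyMeasurable ψ)
    (hψ2 : MemLp ψ 2 volume) : MemLp (pullback p ψ) 2 volume := by
  obtain ⟨C, hC, H⟩ := eLpNorm_indicator_pullback_le hp
  have h := H 1 one_pos le_rfl ψ hψ
  rw [gap_one, Set.indicator_univ] at h
  exact ⟨aestronglyMeasurable_pullback p hψ, h.trans_lt (ENNReal.mul_lt_top ENNReal.ofReal_lt_top hψ2.2)⟩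

/-- The pullback operator `ψ ↦ tripleWeight p · ψ ∘ freq p` from functions on the plane to
functions on triples. -/
def pullbackL {p : ℝ} (hp : 1 < p) : L2Plane →L[ℂ] L2Triple :=
  LinearMap.mkContinuousOfExistsBound
    { toFun := fun ψ => (memLp_pullback hp (Lp.stronglyMeasurable ψ) (Lp.memLp ψ)).toLp _
      map_add' := fun ψ χ => by
        rw [← MemLp.toLp_add]
        refine (MemLp.toLp_eq_toLp_iff _ _).2 ?_
        refine (pullback_ae_congr hp (Lp.coeFn_add ψ χ)).trans (Eventually.of_forall fun y => ?_)
        simp only [pullback, Pi.add_apply, mul_add]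
      map_smul' := fun c ψ => by
        rw [RingHom.id_apply, ← MemLp.toLp_const_smul]
        refine (MemLp.toLp_eq_toLp_iff _ _).2 ?_
        refine (pullback_ae_congr hp (Lp.coeFn_smul c ψ)).trans (Eventually.of_forall fun y => ?_)
        simp only [pullback, Pi.smul_apply, smul_eq_mul]
        ring }
    (by
      obtain ⟨C, hC, H⟩ := eLpNorm_indicator_pullback_le hp
      refine ⟨C, fun ψ => ?_⟩
      have h := H 1 one_pos le_rfl ψ (Lp.stronglyMeasurable ψ)
      rw [gap_one, Set.indicator_univ, Real.one_rpow, mul_one] at h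
      simp only [LinearMap.coe_mk, AddHom.coe_mk, Lp.norm_toLp]
      refine (ENNReal.toReal_mono (ENNReal.mul_ne_top ENNReal.ofReal_ne_top
        (Lp.eLpNorm_ne_top ψ)) h).trans ?_
      rw [ENNReal.toReal_mul, ENNReal.toReal_ofReal hC, ← Lp.norm_def])

theorem coeFn_pullbackL {p : ℝ} (hp : 1 < p) (ψ : L2Plane) :
    pullbackL hp ψ =ᵐ[volume] pullback p ψ :=
  (memLp_pullback hp (Lp.stronglyMeasurable ψ) (Lp.memLp ψ)).coeFn_toLp

/-- The adjoint of the pullback. It sends a function `k` on triples to the density of the image of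
`k` times the weight under the sum map, which is the Fourier transform of the corresponding
product of three extensions. -/
def pushL {p : ℝ} (hp : 1 < p) : L2Triple →L[ℂ] L2Plane := (pullbackL hp).adjoint

theorem inner_pushL {p : ℝ} (hp : 1 < p) (k : L2Triple) (ψ : L2Plane) :
    inner ℂ (pushL hp k) ψ = inner ℂ k (pullbackL hp ψ) :=
  ContinuousLinearMap.adjoint_inner_left _ _ _

theorem inner_indicator_right {α : Type*} [MeasurableSpace α] {μ : Measure α}
    (k : Lp ℂ 2 μ) {s : Set α} (h : ∀ᵐ y ∂μ, y ∉ s → k y = 0) (u : Lp ℂ 2 μ)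
    (hu : MemLp (s.indicator u) 2 μ) : inner ℂ k u = inner ℂ k (hu.toLp _) := by
  rw [L2.inner_def, L2.inner_def]
  refine integral_congr_ae ?_
  filter_upwards [h, hu.coeFn_toLp] with y h1 h2
  rw [h2]
  by_cases hy : y ∈ s
  · rw [Set.indicator_of_mem hy]
  · rw [h1 hy, inner_zero_left, inner_zero_left]

/-- The pushforward is small on functions supported where one variable is much smaller than
another. -/
theorem norm_pushL_gap_le {p : ℝ} (hp : 1 < p) : ∃ C : ℝ, 0 ≤ C ∧ ∀ ε : ℝ, 0 < ε → ε ≤ 1 →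
    ∀ k : L2Triple, (∀ᵐ y, y ∉ {y : ℝ × ℝ × ℝ | minAbs y ≤ ε * maxAbs y} → k y = 0) →
      ‖pushL hp k‖ ≤ C * ε ^ ((1 / 2 + singExp p) / 2) * ‖k‖ := by
  obtain ⟨C, hC, H⟩ := eLpNorm_indicator_pullback_le hp
  refine ⟨C, hC, fun ε hε hε1 k hk => ?_⟩
  have hm : MeasurableSet {y : ℝ × ℝ × ℝ | minAbs y ≤ ε * maxAbs y} :=
    measurableSet_le measurable_minAbs (measurable_maxAbs.const_mul ε)
  set ψ := pushL hp k
  have hu := (Lp.memLp (pullbackL hp ψ)).indicator hm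
  have hnorm : ‖hu.toLp _‖ ≤ C * ε ^ ((1 / 2 + singExp p) / 2) * ‖ψ‖ := by
    rw [Lp.norm_toLp]
    have h := H ε hε hε1 ψ (Lp.stronglyMeasurable ψ)
    have hcongr : eLpNorm ({y | minAbs y ≤ ε * maxAbs y}.indicator (pullbackL hp ψ)) 2 volume =
        eLpNorm ({y | minAbs y ≤ ε * maxAbs y}.indicator (pullback p ψ)) 2 volume := by
      refine eLpNorm_congr_ae ?_
      filter_upwards [coeFn_pullbackL hp ψ] with y hy
      simp only [Set.indicator_apply, hy]
    rw [hcongr]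
    refine (ENNReal.toReal_mono (ENNReal.mul_ne_top ENNReal.ofReal_ne_top
      (Lp.eLpNorm_ne_top ψ)) h).trans ?_
    rw [ENNReal.toReal_mul, ENNReal.toReal_ofReal (by positivity), ← Lp.norm_def]
  rcases (norm_nonneg ψ).eq_or_lt with h0 | h0
  · rw [← h0]; positivity
  refine le_of_mul_le_mul_right ?_ h0
  calc ‖ψ‖ * ‖ψ‖ = ‖inner ℂ ψ ψ‖ := by
        rw [inner_self_eq_norm_sq_to_K, norm_pow, sq]; simp
    _ = ‖inner ℂ k (hu.toLp _)‖ := by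
        rw [← inner_indicator_right k hk, ← inner_pushL]
    _ ≤ ‖k‖ * ‖hu.toLp _‖ := norm_inner_le_norm _ _
    _ ≤ ‖k‖ * (C * ε ^ ((1 / 2 + singExp p) / 2) * ‖ψ‖) := by gcongr
    _ = _ := by ring

theorem memLp_real_mul {α : Type*} [MeasurableSpace α] {μ : Measure α} {a : α → ℝ}
    (ha : Measurable a) {M : ℝ} (hM : ∀ x, |a x| ≤ M) {u : α → ℂ} (hu : MemLp u 2 μ) :
    MemLp (fun x => (a x : ℂ) * u x) 2 μ := by
  refine hu.of_le_mul (c := M) ?_ (Eventually.of_forall fun x => ?_)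
  · exact AEStronglyMeasurable.mul (Measurable.aestronglyMeasurable (by fun_prop)) hu.1
  · rw [norm_mul, Complex.norm_real, Real.norm_eq_abs]
    gcongr
    exact hM x

/-- A bounded factor depending only on `∑ |yᵢ| ^ p` can be moved from one argument of the
positive form `⟪T k₁, T k₂⟫` to the other, because the pushforward `T` intertwines it with
multiplication by a function on the plane. -/
theorem inner_pushL_transfer {p : ℝ} (hp : 1 < p) {a : ℝ → ℝ} (ha : Measurable a) {M : ℝ}
    (hM : ∀ x, |a x| ≤ M) {k₁ k₁' k₂ k₂' : L2Triple}
    (h₁ : ∀ᵐ y, k₁ y = a (curveSum p y).2 * k₁' y)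
    (h₂ : ∀ᵐ y, k₂' y = a (curveSum p y).2 * k₂ y) :
    inner ℂ (pushL hp k₁) (pushL hp k₂) = inner ℂ (pushL hp k₁') (pushL hp k₂') := by
  have ham : Measurable fun z : ℂ => a (2 * Real.pi * z.im) := by
    have := Complex.measurable_im
    fun_prop
  have hmul : ∀ ψ : L2Plane, MemLp (fun z : ℂ => (a (2 * Real.pi * z.im) : ℂ) * ψ z) 2 volume :=
    fun ψ => memLp_real_mul ham (fun z => hM _) (Lp.memLp ψ)
  have hpull : ∀ ψ : L2Plane, ∀ᵐ y, pullbackL hp ((hmul ψ).toLp _) y =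
      a (curveSum p y).2 * pullbackL hp ψ y := by
    intro ψ
    filter_upwards [coeFn_pullbackL hp ((hmul ψ).toLp _), coeFn_pullbackL hp ψ,
      pullback_ae_congr hp (hmul ψ).coeFn_toLp] with y h1 h2 h3
    rw [h1, h2, h3]
    simp only [pullback, freq]
    have : 2 * Real.pi * ((curveSum p y).2 / (2 * Real.pi)) = (curveSum p y).2 := by
      field_simp
    rw [this]
    ring
  have hadj : ∀ {k k' : L2Triple}, (∀ᵐ y, k y = a (curveSum p y).2 * k' y) → ∀ ψ : L2Plane,
      inner ℂ (pushL hp k) ψ = inner ℂ (pushL hp k') ((hmul ψ).toLp _) := by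
    intro k k' hk ψ
    rw [inner_pushL, inner_pushL, L2.inner_def, L2.inner_def]
    refine integral_congr_ae ?_
    filter_upwards [hk, hpull ψ] with y h1 h2
    rw [h1, h2]
    simp only [RCLike.inner_apply, map_mul, Complex.conj_ofReal]
    ring
  have hsymm : ∀ ψ χ : L2Plane, inner ℂ ψ ((hmul χ).toLp _) = inner ℂ ((hmul ψ).toLp _) χ := by
    intro ψ χ
    rw [L2.inner_def, L2.inner_def]
    refine integral_congr_ae ?_
    filter_upwards [(hmul ψ).coeFn_toLp, (hmul χ).coeFn_toLp] with z h1 h2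
    rw [h1, h2]
    simp only [RCLike.inner_apply, map_mul, Complex.conj_ofReal]
    ring
  have hk2 : pushL hp k₂' = (hmul (pushL hp k₂)).toLp _ := by
    refine ext_inner_right ℂ fun χ => ?_
    rw [hadj h₂, hsymm]
  rw [hadj h₁, hk2]

theorem tripleWeight_swapFst (p : ℝ) (y : ℝ × ℝ × ℝ) :
    tripleWeight p (swapFst y) = tripleWeight p y := by
  have : swapFst y = (y.2.1, y.1, y.2.2) := rfl
  rw [this]
  simp only [tripleWeight]
  ring

theorem curveSum_swapFst (p : ℝ) (y : ℝ × ℝ × ℝ) : curveSum p (swapFst y) = curveSum p y := by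
  have : swapFst y = (y.2.1, y.1, y.2.2) := rfl
  rw [this]
  simp only [curveSum]
  congr 1 <;> ring

theorem tripleWeight_swapSnd (p : ℝ) (y : ℝ × ℝ × ℝ) :
    tripleWeight p (swapSnd y) = tripleWeight p y := by
  have : swapSnd y = (y.1, y.2.2, y.2.1) := rfl
  rw [this]
  simp only [tripleWeight]
  ring

theorem curveSum_swapSnd (p : ℝ) (y : ℝ × ℝ × ℝ) : curveSum p (swapSnd y) = curveSum p y := by
  have : swapSnd y = (y.1, y.2.2, y.2.1) := rfl
  rw [this]
  simp only [curveSum]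
  congr 1 <;> ring

/-- The pushforward does not distinguish the order of the variables. -/
theorem pushL_eq_of_symm {p : ℝ} (hp : 1 < p) {σ : (ℝ × ℝ × ℝ) ≃ᵐ (ℝ × ℝ × ℝ)}
    (hσ : MeasurePreserving σ) (hW : ∀ y, tripleWeight p (σ y) = tripleWeight p y)
    (hc : ∀ y, curveSum p (σ y) = curveSum p y) {k k' : L2Triple}
    (h : ∀ᵐ y, k y = k' (σ y)) : pushL hp k = pushL hp k' := by
  refine ext_inner_right ℂ fun ψ => ?_
  rw [inner_pushL, inner_pushL, L2.inner_def, L2.inner_def,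
    ← hσ.integral_comp σ.measurableEmbedding fun y => inner ℂ (k' y) (pullbackL hp ψ y)]
  refine integral_congr_ae ?_
  have h2 := coeFn_pullbackL hp ψ
  filter_upwards [h, h2, hσ.quasiMeasurePreserving.ae h2] with y h1 h2 h3
  rw [h1, h2, h3]
  simp only [pullback, freq, hW, hc]

/-! ### The extension operator and the Fourier transform -/

/-- The tensor product of three functions of one variable. -/
def tens (f g h : ℝ → ℂ) (y : ℝ × ℝ × ℝ) : ℂ := f y.1 * (g y.2.1 * h y.2.2)

theorem aestronglyMeasurable_tens {f g h : ℝ → ℂ} (hf : AEStronglyMeasurable f volume)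
    (hg : AEStronglyMeasurable g volume) (hh : AEStronglyMeasurable h volume) :
    AEStronglyMeasurable (tens f g h) volume :=
  hf.comp_fst.mul (hg.comp_fst.mul hh.comp_snd).comp_snd

theorem eLpNorm_tens {f g h : ℝ → ℂ} (hf : AEStronglyMeasurable f volume)
    (hg : AEStronglyMeasurable g volume) (hh : AEStronglyMeasurable h volume) :
    eLpNorm (tens f g h) 2 volume =
      eLpNorm f 2 volume * (eLpNorm g 2 volume * eLpNorm h 2 volume) := by
  have h2 : ∀ {u : ℝ → ℂ}, AEStronglyMeasurable u volume →
      AEMeasurable (fun x => ‖u x‖ₑ ^ 2) volume := fun hu => hu.enorm.pow_const 2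
  have hinj := (ENNReal.pow_right_strictMono (n := 2) two_ne_zero).injective
  refine hinj ?_
  simp only [mul_pow, eLpNorm_two_sq]
  calc _ = ∫⁻ y : ℝ × ℝ × ℝ, ‖f y.1‖ₑ ^ 2 * (fun z : ℝ × ℝ => ‖g z.1‖ₑ ^ 2 * ‖h z.2‖ₑ ^ 2) y.2 := by
        refine lintegral_congr fun y => ?_
        simp only [tens, enorm_mul, mul_pow]
    _ = _ := by
        have hgh : AEMeasurable (fun z : ℝ × ℝ => ‖g z.1‖ₑ ^ 2 * ‖h z.2‖ₑ ^ 2) volume :=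
          (h2 hg).comp_fst.mul (h2 hh).comp_snd
        rw [Measure.volume_eq_prod, lintegral_prod_mul (h2 hf) hgh, Measure.volume_eq_prod,
          lintegral_prod_mul (h2 hg) (h2 hh)]

theorem memLp_tens {f g h : ℝ → ℂ} (hf : MemLp f 2 volume) (hg : MemLp g 2 volume)
    (hh : MemLp h 2 volume) : MemLp (tens f g h) 2 volume := by
  refine ⟨aestronglyMeasurable_tens hf.1 hg.1 hh.1, ?_⟩
  rw [eLpNorm_tens hf.1 hg.1 hh.1]
  exact ENNReal.mul_lt_top hf.2 (ENNReal.mul_lt_top hg.2 hh.2)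

theorem integrable_weight_mul {p : ℝ} (hp : 1 < p) {h : ℝ → ℂ} (hh : MemLp h 2 volume) {R : ℝ}
    (hR : 0 ≤ R) (hsupp : ∀ x ∉ Set.Icc (-R) R, h x = 0) :
    Integrable (fun y => ((|y| ^ ((p - 2) / 6) : ℝ) : ℂ) * h y) volume := by
  set w : ℝ → ℂ := (Set.Icc (-R) R).indicator fun y => ((|y| ^ ((p - 2) / 6) : ℝ) : ℂ)
  have hw : MemLp w 2 volume := by
    refine ⟨(Measurable.aestronglyMeasurable (by fun_prop)).indicator measurableSet_Icc, ?_⟩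
    have : eLpNorm w 2 volume ^ 2 < ∞ := by
      rw [eLpNorm_two_sq]
      refine lt_of_eq_of_lt ?_ (lt_of_eq_of_lt (lintegral_abs_rpow_indicator
        (r := (p - 2) / 3) (by linarith) hR) ENNReal.ofReal_lt_top)
      refine lintegral_congr fun y => ?_
      by_cases hy : y ∈ Set.Icc (-R) R
      · simp only [w, Set.indicator_of_mem hy]
        rw [← ofReal_norm, Complex.norm_real, Real.norm_of_nonneg (by positivity),
          ← ENNReal.ofReal_pow (by positivity), ← Real.rpow_natCast,
          ← Real.rpow_mul (abs_nonneg y)]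
        congr 2
        push_cast
        ring
      · simp only [w, Set.indicator_of_notMem hy]
        simp
    by_contra hcon
    rw [not_lt, top_le_iff] at hcon
    simp [hcon] at this
  refine (hw.integrable_mul hh).congr (Eventually.of_forall fun y => ?_)
  by_cases hy : y ∈ Set.Icc (-R) R
  · simp only [w, Pi.mul_apply, Set.indicator_of_mem hy]
  · simp only [w, Pi.mul_apply, hsupp y hy, mul_zero]

/-- The oscillating factor of the product of three extensions. -/
def phase (p : ℝ) (z : ℂ) (y : ℝ × ℝ × ℝ) : ℂ :=
  Complex.exp (Complex.I * ((z.re * (curveSum p y).1 + z.im * (curveSum p y).2 : ℝ) : ℂ))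

theorem norm_phase (p : ℝ) (z : ℂ) (y : ℝ × ℝ × ℝ) : ‖phase p z y‖ = 1 := by
  rw [phase, mul_comm]
  exact Complex.norm_exp_ofReal_mul_I _

theorem extIntegral_cube (p : ℝ) (h : ℝ → ℂ) (z : ℂ) :
    extIntegral p h (z.re, z.im) ^ 3 =
      ∫ y : ℝ × ℝ × ℝ, phase p z y * ((tripleWeight p y : ℂ) * tens h h h y) := by
  rw [pow_succ', sq]
  simp only [extIntegral]
  rw [← integral_prod_mul, ← integral_prod_mul]
  refine integral_congr_ae (Eventually.of_forall fun y => ?_)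
  simp only [phase, tripleWeight, tens, curveSum]
  have e : Complex.I * ((z.re * (y.1 + y.2.1 + y.2.2) +
      z.im * (|y.1| ^ p + |y.2.1| ^ p + |y.2.2| ^ p) : ℝ) : ℂ) =
      Complex.I * ((z.re * y.1 : ℝ) : ℂ) + Complex.I * ((z.im * |y.1| ^ p : ℝ) : ℂ) +
      (Complex.I * ((z.re * y.2.1 : ℝ) : ℂ) + Complex.I * ((z.im * |y.2.1| ^ p : ℝ) : ℂ)) +
      (Complex.I * ((z.re * y.2.2 : ℝ) : ℂ) + Complex.I * ((z.im * |y.2.2| ^ p : ℝ) : ℂ)) := by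
    push_cast
    ring
  rw [e, Complex.exp_add, Complex.exp_add, Complex.exp_add, Complex.exp_add, Complex.exp_add]
  push_cast
  ring

theorem conj_phase (p : ℝ) (z : ℂ) (y : ℝ × ℝ × ℝ) :
    (starRingEnd ℂ) (phase p z y) =
      Complex.exp (((-2 * Real.pi * inner ℝ z (freq p y) : ℝ) : ℂ) * Complex.I) := by
  rw [phase, ← Complex.exp_conj]
  congr 1
  have : -2 * Real.pi * inner ℝ z (freq p y) =
      -(z.re * (curveSum p y).1 + z.im * (curveSum p y).2) := by
    rw [Complex.inner]
    simp only [freq, Complex.mul_re, Complex.conj_re, Complex.conj_im]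
    field_simp
    ring
  rw [this, map_mul, Complex.conj_I, Complex.conj_ofReal]
  push_cast
  ring

theorem measurable_phase (p : ℝ) : Measurable fun q : ℂ × (ℝ × ℝ × ℝ) => phase p q.1 q.2 := by
  have h1 := measurable_curveSum p
  have h2 : Measurable fun q : ℂ × (ℝ × ℝ × ℝ) => q.1.re := Complex.measurable_re.comp measurable_fst
  have h3 : Measurable fun q : ℂ × (ℝ × ℝ × ℝ) => q.1.im := Complex.measurable_im.comp measurable_fst
  unfold phase
  fun_prop

theorem integrable_tripleWeight_tens {p : ℝ} (hp : 1 < p) {h : ℝ → ℂ} (hh : MemLp h 2 volume)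
    {R : ℝ} (hR : 0 ≤ R) (hsupp : ∀ x ∉ Set.Icc (-R) R, h x = 0) :
    Integrable (fun y => (tripleWeight p y : ℂ) * tens h h h y) volume := by
  have h1 := integrable_weight_mul hp hh hR hsupp
  refine (h1.mul_prod (h1.mul_prod h1)).congr (Eventually.of_forall fun y => ?_)
  simp only [tripleWeight, tens]
  push_cast
  ring

open FourierTransform SchwartzMap in
/-- The cube of the extension, as a distribution: Fubini's theorem turns the pairing with a test
function `ψ` into the pairing of `h ⊗ h ⊗ h` with the pullback of `𝓕 ψ`. -/
theorem integral_conj_cube_mul {p : ℝ} (hp : 1 < p) {h : ℝ → ℂ} (hh : MemLp h 2 volume)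
    {R : ℝ} (hR : 0 ≤ R) (hsupp : ∀ x ∉ Set.Icc (-R) R, h x = 0) (ψ : 𝓢(ℂ, ℂ)) :
    ∫ z : ℂ, (starRingEnd ℂ) (extIntegral p h (z.re, z.im) ^ 3) * ψ z =
      inner ℂ ((memLp_tens hh hh hh).toLp _) (pullbackL hp ((𝓕 ψ).toLp 2)) := by
  have hint := integrable_tripleWeight_tens hp hh hR hsupp
  have hint' : Integrable (fun y => (starRingEnd ℂ) ((tripleWeight p y : ℂ) * tens h h h y))
      volume := by
    refine hint.norm.mono' (Complex.continuous_conj.comp_aestronglyMeasurable hint.1) ?_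
    exact Eventually.of_forall fun y => by rw [RCLike.norm_conj]
  calc _ = ∫ z : ℂ, ∫ y, (starRingEnd ℂ) (phase p z y) *
        (ψ z * (starRingEnd ℂ) ((tripleWeight p y : ℂ) * tens h h h y)) := by
        refine integral_congr_ae (Eventually.of_forall fun z => ?_)
        dsimp only
        rw [extIntegral_cube, ← integral_conj, ← integral_mul_const]
        refine integral_congr_ae (Eventually.of_forall fun y => ?_)
        simp only [map_mul]
        ring
    _ = ∫ y, ∫ z : ℂ, (starRingEnd ℂ) (phase p z y) *
        (ψ z * (starRingEnd ℂ) ((tripleWeight p y : ℂ) * tens h h h y)) := by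
        refine integral_integral_swap ?_
        refine Integrable.bdd_mul (c := 1) (ψ.integrable.mul_prod hint') ?_
          (Eventually.of_forall fun q => ?_)
        · exact (Complex.continuous_conj.measurable.comp (measurable_phase p)).aestronglyMeasurable
        · simp [norm_phase]
    _ = ∫ y, (starRingEnd ℂ) (tens h h h y) * pullback p (𝓕 ψ : 𝓢(ℂ, ℂ)) y := by
        refine integral_congr_ae (Eventually.of_forall fun y => ?_)
        dsimp only
        rw [pullback, SchwartzMap.fourier_coe, Real.fourier_eq', ← integral_const_mul,
          ← integral_const_mul]
        refine integral_congr_ae (Eventually.of_forall fun z => ?_)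
        simp only [conj_phase, map_mul, Complex.conj_ofReal, smul_eq_mul]
        ring
    _ = _ := by
        rw [L2.inner_def]
        refine integral_congr_ae ?_
        filter_upwards [(memLp_tens hh hh hh).coeFn_toLp, coeFn_pullbackL hp ((𝓕 ψ).toLp 2),
          pullback_ae_congr hp ((𝓕 ψ).coeFn_toLp 2)] with y h1 h2 h3
        rw [h1, h2, h3, RCLike.inner_apply, mul_comm]

theorem norm_extIntegral_cube_le (p : ℝ) (h : ℝ → ℂ) (z : ℂ) :
    ‖extIntegral p h (z.re, z.im) ^ 3‖ ≤
      ∫ y : ℝ × ℝ × ℝ, ‖(tripleWeight p y : ℂ) * tens h h h y‖ := by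
  rw [extIntegral_cube]
  refine (norm_integral_le_integral_norm _).trans (le_of_eq ?_)
  simp only [norm_mul, norm_phase, one_mul]

theorem aestronglyMeasurable_extIntegral_plane (p : ℝ) {h : ℝ → ℂ}
    (hh : AEStronglyMeasurable h volume) :
    AEStronglyMeasurable (fun z : ℂ => extIntegral p h (z.re, z.im)) volume :=
  (aestronglyMeasurable_extIntegral p hh).comp_quasiMeasurePreserving
    Complex.volume_preserving_equiv_real_prod.quasiMeasurePreserving

open FourierTransform SchwartzMap in
/-- For compactly supported `h` the cube of the extension is the inverse Fourier transform of
the pushforward of `h ⊗ h ⊗ h`. -/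
theorem extIntegral_cube_ae_eq {p : ℝ} (hp : 1 < p) {h : ℝ → ℂ} (hh : MemLp h 2 volume)
    {R : ℝ} (hR : 0 ≤ R) (hsupp : ∀ x ∉ Set.Icc (-R) R, h x = 0) :
    (fun z : ℂ => extIntegral p h (z.re, z.im) ^ 3) =ᵐ[volume]
      (𝓕⁻ (pushL hp ((memLp_tens hh hh hh).toLp _)) : L2Plane) := by
  set v : L2Plane := 𝓕⁻ (pushL hp ((memLp_tens hh hh hh).toLp _))
  have hv : LocallyIntegrable (fun z => (starRingEnd ℂ) (v z)) volume := by
    have h1 : MemLp (fun z => (starRingEnd ℂ) (v z)) 2 volume := (Lp.memLp v).star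
    exact h1.locallyIntegrable (by norm_num)
  have hu : LocallyIntegrable
      (fun z : ℂ => (starRingEnd ℂ) (extIntegral p h (z.re, z.im) ^ 3)) volume := by
    have h1 : MemLp (fun z : ℂ => (starRingEnd ℂ) (extIntegral p h (z.re, z.im) ^ 3)) ∞ volume := by
      refine memLp_top_of_bound (Complex.continuous_conj.comp_aestronglyMeasurable
        ((aestronglyMeasurable_extIntegral_plane p hh.1).pow 3))
        (∫ y : ℝ × ℝ × ℝ, ‖(tripleWeight p y : ℂ) * tens h h h y‖)
        (Eventually.of_forall fun z => ?_)
      rw [RCLike.norm_conj]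
      exact norm_extIntegral_cube_le p h z
    exact h1.locallyIntegrable le_top
  have key := ae_eq_of_integral_contDiff_smul_eq hu hv fun g hg hgc => ?_
  · filter_upwards [key] with z hz
    exact (starRingEnd ℂ).injective hz
  have hgc' : HasCompactSupport fun z => (g z : ℂ) :=
    hgc.comp_left (g := fun x : ℝ => (x : ℂ)) Complex.ofReal_zero
  have hg' : ContDiff ℝ (⊤ : ℕ∞) fun z => (g z : ℂ) := Complex.ofRealCLM.contDiff.comp hg
  set ψ : 𝓢(ℂ, ℂ) := hgc'.toSchwartzMap hg' with hψ
  have hψg : ∀ z, ψ z = g z := fun z => rfl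
  calc _ = ∫ z : ℂ, (starRingEnd ℂ) (extIntegral p h (z.re, z.im) ^ 3) * ψ z := by
        refine integral_congr_ae (Eventually.of_forall fun z => ?_)
        simp only [hψg, Complex.real_smul, mul_comm]
    _ = inner ℂ (pushL hp ((memLp_tens hh hh hh).toLp _)) (𝓕 (ψ.toLp 2)) := by
        rw [integral_conj_cube_mul hp hh hR hsupp, inner_pushL, SchwartzMap.toLp_fourier_eq]
    _ = inner ℂ v (ψ.toLp 2) := by
        rw [← Lp.inner_fourier_eq v, fourier_fourierInv_eq]
    _ = _ := by
        rw [L2.inner_def]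
        refine integral_congr_ae ?_
        filter_upwards [ψ.coeFn_toLp 2] with z hz
        rw [hz, hψg, RCLike.inner_apply, Complex.real_smul]

/-- Plancherel's theorem for the cube of the extension of a compactly supported function. -/
theorem eLpNorm_extIntegral_cube {p : ℝ} (hp : 1 < p) {h : ℝ → ℂ} (hh : MemLp h 2 volume)
    {R : ℝ} (hR : 0 ≤ R) (hsupp : ∀ x ∉ Set.Icc (-R) R, h x = 0) :
    eLpNorm (extIntegral p h) 6 volume ^ 3 =
      ‖pushL hp ((memLp_tens hh hh hh).toLp _)‖ₑ := by
  have h1 : eLpNorm (extIntegral p h) 6 volume =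
      eLpNorm (fun z : ℂ => extIntegral p h (z.re, z.im)) 6 volume :=
    (eLpNorm_comp_measurePreserving (aestronglyMeasurable_extIntegral p hh.1)
      Complex.volume_preserving_equiv_real_prod).symm
  have h2 := eLpNorm_norm_rpow (p := 2) (q := 3) (μ := volume)
    (fun z : ℂ => extIntegral p h (z.re, z.im)) (by norm_num)
  have h6 : (2 : ℝ≥0∞) * ENNReal.ofReal 3 = 6 := by
    norm_num
  rw [h6] at h2
  rw [h1, show eLpNorm (fun z : ℂ => extIntegral p h (z.re, z.im)) 6 volume ^ 3 =
    eLpNorm (fun z : ℂ => extIntegral p h (z.re, z.im)) 6 volume ^ (3 : ℝ) by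
      rw [← ENNReal.rpow_natCast]; norm_num, ← h2]
  have h3 : eLpNorm (fun z : ℂ => ‖extIntegral p h (z.re, z.im)‖ ^ (3 : ℝ)) 2 volume =
      eLpNorm (fun z : ℂ => extIntegral p h (z.re, z.im) ^ 3) 2 volume := by
    refine eLpNorm_congr_norm_ae (Eventually.of_forall fun z => ?_)
    rw [norm_pow, Real.norm_of_nonneg (by positivity), ← Real.rpow_natCast]
    norm_num
  rw [h3, eLpNorm_congr_ae (extIntegral_cube_ae_eq hp hh hR hsupp), ← Lp.enorm_def]
  have := (Lp.fourierTransformₗᵢ ℂ ℂ).symm.norm_map (pushL hp ((memLp_tens hh hh hh).toLp _))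
  rw [← ofReal_norm, ← ofReal_norm]
  exact congrArg ENNReal.ofReal this

/-! ### Existence of the extension and the sharp constant -/

theorem tendsto_eLpNorm_indicator_sub {α : Type*} [MeasurableSpace α] {μ : Measure α} {u : α → ℂ}
    (hu : MemLp u 2 μ) {s : ℝ → Set α} (hs : ∀ R, MeasurableSet (s R))
    (h : ∀ x, ∀ᶠ R in atTop, x ∈ s R) :
    Tendsto (fun R => eLpNorm ((s R).indicator u - u) 2 μ) atTop (𝓝 0) := by
  set v := hu.1.mk u
  have hvm : Measurable v := hu.1.stronglyMeasurable_mk.measurable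
  have huv : u =ᵐ[μ] v := hu.1.ae_eq_mk
  have h1 : ∀ R, eLpNorm ((s R).indicator u - u) 2 μ =
      (∫⁻ x, ‖(s R).indicator v x - v x‖ₑ ^ 2 ∂μ) ^ (1 / 2 : ℝ) := by
    intro R
    have : eLpNorm ((s R).indicator u - u) 2 μ = eLpNorm ((s R).indicator v - v) 2 μ := by
      refine eLpNorm_congr_ae ?_
      filter_upwards [huv] with x hx
      rw [Pi.sub_apply, Pi.sub_apply, hx]
      by_cases hxs : x ∈ s R
      · rw [Set.indicator_of_mem hxs, Set.indicator_of_mem hxs, hx]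
      · rw [Set.indicator_of_notMem hxs, Set.indicator_of_notMem hxs]
    rw [this, show (∫⁻ x, ‖(s R).indicator v x - v x‖ₑ ^ 2 ∂μ) =
      eLpNorm ((s R).indicator v - v) 2 μ ^ 2 from (eLpNorm_two_sq _).symm,
      ← ENNReal.rpow_natCast, ← ENNReal.rpow_mul]
    norm_num
  have h2 : Tendsto (fun R => ∫⁻ x, ‖(s R).indicator v x - v x‖ₑ ^ 2 ∂μ) atTop
      (𝓝 (∫⁻ _, 0 ∂μ)) := by
    refine tendsto_lintegral_filter_of_dominated_convergence (fun x => ‖v x‖ₑ ^ 2)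
      (Eventually.of_forall fun R => ?_) (Eventually.of_forall fun R => ae_of_all _ fun x => ?_)
      ?_ (ae_of_all _ fun x => ?_)
    · exact ((hvm.indicator (hs R)).sub hvm).enorm.pow_const 2
    · by_cases hx : x ∈ s R
      · simp [Set.indicator_of_mem hx]
      · simp [Set.indicator_of_notMem hx]
    · rw [← eLpNorm_two_sq]
      exact ENNReal.pow_ne_top (hu.ae_eq huv).2.ne
    · refine Tendsto.congr' ?_ tendsto_const_nhds
      filter_upwards [h x] with R hR
      simp [Set.indicator_of_mem hR]
  rw [lintegral_zero] at h2
  have h3 := h2.ennrpow_const (1 / 2)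
  rw [ENNReal.zero_rpow_of_pos (by norm_num)] at h3
  exact h3.congr fun R => (h1 R).symm

theorem tendsto_toLp_indicator {α : Type*} [MeasurableSpace α] {μ : Measure α} {u : α → ℂ}
    (hu : MemLp u 2 μ) {s : ℝ → Set α} (hs : ∀ R, MeasurableSet (s R))
    (h : ∀ x, ∀ᶠ R in atTop, x ∈ s R) :
    Tendsto (fun R => (hu.indicator (hs R)).toLp _) atTop (𝓝 (hu.toLp _)) :=
  (Lp.tendsto_Lp_iff_tendsto_eLpNorm'' _ _ _ hu).2 (tendsto_eLpNorm_indicator_sub hu hs h)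

/-- The pushforward of `f ⊗ f ⊗ f`, whose norm is the cube of the norm of the extension of `f`. -/
def cubeL {p : ℝ} (hp : 1 < p) {f : ℝ → ℂ} (hf : MemLp f 2 volume) : L2Plane :=
  pushL hp ((memLp_tens hf hf hf).toLp _)

theorem norm_toLp_tens {f g h : ℝ → ℂ} (hf : MemLp f 2 volume) (hg : MemLp g 2 volume)
    (hh : MemLp h 2 volume) : ‖(memLp_tens hf hg hh).toLp _‖ =
      ‖hf.toLp _‖ * (‖hg.toLp _‖ * ‖hh.toLp _‖) := by
  rw [Lp.norm_toLp, Lp.norm_toLp, Lp.norm_toLp, Lp.norm_toLp, eLpNorm_tens hf.1 hg.1 hh.1,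
    ENNReal.toReal_mul, ENNReal.toReal_mul]

theorem norm_cubeL_le {p : ℝ} (hp : 1 < p) {f : ℝ → ℂ} (hf : MemLp f 2 volume) :
    ‖cubeL hp hf‖ ≤ ‖pushL hp‖ * ‖hf.toLp _‖ ^ 3 := by
  refine ((pushL hp).le_opNorm _).trans (le_of_eq ?_)
  rw [norm_toLp_tens hf hf hf]
  ring

theorem enorm_cubeL_le {p : ℝ} (hp : 1 < p) {f : ℝ → ℂ} (hf : MemLp f 2 volume) :
    ‖cubeL hp hf‖ₑ ≤ ENNReal.ofReal ‖pushL hp‖ * eLpNorm f 2 volume ^ 3 := by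
  rw [← ofReal_norm, ← Lp.enorm_toLp hf, ← ofReal_norm, ← ENNReal.ofReal_pow (norm_nonneg _),
    ← ENNReal.ofReal_mul (norm_nonneg _)]
  exact ENNReal.ofReal_le_ofReal (norm_cubeL_le hp hf)

theorem le_mul_of_pow_three_le {x y c : ℝ≥0∞} (hc : 1 ≤ c) (h : x ^ 3 ≤ c * y ^ 3) :
    x ≤ c * y := by
  rw [← ENNReal.pow_le_pow_left_iff three_ne_zero, mul_pow]
  refine h.trans ?_
  gcongr
  exact le_self_pow₀ hc three_ne_zero

theorem eLpNorm_extIntegral_le {p : ℝ} (hp : 1 < p) : ∃ c : ℝ, 0 ≤ c ∧ ∀ h : ℝ → ℂ,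
    MemLp h 2 volume → ∀ R : ℝ, 0 ≤ R → (∀ x ∉ Set.Icc (-R) R, h x = 0) →
      eLpNorm (extIntegral p h) 6 volume ≤ ENNReal.ofReal c * eLpNorm h 2 volume := by
  refine ⟨max 1 ‖pushL hp‖, by positivity, fun h hh R hR hsupp => ?_⟩
  refine le_mul_of_pow_three_le ?_ ?_
  · rw [← ENNReal.ofReal_one]
    exact ENNReal.ofReal_le_ofReal (le_max_left _ _)
  · rw [eLpNorm_extIntegral_cube hp hh hR hsupp]
    refine (enorm_cubeL_le hp hh).trans ?_
    gcongr
    exact le_max_right _ _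

theorem extIntegral_sub {p : ℝ} (hp : 1 < p) {g h : ℝ → ℂ} (hg : MemLp g 2 volume)
    (hh : MemLp h 2 volume) {R : ℝ} (hR : 0 ≤ R) (hgs : ∀ x ∉ Set.Icc (-R) R, g x = 0)
    (hhs : ∀ x ∉ Set.Icc (-R) R, h x = 0) :
    extIntegral p (g - h) = extIntegral p g - extIntegral p h := by
  have hint : ∀ {u : ℝ → ℂ}, MemLp u 2 volume → (∀ x ∉ Set.Icc (-R) R, u x = 0) → ∀ z : ℝ × ℝ,
      Integrable (fun y : ℝ => Complex.exp (Complex.I * (z.1 * y : ℝ)) *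
        Complex.exp (Complex.I * (z.2 * |y| ^ p : ℝ)) * ((|y| ^ ((p - 2) / 6) : ℝ) : ℂ) * u y)
        volume := by
    intro u hu hus z
    have h1 := integrable_weight_mul hp hu hR hus
    refine (Integrable.bdd_mul (c := 1) (f := fun y : ℝ => Complex.exp (Complex.I * (z.1 * y : ℝ)) *
        Complex.exp (Complex.I * (z.2 * |y| ^ p : ℝ))) h1 ?_
        (Eventually.of_forall fun y => ?_)).congr (Eventually.of_forall fun y => ?_)
    · exact Measurable.aestronglyMeasurable (by fun_prop)
    · rw [norm_mul, mul_comm Complex.I, mul_comm Complex.I, Complex.norm_exp_ofReal_mul_I,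
        Complex.norm_exp_ofReal_mul_I, mul_one]
    · simp only [mul_assoc]
  ext z
  simp only [extIntegral, Pi.sub_apply]
  rw [← integral_sub (hint hg hgs z) (hint hh hhs z)]
  refine integral_congr_ae (Eventually.of_forall fun y => ?_)
  dsimp only
  ring

theorem eventually_mem_Icc_symm (x : ℝ) : ∀ᶠ R in atTop, x ∈ Set.Icc (-R) R := by
  filter_upwards [eventually_ge_atTop |x|] with R hR
  exact abs_le.1 hR

theorem indicator_Icc_eq_zero {f : ℝ → ℂ} {R S : ℝ} (h : R ≤ S) :
    ∀ x ∉ Set.Icc (-S) S, (Set.Icc (-R) R).indicator f x = 0 := fun x hx =>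
  Set.indicator_of_notMem (fun hx' => hx ⟨by linarith [hx'.1], by linarith [hx'.2]⟩) _

theorem memLp_extIntegral_indicator {p : ℝ} (hp : 1 < p) {f : ℝ → ℂ} (hf : MemLp f 2 volume)
    (R : ℝ) : MemLp (extIntegral p ((Set.Icc (-R) R).indicator f)) 6 volume := by
  obtain ⟨c, hc, H⟩ := eLpNorm_extIntegral_le hp
  have hfR := hf.indicator (measurableSet_Icc (a := -R) (b := R))
  refine ⟨aestronglyMeasurable_extIntegral p hfR.1, ?_⟩
  exact (H _ hfR |R| (abs_nonneg R) (indicator_Icc_eq_zero (le_abs_self R))).trans_lt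
    (ENNReal.mul_lt_top ENNReal.ofReal_lt_top hfR.2)

/-- The extension of every `f ∈ L²` exists: the truncated integrals form a Cauchy family in `L⁶`,
as the bound for compactly supported functions applies to their differences. -/
theorem exists_isExtension {p : ℝ} (hp : 1 < p) {f : ℝ → ℂ} (hf : MemLp f 2 volume) :
    ∃ F, IsExtension p f F ∧ eLpNorm F 6 volume ^ 3 = ‖cubeL hp hf‖ₑ := by
  obtain ⟨c, hc, H⟩ := eLpNorm_extIntegral_le hp
  have : Fact ((1 : ℝ≥0∞) ≤ 6) := ⟨by norm_num⟩
  set U : ℝ → Lp ℂ 6 (volume : Measure (ℝ × ℝ)) := fun R =>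
    (memLp_extIntegral_indicator hp hf R).toLp _ with hU
  have hfR : ∀ R, MemLp ((Set.Icc (-R) R).indicator f) 2 volume := fun R =>
    hf.indicator measurableSet_Icc
  set G : ℝ → Lp ℂ 2 (volume : Measure ℝ) := fun R => (hfR R).toLp _ with hG
  have hlim : Tendsto G atTop (𝓝 (hf.toLp _)) :=
    tendsto_toLp_indicator hf (fun R => measurableSet_Icc) eventually_mem_Icc_symm
  have hdist : ∀ R S, dist (U R) (U S) ≤ c * dist (G R) (G S) := by
    intro R S
    have hM : 0 ≤ max |R| |S| := le_max_of_le_left (abs_nonneg R)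
    have hR := indicator_Icc_eq_zero (f := f) (S := max |R| |S|)
      ((le_abs_self R).trans (le_max_left |R| |S|))
    have hS := indicator_Icc_eq_zero (f := f) (S := max |R| |S|)
      ((le_abs_self S).trans (le_max_right |R| |S|))
    have h1 := H _ ((hfR R).sub (hfR S)) _ hM (fun x hx => by
      rw [Pi.sub_apply, hR x hx, hS x hx, sub_zero])
    rw [extIntegral_sub hp (hfR R) (hfR S) hM hR hS] at h1
    rw [dist_eq_norm, dist_eq_norm, hU, hG]
    dsimp only
    rw [← MemLp.toLp_sub, ← MemLp.toLp_sub, Lp.norm_toLp, Lp.norm_toLp]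
    refine (ENNReal.toReal_mono (ENNReal.mul_ne_top ENNReal.ofReal_ne_top
      ((hfR R).sub (hfR S)).2.ne) h1).trans (le_of_eq ?_)
    rw [ENNReal.toReal_mul, ENNReal.toReal_ofReal hc]
  have hcauchy : CauchySeq U := by
    rw [Metric.cauchySeq_iff]
    intro δ hδ
    obtain ⟨N, hN⟩ := Metric.cauchySeq_iff.1 hlim.cauchySeq (δ / (c + 1)) (by positivity)
    refine ⟨N, fun R hR S hS => (hdist R S).trans_lt ?_⟩
    have h1 := hN R hR S hS
    rw [lt_div_iff₀ (by positivity)] at h1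
    nlinarith [dist_nonneg (x := G R) (y := G S)]
  obtain ⟨F, hF⟩ := cauchySeq_tendsto_of_complete hcauchy
  refine ⟨F, ⟨Lp.memLp F, ?_⟩, ?_⟩
  · refine ((Lp.tendsto_Lp_iff_tendsto_eLpNorm' U F).1 hF).congr fun R => ?_
    refine eLpNorm_congr_ae ?_
    filter_upwards [(memLp_extIntegral_indicator hp hf R).coeFn_toLp] with z hz
    simp only [hU, Pi.sub_apply, hz]
  -- The truncations of `f ⊗ f ⊗ f` to cubes are the tensor cubes of the truncations of `f`.
  · have hbox : ∀ R, MeasurableSet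
        {y : ℝ × ℝ × ℝ | y.1 ∈ Set.Icc (-R) R ∧ y.2.1 ∈ Set.Icc (-R) R ∧ y.2.2 ∈ Set.Icc (-R) R} := by
      intro R
      simp only [Set.mem_Icc, measurableSet_setOfPred]
      fun_prop
    have hk := tendsto_toLp_indicator (memLp_tens hf hf hf) hbox fun y => by
      filter_upwards [eventually_mem_Icc_symm y.1, eventually_mem_Icc_symm y.2.1,
        eventually_mem_Icc_symm y.2.2] with R h1 h2 h3
      exact ⟨h1, h2, h3⟩
    have h1 : Tendsto (fun R => ‖U R‖ₑ ^ 3) atTop (𝓝 (‖F‖ₑ ^ 3)) :=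
      (ENNReal.continuous_pow 3).continuousAt.tendsto.comp hF.enorm
    have h2 := ((pushL hp).continuous.tendsto _).comp hk
    have h3 := h2.enorm
    rw [← Lp.enorm_def]
    refine tendsto_nhds_unique (h1.congr' ?_) h3
    filter_upwards [eventually_ge_atTop 0] with R hR
    rw [hU]
    dsimp only [Function.comp]
    rw [Lp.enorm_toLp, eLpNorm_extIntegral_cube hp (hfR R) hR (indicator_Icc_eq_zero le_rfl)]
    congr 2
    refine (MemLp.toLp_eq_toLp_iff _ _).2 (Eventually.of_forall fun y => ?_)
    simp only [tens, Set.indicator_apply, Set.mem_ofPred_eq]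
    by_cases h1 : y.1 ∈ Set.Icc (-R) R <;> by_cases h2 : y.2.1 ∈ Set.Icc (-R) R <;>
      by_cases h3 : y.2.2 ∈ Set.Icc (-R) R <;> simp [h1, h2, h3]

theorem extNorm_cube {p : ℝ} (hp : 1 < p) {f : ℝ → ℂ} (hf : MemLp f 2 volume) :
    extNorm p f ^ 3 = ‖cubeL hp hf‖ₑ := by
  obtain ⟨F, hF, h⟩ := exists_isExtension hp hf
  rw [extNorm_eq hf.1 hF, h]

theorem optConst_ne_top {p : ℝ} (hp : 1 < p) : optConst p ≠ ∞ := by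
  have h : optConst p ≤ ENNReal.ofReal (max 1 ‖pushL hp‖) := by
    refine iSup_le fun f => iSup_le fun hf => iSup_le fun hf0 => ?_
    refine ENNReal.div_le_of_le_mul (le_mul_of_pow_three_le ?_ ?_)
    · rw [← ENNReal.ofReal_one]
      exact ENNReal.ofReal_le_ofReal (le_max_left _ _)
    · rw [extNorm_cube hp hf]
      refine (enorm_cubeL_le hp hf).trans ?_
      gcongr
      exact le_max_right _ _
  exact (h.trans_lt ENNReal.ofReal_lt_top).ne

theorem extNorm_le {p : ℝ} (hp : 1 < p) {f : ℝ → ℂ} (hf : MemLp f 2 volume) :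
    extNorm p f ≤ optConst p * eLpNorm f 2 volume := by
  by_cases hf0 : f =ᵐ[volume] 0
  · have h1 : eLpNorm f 2 volume = 0 := by rw [eLpNorm_congr_ae hf0, eLpNorm_zero]
    have h2 := enorm_cubeL_le hp hf
    rw [h1, ← extNorm_cube hp hf] at h2
    simp only [ne_eq, OfNat.ofNat_ne_zero, not_false_eq_true, zero_pow, mul_zero,
      nonpos_iff_eq_zero, pow_eq_zero_iff] at h2
    rw [h2]
    exact zero_le
  · have h1 : eLpNorm f 2 volume ≠ 0 := fun h =>
      hf0 ((eLpNorm_eq_zero_iff hf.1 (by norm_num)).1 h)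
    rw [← ENNReal.div_le_iff h1 hf.2.ne]
    exact le_iSup_of_le f (le_iSup_of_le hf (le_iSup_of_le hf0 le_rfl))

/-- The pushforward of a nonnegative function that is not zero does not vanish, here for the
indicator of `[1, 2]`. -/
theorem exists_cubeL_ne_zero {p : ℝ} (hp : 1 < p) :
    ∃ (g : ℝ → ℂ) (hg : MemLp g 2 volume), cubeL hp hg ≠ 0 := by
  set g : ℝ → ℂ := (Set.Icc 1 2).indicator fun _ => 1
  have hg : MemLp g 2 volume := memLp_indicator_const 2 measurableSet_Icc 1
    (Or.inr (by simp [Real.volume_Icc]))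
  refine ⟨g, hg, fun h0 => ?_⟩
  set box : Set (ℝ × ℝ × ℝ) := Set.Icc 1 2 ×ˢ (Set.Icc 1 2 ×ˢ Set.Icc 1 2) with hbox
  have hboxm : MeasurableSet box :=
    measurableSet_Icc.prod (measurableSet_Icc.prod measurableSet_Icc)
  have hbv : volume box = 1 := by
    rw [hbox, Measure.volume_eq_prod, Measure.prod_prod, Measure.volume_eq_prod,
      Measure.prod_prod, Real.volume_Icc]
    norm_num
  set r : ℝ := (6 + 3 * 2 ^ p) / (2 * Real.pi)
  have hfreq : ∀ y ∈ box, freq p y ∈ Metric.closedBall (0 : ℂ) r := by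
    rintro ⟨y₁, y₂, y₃⟩ ⟨⟨a1, a2⟩, ⟨b1, b2⟩, c1, c2⟩
    dsimp only at a1 a2 b1 b2 c1 c2
    have hpow : ∀ x : ℝ, 1 ≤ x → x ≤ 2 → 0 ≤ |x| ^ p ∧ |x| ^ p ≤ 2 ^ p := fun x h1 h2 => by
      rw [abs_of_nonneg (by linarith)]
      exact ⟨by positivity, Real.rpow_le_rpow (by linarith) h2 (by linarith)⟩
    have e1 := hpow y₁ a1 a2
    have e2 := hpow y₂ b1 b2
    have e3 := hpow y₃ c1 c2
    rw [mem_closedBall_zero_iff]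
    refine (Complex.norm_le_abs_re_add_abs_im _).trans ?_
    simp only [freq, curveSum]
    rw [abs_of_nonneg (by have := Real.pi_pos; positivity),
      abs_of_nonneg (by have := Real.pi_pos; positivity), ← add_div]
    exact div_le_div_of_nonneg_right (by linarith) (by positivity)
  have hB : volume (Metric.closedBall (0 : ℂ) r) ≠ ∞ := measure_closedBall_lt_top.ne
  set ψ : L2Plane := indicatorConstLp 2 Metric.isClosed_closedBall.measurableSet hB (1 : ℂ)
  have hin : inner ℂ (cubeL hp hg) ψ = 0 := by rw [h0, inner_zero_left]
  rw [cubeL, inner_pushL, L2.inner_def] at hin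
  have hae : (fun y => inner ℂ ((memLp_tens hg hg hg).toLp _ y) (pullbackL hp ψ y)) =ᵐ[volume]
      fun y => ((box.indicator (tripleWeight p) y : ℝ) : ℂ) := by
    filter_upwards [(memLp_tens hg hg hg).coeFn_toLp, coeFn_pullbackL hp ψ,
      pullback_ae_congr hp indicatorConstLp_coeFn] with y h1 h2 h3
    rw [h1, h2, h3, RCLike.inner_apply]
    simp only [tens, pullback, g]
    by_cases hy : y ∈ box
    · rw [Set.indicator_of_mem hy, Set.indicator_of_mem (hfreq y hy), Set.indicator_of_mem hy.1,
        Set.indicator_of_mem hy.2.1, Set.indicator_of_mem hy.2.2]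
      simp
    · rw [Set.indicator_of_notMem hy]
      by_cases a : y.1 ∈ Set.Icc (1 : ℝ) 2
      · by_cases b : y.2.1 ∈ Set.Icc (1 : ℝ) 2
        · have c : y.2.2 ∉ Set.Icc (1 : ℝ) 2 := fun c => hy ⟨a, b, c⟩
          simp [Set.indicator_of_notMem c]
        · simp [Set.indicator_of_notMem b]
      · simp [Set.indicator_of_notMem a]
  have hint : Integrable (fun y => box.indicator (tripleWeight p) y) volume := by
    have := ((L2.integrable_inner (𝕜 := ℂ) ((memLp_tens hg hg hg).toLp _)
      (pullbackL hp ψ)).congr hae).re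
    simpa using this
  rw [integral_congr_ae hae, integral_complex_ofReal, Complex.ofReal_eq_zero,
    integral_eq_zero_iff_of_nonneg (fun y => Set.indicator_nonneg
      (fun y _ => tripleWeight_nonneg p y) y) hint] at hin
  have hpos : ∀ y ∈ box, 0 < tripleWeight p y := by
    rintro ⟨y₁, y₂, y₃⟩ ⟨⟨a1, a2⟩, ⟨b1, b2⟩, c1, c2⟩
    dsimp only at a1 a2 b1 b2 c1 c2
    have h1 : 0 < |y₁| := abs_pos.2 (by linarith)
    have h2 : 0 < |y₂| := abs_pos.2 (by linarith)
    have h3 : 0 < |y₃| := abs_pos.2 (by linarith)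
    simp only [tripleWeight]
    positivity
  have : volume box = 0 := by
    refine measure_mono_null (fun y hy => ?_) hin
    simp only [Set.mem_compl_iff, Set.mem_ofPred_eq, Set.indicator_of_mem hy, Pi.zero_apply]
    exact (hpos y hy).ne'
  rw [hbv] at this
  exact one_ne_zero this

/-- An extremizer maximizes `‖T (f ⊗ f ⊗ f)‖ / ‖f‖ ^ 3`, and the maximum is positive. -/
theorem IsExtremizer.exists_const {p : ℝ} (hp : 1 < p) {f : ℝ → ℂ} (hf : IsExtremizer p f) :
    ∃ K : ℝ, 0 < K ∧ (∀ (g : ℝ → ℂ) (hg : MemLp g 2 volume),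
      ‖cubeL hp hg‖ ≤ K * ‖hg.toLp _‖ ^ 3) ∧
      ‖cubeL hp hf.1‖ = K * ‖hf.1.toLp _‖ ^ 3 := by
  have htop := optConst_ne_top hp
  have hK : ∀ (g : ℝ → ℂ) (hg : MemLp g 2 volume),
      ‖cubeL hp hg‖ ≤ (optConst p).toReal ^ 3 * ‖hg.toLp _‖ ^ 3 := by
    intro g hg
    have h1 : ‖cubeL hp hg‖ₑ ≤ (optConst p * eLpNorm g 2 volume) ^ 3 := by
      rw [← extNorm_cube hp hg]
      exact pow_le_pow_left' (extNorm_le hp hg) 3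
    have h2 := ENNReal.toReal_mono (ENNReal.pow_ne_top (ENNReal.mul_ne_top htop hg.2.ne)) h1
    rwa [toReal_enorm, ENNReal.toReal_pow, ENNReal.toReal_mul, ← Lp.norm_toLp _ hg, mul_pow] at h2
  refine ⟨(optConst p).toReal ^ 3, ?_, hK, ?_⟩
  · obtain ⟨g, hg, hg0⟩ := exists_cubeL_ne_zero hp
    have h1 := (norm_pos_iff.2 hg0).trans_le (hK g hg)
    exact pos_of_mul_pos_left h1 (by positivity)
  · have h1 : ‖cubeL hp hf.1‖ₑ = (optConst p * eLpNorm f 2 volume) ^ 3 := by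
      rw [← extNorm_cube hp hf.1, hf.2.2]
    have h2 := congrArg ENNReal.toReal h1
    rwa [toReal_enorm, ENNReal.toReal_pow, ENNReal.toReal_mul, ← Lp.norm_toLp _ hf.1, mul_pow] at h2

/-! ### The Euler–Lagrange equation -/

/-- The first variation of `‖𝓒(u + t v)‖² ≤ K² ‖u + t v‖⁶` at a point of equality `t = 0`, for a
cubic form `𝓒` with `𝓒(u + t v) = A + 3 t B + t² C + t³ D`. -/
theorem re_inner_eq_of_cubic_le {E F : Type*} [NormedAddCommGroup E] [InnerProductSpace ℂ E]
    [NormedAddCommGroup F] [InnerProductSpace ℂ F] {u v : E} {A B C D : F} {K : ℝ}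
    (h : ∀ t : ℝ, ‖A + (t : ℂ) • (3 : ℂ) • B + (t : ℂ) ^ 2 • C + (t : ℂ) ^ 3 • D‖ ^ 2 ≤
      K ^ 2 * (‖u + (t : ℂ) • v‖ ^ 2) ^ 3)
    (h0 : ‖A‖ ^ 2 = K ^ 2 * (‖u‖ ^ 2) ^ 3) :
    K ^ 2 * ‖u‖ ^ 4 * (inner ℂ u v).re = (inner ℂ A B).re := by
  let _ : InnerProductSpace ℝ E := InnerProductSpace.complexToReal
  let _ : InnerProductSpace ℝ F := InnerProductSpace.complexToReal
  have hE : ∀ (t : ℝ) (x : E), (t : ℂ) • x = t • x := fun _ _ => rfl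
  have hF : ∀ (t : ℝ) (x : F), (t : ℂ) • x = t • x := fun _ _ => rfl
  have hin : ∀ x y : E, inner ℝ x y = (inner ℂ x y).re := fun _ _ => rfl
  have hin' : ∀ x y : F, inner ℝ x y = (inner ℂ x y).re := fun _ _ => rfl
  simp only [← Complex.ofReal_pow, ← Complex.ofReal_ofNat, hE, hF] at h
  have hu : HasDerivAt (fun t : ℝ => u + t • v) v 0 := by
    simpa using ((hasDerivAt_id (0 : ℝ)).smul_const v).const_add u
  have hA : HasDerivAt (fun t : ℝ => A + t • (3 : ℝ) • B + t ^ 2 • C + t ^ 3 • D)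
      ((3 : ℝ) • B) 0 := by
    have h1 := ((hasDerivAt_id (0 : ℝ)).smul_const ((3 : ℝ) • B)).const_add A
    have h2 := ((hasDerivAt_id (0 : ℝ)).pow 2).smul_const C
    have h3 := ((hasDerivAt_id (0 : ℝ)).pow 3).smul_const D
    convert! (h1.add h2).add h3 using 1
    simp
  have hd := (((HasDerivAt.norm_sq (F := E) hu).pow 3).const_mul (K ^ 2)).sub
    (HasDerivAt.norm_sq (F := F) hA)
  have hmin : IsLocalMin (fun t : ℝ => K ^ 2 * (‖u + t • v‖ ^ 2) ^ 3 -
      ‖A + t • (3 : ℝ) • B + t ^ 2 • C + t ^ 3 • D‖ ^ 2) 0 := by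
    refine Eventually.of_forall fun t => ?_
    simp only [zero_smul, add_zero, ne_eq, OfNat.ofNat_ne_zero, not_false_eq_true, zero_pow]
    rw [h0, sub_self]
    exact sub_nonneg.2 (h t)
  have := hmin.hasDerivAt_eq_zero hd
  simp only [zero_smul, add_zero, ne_eq, OfNat.ofNat_ne_zero, not_false_eq_true, zero_pow,
    hin, hin'] at this
  norm_num at this
  linarith

theorem tens_add_smul (f g : ℝ → ℂ) (t : ℂ) :
    tens (f + t • g) (f + t • g) (f + t • g) = tens f f f + t • (tens g f f + (tens f g f +
      tens f f g)) + t ^ 2 • (tens g g f + (tens g f g + tens f g g)) + t ^ 3 • tens g g g := by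
  ext y
  simp only [tens, Pi.add_apply, Pi.smul_apply, smul_eq_mul]
  ring

theorem IsExtremizer.memLp {p : ℝ} {f : ℝ → ℂ} (hf : IsExtremizer p f) : MemLp f 2 volume := hf.1

theorem IsExtremizer.norm_toLp_pos {p : ℝ} {f : ℝ → ℂ} (hf : IsExtremizer p f) :
    0 < ‖hf.memLp.toLp f‖ := by
  rw [Lp.norm_toLp]
  refine ENNReal.toReal_pos (fun h => hf.2.1 ?_) hf.memLp.2.ne
  exact (eLpNorm_eq_zero_iff hf.memLp.1 two_ne_zero).1 h

/-- The Euler–Lagrange equation of an extremizer `f`, in the weak form obtained by varying `f` in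
the direction `g`. -/
theorem IsExtremizer.exists_euler_lagrange {p : ℝ} (hp : 1 < p) {f : ℝ → ℂ}
    (hf : IsExtremizer p f) : ∃ ω : ℝ, 0 < ω ∧ ∀ g : ℝ → ℂ, ∀ hg : MemLp g 2 volume,
      ω * (inner ℂ (hf.memLp.toLp f) (hg.toLp g)).re =
        (inner ℂ (pushL hp ((memLp_tens hf.memLp hf.memLp hf.memLp).toLp _))
          (pushL hp ((memLp_tens hg hf.memLp hf.memLp).toLp _))).re := by
  obtain ⟨K, hK, hle, heq⟩ := hf.exists_const hp
  have hpos := hf.norm_toLp_pos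
  refine ⟨K ^ 2 * ‖hf.memLp.toLp f‖ ^ 4, by positivity, fun g hg => ?_⟩
  have hf' := hf.memLp
  change _ * (inner ℂ (hf'.toLp f) (hg.toLp g)).re = _
  have h12 : pushL hp ((memLp_tens hf' hg hf').toLp _) =
      pushL hp ((memLp_tens hg hf' hf').toLp _) := by
    refine pushL_eq_of_symm hp measurePreserving_swapFst (tripleWeight_swapFst p)
      (curveSum_swapFst p) ?_
    filter_upwards [(memLp_tens hf' hg hf').coeFn_toLp,
      measurePreserving_swapFst.quasiMeasurePreserving.ae (memLp_tens hg hf' hf').coeFn_toLp]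
      with y h1 h2
    rw [h1, h2]
    have : swapFst y = (y.2.1, y.1, y.2.2) := rfl
    simp only [this, tens]
    ring
  have h23 : pushL hp ((memLp_tens hf' hf' hg).toLp _) =
      pushL hp ((memLp_tens hf' hg hf').toLp _) := by
    refine pushL_eq_of_symm hp measurePreserving_swapSnd (tripleWeight_swapSnd p)
      (curveSum_swapSnd p) ?_
    filter_upwards [(memLp_tens hf' hf' hg).coeFn_toLp,
      measurePreserving_swapSnd.quasiMeasurePreserving.ae (memLp_tens hf' hg hf').coeFn_toLp]
      with y h1 h2
    rw [h1, h2]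
    have : swapSnd y = (y.1, y.2.2, y.2.1) := rfl
    simp only [this, tens]
    ring
  refine re_inner_eq_of_cubic_le
    (C := pushL hp (((memLp_tens hg hg hf').add
      ((memLp_tens hg hf' hg).add (memLp_tens hf' hg hg))).toLp _))
    (D := pushL hp ((memLp_tens hg hg hg).toLp _)) (fun t => ?_) ?_
  · have ht : MemLp (f + (t : ℂ) • g) 2 volume := hf'.add (hg.const_smul t)
    have h1 := hle _ ht
    have h2 : ht.toLp _ = hf'.toLp f + (t : ℂ) • hg.toLp g := by
      rw [← MemLp.toLp_const_smul, ← MemLp.toLp_add]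
    have h3 : cubeL hp ht = pushL hp ((memLp_tens hf' hf' hf').toLp _) +
        (t : ℂ) • (3 : ℂ) • pushL hp ((memLp_tens hg hf' hf').toLp _) +
        (t : ℂ) ^ 2 • pushL hp (((memLp_tens hg hg hf').add
          ((memLp_tens hg hf' hg).add (memLp_tens hf' hg hg))).toLp _) +
        (t : ℂ) ^ 3 • pushL hp ((memLp_tens hg hg hg).toLp _) := by
      have h4 : (3 : ℂ) • pushL hp ((memLp_tens hg hf' hf').toLp _) =
          pushL hp (((memLp_tens hg hf' hf').add
            ((memLp_tens hf' hg hf').add (memLp_tens hf' hf' hg))).toLp _) := by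
        rw [MemLp.toLp_add (memLp_tens hg hf' hf') ((memLp_tens hf' hg hf').add (memLp_tens hf' hf' hg)),
          MemLp.toLp_add (memLp_tens hf' hg hf') (memLp_tens hf' hf' hg), map_add, map_add, h23, h12]
        module
      rw [h4]
      simp only [← map_smul, ← map_add]
      rw [cubeL]
      congr 1
      simp only [← MemLp.toLp_const_smul, ← MemLp.toLp_add]
      exact MemLp.toLp_congr _ _ (Eventually.of_forall fun y =>
        congrFun (tens_add_smul f g (t : ℂ)) y)
    rw [← h2, ← h3]
    calc ‖cubeL hp ht‖ ^ 2 ≤ (K * ‖ht.toLp _‖ ^ 3) ^ 2 := by gcongr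
      _ = K ^ 2 * (‖ht.toLp _‖ ^ 2) ^ 3 := by ring
  · have : ‖pushL hp ((memLp_tens hf' hf' hf').toLp _)‖ = K * ‖hf'.toLp f‖ ^ 3 := heq
    rw [this]
    ring

/-! ### The bootstrap inequality -/

/-- The `L²` norm as a real number; it is meaningful for functions in `L²`, and `0` if the norm is
infinite. -/
def nrm (u : ℝ → ℂ) : ℝ := (eLpNorm u 2 volume).toReal

theorem nrm_nonneg (u : ℝ → ℂ) : 0 ≤ nrm u := ENNReal.toReal_nonneg

theorem nrm_add_le {u v : ℝ → ℂ} (hu : MemLp u 2 volume) (hv : MemLp v 2 volume) :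
    nrm (u + v) ≤ nrm u + nrm v := by
  rw [nrm, nrm, nrm, ← ENNReal.toReal_add hu.2.ne hv.2.ne]
  exact ENNReal.toReal_mono (ENNReal.add_ne_top.2 ⟨hu.2.ne, hv.2.ne⟩)
    (eLpNorm_add_le hu.1 hv.1 (by norm_num))

theorem nrm_le_of_norm_le {u v : ℝ → ℂ} (hv : MemLp v 2 volume) {c : ℝ} (hc : 0 ≤ c)
    (h : ∀ x, ‖u x‖ ≤ c * ‖v x‖) : nrm u ≤ c * nrm v := by
  have h1 := eLpNorm_le_mul_eLpNorm_of_ae_le_mul (μ := volume) (Eventually.of_forall h) 2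
  have h2 := ENNReal.toReal_mono (ENNReal.mul_ne_top ENNReal.ofReal_ne_top hv.2.ne) h1
  rwa [ENNReal.toReal_mul, ENNReal.toReal_ofReal hc] at h2

theorem nrm_sq {u : ℝ → ℂ} (hu : MemLp u 2 volume) : nrm u ^ 2 = ∫ x, ‖u x‖ ^ 2 := by
  have hm : AEStronglyMeasurable (fun x => ‖u x‖ ^ 2) volume := hu.1.norm.pow 2
  rw [nrm, ← ENNReal.toReal_pow, eLpNorm_two_sq, integral_eq_lintegral_of_nonneg_ae
    (Eventually.of_forall fun x => by positivity) hm]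
  congr 1
  refine lintegral_congr fun x => ?_
  rw [← ofReal_norm, ENNReal.ofReal_pow (norm_nonneg _)]

theorem norm_toLp_le_of_tens {q : ℝ × ℝ × ℝ → ℂ} (hq : MemLp q 2 volume) {f g h : ℝ → ℂ}
    (hf : MemLp f 2 volume) (hg : MemLp g 2 volume) (hh : MemLp h 2 volume)
    (H : ∀ y, ‖q y‖ ≤ ‖tens f g h y‖) : ‖hq.toLp q‖ ≤ nrm f * (nrm g * nrm h) := by
  have h1 := norm_toLp_tens hf hg hh
  rw [Lp.norm_toLp f hf, Lp.norm_toLp g hg, Lp.norm_toLp h hh] at h1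
  rw [nrm, nrm, nrm, ← h1]
  refine Lp.norm_le_norm_of_ae_le ?_
  filter_upwards [hq.coeFn_toLp, (memLp_tens hf hg hh).coeFn_toLp] with y h1 h2
  rw [h1, h2]
  exact H y

theorem measurableSet_lt_abs (r : ℝ) : MeasurableSet {x : ℝ | r < |x|} :=
  measurableSet_lt measurable_const (by fun_prop)

/-- For a weight `a` that is increasing and submultiplicative in the second coordinate of the
curve, the weighted tail `X` of an extremizer, beyond the radius `N s`, is controlled by a small
multiple of the full weighted norm and by the square of the weighted tail beyond `s`. The
Euler–Lagrange equation, tested against `a² f` on the tail, has `X²` on the left; on the right the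
weight is distributed over the factors. If one of the two remaining frequencies in the tested factor is at most `s`, then the
frequencies are separated by the ratio `N` and the gap estimate gives a gain. Otherwise both
belong to the tail beyond `s`. -/
theorem IsExtremizer.exists_bootstrap {p : ℝ} (hp : 1 < p) {f : ℝ → ℂ} (hf : IsExtremizer p f) :
    ∃ ω C γ : ℝ, 0 < ω ∧ 0 ≤ C ∧ 0 < γ ∧ ∀ (a : ℝ → ℝ) (M : ℝ), Measurable a → (∀ τ, 1 ≤ a τ) →
      (∀ τ, a τ ≤ M) → (∀ σ τ, 0 ≤ σ → σ ≤ τ → a σ ≤ a τ) →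
      (∀ x y z, 0 ≤ x → 0 ≤ y → 0 ≤ z → a (x + y + z) ≤ a x * (a y * a z)) →
      ∀ N s : ℝ, 1 ≤ N → 0 < s →
        ω * nrm ({x | N * s < |x|}.indicator fun x => (a (|x| ^ p) : ℂ) * f x) ≤
          C * nrm (fun x => (a (|x| ^ p) : ℂ) * f x) ^ 3 *
            (C * N ^ (-γ) * nrm (fun x => (a (|x| ^ p) : ℂ) * f x) ^ 2 +
              C * nrm ({x | s < |x|}.indicator fun x => (a (|x| ^ p) : ℂ) * f x) ^ 2) := by
  obtain ⟨ω, hω, hEL⟩ := hf.exists_euler_lagrange hp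
  obtain ⟨Cg, hCg, hgap⟩ := norm_pushL_gap_le hp
  have hγ : 0 < (1 / 2 + singExp p) / 2 := by
    have := singExp_gt hp
    linarith
  set γ := (1 / 2 + singExp p) / 2
  set C := max Cg ‖pushL hp‖ with hCdef
  have hC : 0 ≤ C := hCg.trans (le_max_left _ _)
  have hop : ∀ k, ‖pushL hp k‖ ≤ C * ‖k‖ := fun k =>
    ((pushL hp).le_opNorm k).trans (by gcongr; exact le_max_right _ _)
  refine ⟨ω, C, γ, hω, hC, hγ, fun a M ham ha1 haM hmono hsub N s hN hs => ?_⟩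
  have hf' := hf.memLp
  have hN0 : 0 < N := by linarith
  have ha0 : ∀ τ, 0 < a τ := fun τ => one_pos.trans_le (ha1 τ)
  set w : ℝ → ℝ := fun x => a (|x| ^ p) with hw
  have hwm : Measurable w := ham.comp (by fun_prop)
  have hwM : ∀ x, |w x| ≤ M := fun x => by rw [abs_of_pos (ha0 _)]; exact haM _
  have hw0 : ∀ x, 0 < w x := fun x => ha0 _
  set h : ℝ → ℂ := fun x => (w x : ℂ) * f x with hh
  have hhm : MemLp h 2 volume := memLp_real_mul hwm hwM hf'
  have hTm := hhm.indicator (measurableSet_lt_abs (N * s))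
  have hSm := hhm.indicator (measurableSet_lt_abs s)
  set hT := {x : ℝ | N * s < |x|}.indicator h with hhT
  set hS := {x : ℝ | s < |x|}.indicator h with hhS
  set X := nrm hT
  set H := nrm h
  set S := nrm hS
  have hX0 : 0 ≤ X := nrm_nonneg _
  have hH0 : 0 ≤ H := nrm_nonneg _
  have hS0 : 0 ≤ S := nrm_nonneg _
  set g : ℝ → ℂ := fun x => (w x : ℂ) * hT x with hg
  have hgm : MemLp g 2 volume := memLp_real_mul hwm hwM hTm
  have hnh : ∀ x, ‖h x‖ = w x * ‖f x‖ := fun x => by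
    rw [hh, norm_mul, Complex.norm_real, Real.norm_of_nonneg (hw0 x).le]
  have hng : ∀ x, ‖g x‖ = w x * ‖hT x‖ := fun x => by
    rw [hg, norm_mul, Complex.norm_real, Real.norm_of_nonneg (hw0 x).le]
  have hfh : ∀ x, ‖f x‖ ≤ ‖h x‖ := fun x => by
    rw [hnh]
    exact le_mul_of_one_le_left (norm_nonneg _) (ha1 _)
  -- The tested side of the Euler–Lagrange equation is the square of the tail norm.
  have hleft : (inner ℂ (hf'.toLp f) (hgm.toLp g)).re = X ^ 2 := by
    have e1 : inner ℂ (hf'.toLp f) (hgm.toLp g) = inner ℂ (hTm.toLp hT) (hTm.toLp hT) := by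
      rw [L2.inner_def, L2.inner_def]
      refine integral_congr_ae ?_
      filter_upwards [hf'.coeFn_toLp, hgm.coeFn_toLp, hTm.coeFn_toLp] with x h1 h2 h3
      rw [h1, h2, h3, RCLike.inner_apply, RCLike.inner_apply]
      by_cases hx : x ∈ {x : ℝ | N * s < |x|}
      · simp only [hg, hhT, Set.indicator_of_mem hx, hh, map_mul, Complex.conj_ofReal]
        ring
      · simp [hg, hhT, Set.indicator_of_notMem hx]
    have e2 := inner_self_eq_norm_sq (𝕜 := ℂ) (hTm.toLp hT)
    rw [e1]
    rw [Lp.norm_toLp] at e2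
    exact e2
  have hκm : Measurable fun y => a (curveSum p y).2 := ham.comp (measurable_curveSum p).snd
  have hκiM : ∀ y, |(a (curveSum p y).2)⁻¹| ≤ 1 := fun y => by
    rw [abs_of_pos (inv_pos.2 (ha0 _))]
    exact inv_le_one_of_one_le₀ (ha1 _)
  have hκM : ∀ y, |a (curveSum p y).2| ≤ M := fun y => by rw [abs_of_pos (ha0 _)]; exact haM _
  -- The weight `a` of the sum is moved from the tested factor to the other one.
  set q : ℝ × ℝ × ℝ → ℂ := fun y => (((a (curveSum p y).2)⁻¹ : ℝ) : ℂ) * tens g f f y with hq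
  set r : ℝ × ℝ × ℝ → ℂ := fun y => (a (curveSum p y).2 : ℂ) * tens f f f y with hr
  have hqm : MemLp q 2 volume := memLp_real_mul hκm.inv hκiM (memLp_tens hgm hf' hf')
  have hrm : MemLp r 2 volume := memLp_real_mul hκm hκM (memLp_tens hf' hf' hf')
  have htransfer : inner ℂ (pushL hp ((memLp_tens hgm hf' hf').toLp _))
      (pushL hp ((memLp_tens hf' hf' hf').toLp _)) =
      inner ℂ (pushL hp (hqm.toLp q)) (pushL hp (hrm.toLp r)) := by
    refine inner_pushL_transfer hp ham (fun τ => by rw [abs_of_pos (ha0 _)]; exact haM _) ?_ ?_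
    · filter_upwards [hqm.coeFn_toLp, (memLp_tens hgm hf' hf').coeFn_toLp] with y h1 h2
      rw [h1, h2, hq]
      dsimp only
      rw [← mul_assoc, ← Complex.ofReal_mul, mul_inv_cancel₀ (ha0 _).ne', Complex.ofReal_one,
        one_mul]
    · filter_upwards [hrm.coeFn_toLp, (memLp_tens hf' hf' hf').coeFn_toLp] with y h1 h2
      rw [h1, h2]
  have hpow : ∀ x : ℝ, 0 ≤ |x| ^ p := fun x => by positivity
  have hrn : ‖hrm.toLp r‖ ≤ H * (H * H) := by
    refine norm_toLp_le_of_tens hrm hhm hhm hhm fun y => ?_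
    simp only [hr, tens, norm_mul, hnh, Complex.norm_real, Real.norm_of_nonneg (ha0 _).le]
    calc a (curveSum p y).2 * (‖f y.1‖ * (‖f y.2.1‖ * ‖f y.2.2‖))
        ≤ (w y.1 * (w y.2.1 * w y.2.2)) * (‖f y.1‖ * (‖f y.2.1‖ * ‖f y.2.2‖)) := by
          gcongr
          exact hsub _ _ _ (hpow _) (hpow _) (hpow _)
      _ = _ := by ring
  have hqle : ∀ y, ‖q y‖ ≤ ‖hT y.1‖ * (‖f y.2.1‖ * ‖f y.2.2‖) := by
    intro y
    simp only [hq, tens, norm_mul, hng, Complex.norm_real]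
    rw [Real.norm_of_nonneg (inv_pos.2 (ha0 _)).le, inv_mul_le_iff₀ (ha0 _), mul_assoc]
    gcongr
    refine hmono _ _ (hpow _) ?_
    simp only [curveSum]
    linarith [hpow y.2.1, hpow y.2.2]
  set G : Set (ℝ × ℝ × ℝ) := {y | |y.2.1| ≤ s ∨ |y.2.2| ≤ s} with hG
  have hGm : MeasurableSet G := by
    have h1 : MeasurableSet {y : ℝ × ℝ × ℝ | |y.2.1| ≤ s} :=
      measurableSet_le (by fun_prop) measurable_const
    have h2 : MeasurableSet {y : ℝ × ℝ × ℝ | |y.2.2| ≤ s} :=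
      measurableSet_le (by fun_prop) measurable_const
    exact h1.union h2
  have hqG := hqm.indicator hGm
  have hqG' := hqm.indicator hGm.compl
  have hsplit : hqm.toLp q = hqG.toLp _ + hqG'.toLp _ := by
    rw [← MemLp.toLp_add]
    exact MemLp.toLp_congr _ _ (Eventually.of_forall fun y => by
      rw [Set.indicator_self_add_compl])
  have hA : ‖pushL hp (hqG.toLp _)‖ ≤ C * N ^ (-γ) * (X * (H * H)) := by
    have h1 := hgap (1 / N) (by positivity) (by rw [div_le_one hN0]; exact hN) (hqG.toLp _) ?_
    · refine h1.trans ?_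
      rw [one_div, Real.inv_rpow hN0.le, Real.rpow_neg hN0.le]
      gcongr
      · exact le_max_left _ _
      · refine norm_toLp_le_of_tens hqG hTm hhm hhm fun y => ?_
        refine (norm_indicator_le_norm_self _ _).trans ((hqle y).trans ?_)
        simp only [tens, norm_mul]
        gcongr <;> exact hfh _
    · filter_upwards [hqG.coeFn_toLp] with y hy hyn
      rw [hy]
      by_cases hyG : y ∈ G
      · rw [Set.indicator_of_mem hyG, ← norm_le_zero_iff]
        refine (hqle y).trans (le_of_eq ?_)
        have : y.1 ∉ {x : ℝ | N * s < |x|} := fun hy1 => hyn ?_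
        · simp [hhT, Set.indicator_of_notMem this]
        · have hmin : minAbs y ≤ s := by
            rcases hyG with h | h
            · exact ((min_le_right _ _).trans (min_le_left _ _)).trans h
            · exact ((min_le_right _ _).trans (min_le_right _ _)).trans h
          have hmax : N * s ≤ maxAbs y := (le_of_lt hy1).trans (le_max_left _ _)
          change minAbs y ≤ 1 / N * maxAbs y
          refine hmin.trans ?_
          rw [one_div, le_inv_mul_iff₀ hN0]
          exact hmax
      · exact Set.indicator_of_notMem hyG _
  have hB : ‖pushL hp (hqG'.toLp _)‖ ≤ C * (X * (S * S)) := by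
    refine (hop _).trans ?_
    gcongr
    refine norm_toLp_le_of_tens hqG' hTm hSm hSm fun y => ?_
    by_cases hyG : y ∈ G
    · rw [Set.indicator_of_notMem (by simpa using hyG), norm_zero]
      exact norm_nonneg _
    · rw [Set.indicator_of_mem (by simpa using hyG)]
      have hyG' : s < |y.2.1| ∧ s < |y.2.2| := by
        simpa [hG, not_or] using hyG
      refine (hqle y).trans ?_
      have e1 : hS y.2.1 = h y.2.1 := Set.indicator_of_mem (s := {x : ℝ | s < |x|}) hyG'.1 _
      have e2 : hS y.2.2 = h y.2.2 := Set.indicator_of_mem (s := {x : ℝ | s < |x|}) hyG'.2 _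
      simp only [tens, norm_mul, e1, e2]
      gcongr <;> exact hfh _
  have hmain : ω * X ^ 2 ≤ (C * N ^ (-γ) * (X * (H * H)) + C * (X * (S * S))) *
      (C * (H * (H * H))) := by
    rw [← hleft]
    calc ω * (inner ℂ (hf'.toLp f) (hgm.toLp g)).re
        = (inner ℂ (pushL hp ((memLp_tens hf' hf' hf').toLp _))
          (pushL hp ((memLp_tens hgm hf' hf').toLp _))).re := hEL g hgm
      _ ≤ ‖inner ℂ (pushL hp ((memLp_tens hf' hf' hf').toLp _))
          (pushL hp ((memLp_tens hgm hf' hf').toLp _))‖ := Complex.re_le_norm _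
      _ = ‖inner ℂ (pushL hp (hqm.toLp q)) (pushL hp (hrm.toLp r))‖ := by
          rw [norm_inner_symm, htransfer]
      _ ≤ ‖pushL hp (hqm.toLp q)‖ * ‖pushL hp (hrm.toLp r)‖ := norm_inner_le_norm _ _
      _ ≤ _ := by
          gcongr
          · rw [hsplit, map_add]
            exact (norm_add_le _ _).trans (add_le_add hA hB)
          · exact (hop _).trans (by gcongr)
  rcases hX0.eq_or_lt with h0 | h0
  · rw [← h0, mul_zero]
    have : 0 ≤ N ^ (-γ) := by positivity
    positivity
  · refine le_of_mul_le_mul_right ?_ h0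
    calc ω * X * X = ω * X ^ 2 := by ring
      _ ≤ _ := hmain
      _ = _ := by ring

/-! ### Exponential decay -/

/-- A bounded substitute for the weight `exp (μ τ)`, `τ ≥ 0`, which increases to it as `ε → 0` and
keeps its monotonicity and submultiplicativity. -/
def damp (μ ε τ : ℝ) : ℝ := Real.exp (μ * (max τ 0 / (1 + ε * max τ 0)))

section damp

variable {μ ε : ℝ}

theorem measurable_damp (μ ε : ℝ) : Measurable (damp μ ε) := by
  unfold damp
  fun_prop

theorem one_le_damp (hμ : 0 ≤ μ) (hε : 0 < ε) (τ : ℝ) : 1 ≤ damp μ ε τ := by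
  have : 0 ≤ max τ 0 := le_max_right _ _
  exact Real.one_le_exp (by positivity)

theorem damp_le (hμ : 0 ≤ μ) (hε : 0 < ε) (τ : ℝ) : damp μ ε τ ≤ Real.exp (μ * ε⁻¹) := by
  have : 0 ≤ max τ 0 := le_max_right _ _
  refine Real.exp_le_exp.2 (mul_le_mul_of_nonneg_left ?_ hμ)
  rw [div_le_iff₀ (by positivity), mul_add, inv_mul_cancel_left₀ hε.ne']
  have := inv_pos.2 hε
  linarith

theorem damp_le_exp (hμ : 0 ≤ μ) (hε : 0 < ε) {τ : ℝ} (hτ : 0 ≤ τ) :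
    damp μ ε τ ≤ Real.exp (μ * τ) := by
  rw [damp, max_eq_left hτ]
  refine Real.exp_le_exp.2 (mul_le_mul_of_nonneg_left (div_le_self hτ ?_) hμ)
  have : 0 ≤ ε * τ := by positivity
  linarith

theorem damp_mono (hμ : 0 ≤ μ) (hε : 0 < ε) {σ τ : ℝ} (hσ : 0 ≤ σ) (h : σ ≤ τ) :
    damp μ ε σ ≤ damp μ ε τ := by
  have hτ := hσ.trans h
  rw [damp, damp, max_eq_left hσ, max_eq_left hτ]
  refine Real.exp_le_exp.2 (mul_le_mul_of_nonneg_left ?_ hμ)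
  rw [div_le_div_iff₀ (by positivity) (by positivity)]
  nlinarith

theorem damp_submul (hμ : 0 ≤ μ) (hε : 0 < ε) {x y z : ℝ} (hx : 0 ≤ x) (hy : 0 ≤ y)
    (hz : 0 ≤ z) : damp μ ε (x + y + z) ≤ damp μ ε x * (damp μ ε y * damp μ ε z) := by
  have hsum : 0 ≤ x + y + z := by positivity
  rw [damp, damp, damp, damp, ← Real.exp_add, ← Real.exp_add, max_eq_left hx, max_eq_left hy,
    max_eq_left hz, max_eq_left hsum, ← mul_add, ← mul_add, ← add_assoc, add_div, add_div]
  refine Real.exp_le_exp.2 (mul_le_mul_of_nonneg_left ?_ hμ)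
  have h1 : ∀ u, 0 ≤ u → u ≤ x + y + z → u / (1 + ε * (x + y + z)) ≤ u / (1 + ε * u) := by
    intro u hu huv
    gcongr
  exact add_le_add (add_le_add (h1 x hx (by linarith)) (h1 y hy (by linarith)))
    (h1 z hz (by linarith))

theorem damp_zero_left (ε τ : ℝ) : damp 0 ε τ = 1 := by simp [damp]

theorem tendsto_damp (μ : ℝ) {τ : ℝ} (hτ : 0 ≤ τ) :
    Tendsto (fun n : ℕ => damp μ (1 / ((n : ℝ) + 1)) τ) atTop (𝓝 (Real.exp (μ * τ))) := by
  have h0 : Tendsto (fun n : ℕ => 1 / ((n : ℝ) + 1)) atTop (𝓝 0) :=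
    tendsto_one_div_add_atTop_nhds_zero_nat
  have h1 : Tendsto (fun n : ℕ => μ * (τ / (1 + 1 / ((n : ℝ) + 1) * τ))) atTop
      (𝓝 (μ * (τ / (1 + 0 * τ)))) :=
    (tendsto_const_nhds.div ((h0.mul_const τ).const_add 1) (by simp)).const_mul μ
  rw [zero_mul, add_zero, div_one] at h1
  simpa only [damp, max_eq_left hτ, Function.comp_def] using
    (Real.continuous_exp.tendsto _).comp h1

end damp

/-- The tail of `f` beyond the radius `r`, with the damped weight. -/
def tail (p : ℝ) (f : ℝ → ℂ) (r μ ε : ℝ) : ℝ → ℂ :=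
  {x | r < |x|}.indicator fun x => (damp μ ε (|x| ^ p) : ℂ) * f x

theorem memLp_damp_mul {p : ℝ} {f : ℝ → ℂ} (hf : MemLp f 2 volume) {μ ε : ℝ} (hμ : 0 ≤ μ)
    (hε : 0 < ε) : MemLp (fun x => (damp μ ε (|x| ^ p) : ℂ) * f x) 2 volume := by
  refine memLp_real_mul (a := fun x => damp μ ε (|x| ^ p)) (M := Real.exp (μ * ε⁻¹))
    ((measurable_damp μ ε).comp (by fun_prop)) (fun x => ?_) hf
  rw [abs_of_pos (one_pos.trans_le (one_le_damp hμ hε _))]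
  exact damp_le hμ hε _

theorem memLp_tail {p : ℝ} {f : ℝ → ℂ} (hf : MemLp f 2 volume) {r μ ε : ℝ} (hμ : 0 ≤ μ)
    (hε : 0 < ε) : MemLp (tail p f r μ ε) 2 volume :=
  (memLp_damp_mul hf hμ hε).indicator (measurableSet_lt_abs r)

theorem continuousOn_nrm_tail_sq {p : ℝ} {f : ℝ → ℂ} (hf : MemLp f 2 volume) (r : ℝ) {ε : ℝ}
    (hε : 0 < ε) (μ₀ : ℝ) :
    ContinuousOn (fun μ => nrm (tail p f r μ ε) ^ 2) (Set.Icc 0 μ₀) := by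
  have h1 : ContinuousOn (fun μ => ∫ x, ‖tail p f r μ ε x‖ ^ 2) (Set.Icc 0 μ₀) := by
    refine continuousOn_of_dominated (bound := fun x => (Real.exp (μ₀ * ε⁻¹) * ‖f x‖) ^ 2)
      (fun μ hμ => (memLp_tail hf hμ.1 hε).1.norm.pow 2)
      (fun μ hμ => Eventually.of_forall fun x => ?_) ?_ (Eventually.of_forall fun x => ?_)
    · rw [norm_pow, norm_norm]
      gcongr
      refine (norm_indicator_le_norm_self _ _).trans ?_
      rw [norm_mul, Complex.norm_real,
        Real.norm_of_nonneg (zero_le_one.trans (one_le_damp hμ.1 hε _))]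
      gcongr
      refine (damp_le hμ.1 hε _).trans (Real.exp_le_exp.2 ?_)
      have := inv_pos.2 hε
      gcongr
      exact hμ.2
    · exact (hf.norm.const_mul _).integrable_sq
    · refine Continuous.continuousOn ?_
      by_cases hx : x ∈ {x : ℝ | r < |x|}
      · simp only [tail, Set.indicator_of_mem hx, damp]
        fun_prop
      · simp only [tail, Set.indicator_of_notMem hx]
        fun_prop
  exact h1.congr fun μ hμ => nrm_sq (memLp_tail hf hμ.1 hε)

theorem nrm_tail_le {p : ℝ} {f : ℝ → ℂ} (hf : MemLp f 2 volume) {r R μ ε E : ℝ} (hμ : 0 ≤ μ)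
    (hε : 0 < ε) (hE : ∀ x, |x| ≤ R → damp μ ε (|x| ^ p) ≤ E) (hE0 : 0 ≤ E) :
    nrm (tail p f r μ ε) ≤ E * nrm ({x | r < |x|}.indicator f) + nrm (tail p f R μ ε) := by
  have hm := memLp_tail (p := p) hf (r := r) hμ hε
  have hfr := hf.indicator (measurableSet_lt_abs r)
  have e : tail p f r μ ε = {x | R < |x|}ᶜ.indicator (tail p f r μ ε) +
      {x | R < |x|}.indicator (tail p f r μ ε) := (Set.indicator_compl_add_self _ _).symm
  rw [e]
  refine (nrm_add_le (hm.indicator (measurableSet_lt_abs R).compl)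
    (hm.indicator (measurableSet_lt_abs R))).trans (add_le_add ?_ ?_)
  · refine nrm_le_of_norm_le hfr hE0 fun x => ?_
    by_cases hx : x ∈ {x : ℝ | R < |x|}
    · rw [Set.indicator_of_notMem (by simpa using hx), norm_zero]
      positivity
    · rw [Set.indicator_of_mem (by simpa using hx)]
      by_cases hxr : x ∈ {x : ℝ | r < |x|}
      · rw [tail, Set.indicator_of_mem hxr, Set.indicator_of_mem hxr, norm_mul, Complex.norm_real,
          Real.norm_of_nonneg (zero_le_one.trans (one_le_damp hμ hε _))]
        gcongr
        exact hE x (not_lt.1 hx)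
      · rw [tail, Set.indicator_of_notMem hxr, Set.indicator_of_notMem hxr]
        simp
  · refine (nrm_le_of_norm_le (c := 1) (memLp_tail hf hμ hε) zero_le_one fun x => ?_).trans
      (one_mul _).le
    rw [one_mul]
    by_cases hx : x ∈ {x : ℝ | R < |x|}
    · rw [Set.indicator_of_mem hx, tail, tail, Set.indicator_of_mem hx]
      exact norm_indicator_le_norm_self _ _
    · rw [Set.indicator_of_notMem hx, norm_zero]
      exact norm_nonneg _

theorem tendsto_nrm_indicator {f : ℝ → ℂ} (hf : MemLp f 2 volume) :
    Tendsto (fun r => nrm ({x | r < |x|}.indicator f)) atTop (𝓝 0) := by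
  have h1 := tendsto_eLpNorm_indicator_sub hf (s := fun R => Set.Icc (-R) R)
    (fun R => measurableSet_Icc) eventually_mem_Icc_symm
  have h2 := (ENNReal.tendsto_toReal ENNReal.zero_ne_top).comp h1
  refine h2.congr fun R => ?_
  rw [Function.comp_apply, nrm]
  congr 1
  refine eLpNorm_congr_norm_ae (Eventually.of_forall fun x => ?_)
  by_cases hx : |x| ≤ R
  · rw [Pi.sub_apply, Set.indicator_of_mem (show x ∈ Set.Icc (-R) R from abs_le.1 hx),
      Set.indicator_of_notMem (by simpa using hx), sub_self]
  · rw [Pi.sub_apply, Set.indicator_of_notMem (fun h : x ∈ Set.Icc (-R) R => hx (abs_le.2 h)),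
      Set.indicator_of_mem (by simpa using hx), zero_sub, norm_neg]

/-- The weighted tail is bounded uniformly in the damping: it is at most `x` for `μ = 0`, it
depends continuously on `μ`, and by the bootstrap inequality it cannot take the value `x`. -/
theorem IsExtremizer.exists_tail_le {p : ℝ} (hp : 1 < p) {f : ℝ → ℂ} (hf : IsExtremizer p f) :
    ∃ R μ₀ x : ℝ, 0 < R ∧ 0 < μ₀ ∧ μ₀ * R ^ p ≤ 1 ∧
      ∀ ε, 0 < ε → nrm (tail p f R μ₀ ε) ≤ x := by
  obtain ⟨ω, C, γ, hω, hC, hγ, hboot⟩ := hf.exists_bootstrap hp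
  have hf' := hf.memLp
  set E := Real.exp 1 with hE
  have hE1 : 1 ≤ E := Real.one_le_exp zero_le_one
  set A := nrm f
  have hA : 0 ≤ A := nrm_nonneg _
  set H := E * A + 1
  have hH : 0 < H := by positivity
  set B := C * H ^ 3 * C with hB
  have hB0 : 0 ≤ B := by positivity
  -- The level `x` makes the quadratic term of the bootstrap inequality less than `ω x / 2`; then
  -- `N` is chosen for the linear term, and `s` for the unweighted part of the tail.
  set x := min 1 (ω / (16 * (B + 1))) with hx
  have hx0 : 0 < x := lt_min one_pos (by positivity)
  have hx1 : x ≤ 1 := min_le_left _ _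
  have hBx : B * (4 * x) < ω / 2 := by
    have h1 : x * (16 * (B + 1)) ≤ ω := (le_div_iff₀ (by positivity)).1 (min_le_right _ _)
    nlinarith
  obtain ⟨N, hN1, hN⟩ : ∃ N : ℝ, 1 ≤ N ∧ B * N ^ (-γ) * H ^ 2 ≤ ω / 2 * x := by
    have h1 : Tendsto (fun N : ℝ => B * N ^ (-γ) * H ^ 2) atTop (𝓝 (B * 0 * H ^ 2)) :=
      ((tendsto_rpow_neg_atTop hγ).const_mul B).mul_const _
    rw [mul_zero, zero_mul] at h1
    obtain ⟨N, h2, h3⟩ := ((h1.eventually (ge_mem_nhds (by positivity :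
      0 < ω / 2 * x))).and (eventually_ge_atTop 1)).exists
    exact ⟨N, h3, h2⟩
  obtain ⟨s, hs0, hs⟩ : ∃ s : ℝ, 0 < s ∧ E * nrm ({x | s < |x|}.indicator f) < x := by
    have h1 := (tendsto_nrm_indicator hf').const_mul E
    rw [mul_zero] at h1
    obtain ⟨s, h2, h3⟩ := ((h1.eventually (gt_mem_nhds hx0)).and (eventually_gt_atTop 0)).exists
    exact ⟨s, h3, h2⟩
  have hR : 0 < N * s := by positivity
  have hRp : 0 < (N * s) ^ p := by positivity
  have hsR : s ≤ N * s := le_mul_of_one_le_left hs0.le hN1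
  refine ⟨N * s, ((N * s) ^ p)⁻¹, x, hR, by positivity, (inv_mul_cancel₀ hRp.ne').le,
    fun ε hε => ?_⟩
  set μ₀ := ((N * s) ^ p)⁻¹ with hμ₀
  have hμ₀0 : 0 ≤ μ₀ := by positivity
  by_contra! hlt
  -- The weighted tail is at most `x` at `μ = 0`.
  have h0 : nrm (tail p f (N * s) 0 ε) ≤ x := by
    have h1 : nrm (tail p f (N * s) 0 ε) ≤ 1 * nrm ({x | s < |x|}.indicator f) := by
      refine nrm_le_of_norm_le (hf'.indicator (measurableSet_lt_abs s)) zero_le_one fun y => ?_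
      rw [one_mul]
      by_cases hy : y ∈ {x : ℝ | N * s < |x|}
      · rw [tail, Set.indicator_of_mem hy, damp_zero_left, Complex.ofReal_one, one_mul,
          Set.indicator_of_mem (show y ∈ {x : ℝ | s < |x|} from hsR.trans_lt hy)]
      · rw [tail, Set.indicator_of_notMem hy, norm_zero]
        exact norm_nonneg _
    refine h1.trans (le_trans ?_ hs.le)
    gcongr
    exact nrm_nonneg _
  obtain ⟨μ, hμ, hμx⟩ := intermediate_value_Icc hμ₀0
    (continuousOn_nrm_tail_sq (p := p) hf' (N * s) hε μ₀)
    (show x ^ 2 ∈ Set.Icc _ _ from ⟨pow_le_pow_left₀ (nrm_nonneg _) h0 2,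
      pow_le_pow_left₀ hx0.le hlt.le 2⟩)
  have hX : nrm (tail p f (N * s) μ ε) = x :=
    (pow_left_inj₀ (nrm_nonneg _) hx0.le two_ne_zero).1 hμx
  have hdE : ∀ y, |y| ≤ N * s → damp μ ε (|y| ^ p) ≤ E := by
    intro y hy
    refine (damp_le_exp hμ.1 hε (by positivity)).trans (Real.exp_le_exp.2 ?_)
    calc μ * |y| ^ p ≤ μ₀ * (N * s) ^ p := by
          gcongr
          exact hμ.2
      _ = 1 := inv_mul_cancel₀ hRp.ne'
  have hS : nrm (tail p f s μ ε) ≤ 2 * x := by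
    have := nrm_tail_le (r := s) hf' hμ.1 hε hdE (by positivity)
    linarith
  -- At the radius `-1` the tail is the whole function.
  have huniv : {y : ℝ | -1 < |y|} = Set.univ :=
    Set.eq_univ_of_forall fun y => lt_of_lt_of_le (by norm_num) (abs_nonneg y)
  have hHle : nrm (fun y => (damp μ ε (|y| ^ p) : ℂ) * f y) ≤ H := by
    have := nrm_tail_le (r := -1) hf' hμ.1 hε hdE (by positivity)
    rw [tail, huniv, Set.indicator_univ, Set.indicator_univ] at this
    linarith
  have hb := hboot (damp μ ε) _ (measurable_damp μ ε) (one_le_damp hμ.1 hε) (damp_le hμ.1 hε)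
    (fun _ _ => damp_mono hμ.1 hε) (fun _ _ _ => damp_submul hμ.1 hε) N s hN1 hs0
  change ω * nrm (tail p f (N * s) μ ε) ≤ C * nrm _ ^ 3 * (C * N ^ (-γ) * nrm _ ^ 2 +
    C * nrm (tail p f s μ ε) ^ 2) at hb
  rw [hX] at hb
  have hHn := nrm_nonneg fun y => (damp μ ε (|y| ^ p) : ℂ) * f y
  have hSn := nrm_nonneg (tail p f s μ ε)
  have hNγ : 0 ≤ N ^ (-γ) := by positivity
  have hfin : ω * x ≤ B * N ^ (-γ) * H ^ 2 + B * (4 * x) * x := by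
    refine hb.trans ?_
    calc _ ≤ C * H ^ 3 * (C * N ^ (-γ) * H ^ 2 + C * (2 * x) ^ 2) := by gcongr
      _ = _ := by rw [hB]; ring
  nlinarith

/-- An extremizer decays like `exp (-μ |x| ^ p)` in the mean square sense. -/
theorem IsExtremizer.exists_memLp_exp {p : ℝ} (hp : 1 < p) {f : ℝ → ℂ} (hf : IsExtremizer p f) :
    ∃ μ₀ : ℝ, 0 < μ₀ ∧
      MemLp (fun x : ℝ => ((Real.exp (μ₀ * |x| ^ p) : ℝ) : ℂ) * f x) 2 volume := by
  obtain ⟨R, μ₀, x, hR, hμ₀, hμR, H⟩ := hf.exists_tail_le hp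
  refine ⟨μ₀, hμ₀, ?_⟩
  have hf' := hf.memLp
  set u : ℝ → ℂ := fun x => ((Real.exp (μ₀ * |x| ^ p) : ℝ) : ℂ) * f x with hu
  have hum : AEStronglyMeasurable u volume :=
    AEStronglyMeasurable.mul (Measurable.aestronglyMeasurable (by fun_prop)) hf'.1
  have hε : ∀ n : ℕ, (0 : ℝ) < 1 / ((n : ℝ) + 1) := fun n => by positivity
  have h1 : MemLp ({x | R < |x|}.indicator u) 2 volume := by
    refine ⟨hum.indicator (measurableSet_lt_abs R), ?_⟩
    have hlim := Lp.eLpNorm_lim_le_liminf_eLpNorm (p := 2) (μ := volume)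
      (f := fun n : ℕ => tail p f R μ₀ (1 / ((n : ℝ) + 1)))
      (fun n => (memLp_tail hf' hμ₀.le (hε n)).1) ({x | R < |x|}.indicator u)
      (Eventually.of_forall fun y => ?_)
    · refine (hlim.trans (liminf_le_of_le (a := ENNReal.ofReal x) ?_ fun b hb => ?_)).trans_lt
        ENNReal.ofReal_lt_top
      · isBoundedDefault
      · obtain ⟨n, hn⟩ := hb.exists
        refine hn.trans ?_
        rw [← ENNReal.ofReal_toReal (memLp_tail hf' hμ₀.le (hε n)).2.ne]
        exact ENNReal.ofReal_le_ofReal (H _ (hε n))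
    · by_cases hy : y ∈ {x : ℝ | R < |x|}
      · simp only [tail, Set.indicator_of_mem hy, hu]
        exact ((Complex.continuous_ofReal.tendsto _).comp
          (tendsto_damp μ₀ (by positivity))).mul_const _
      · simp only [tail, Set.indicator_of_notMem hy]
        exact tendsto_const_nhds
  have h2 : MemLp ({x | R < |x|}ᶜ.indicator u) 2 volume := by
    refine hf'.of_le_mul (c := Real.exp 1) (hum.indicator (measurableSet_lt_abs R).compl)
      (Eventually.of_forall fun y => ?_)
    by_cases hy : y ∈ {x : ℝ | R < |x|}
    · rw [Set.indicator_of_notMem (by simpa using hy), norm_zero]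
      positivity
    · rw [Set.indicator_of_mem (by simpa using hy), hu, norm_mul, Complex.norm_real,
        Real.norm_of_nonneg (Real.exp_pos _).le]
      gcongr
      refine le_trans ?_ hμR
      gcongr
      exact not_lt.1 hy
  have := h1.add h2
  rwa [Set.indicator_self_add_compl] at this

/-! ### The Fourier transform extends to an entire function -/

/-- Since `p > 1`, the weight `exp (-μ |x| ^ p)` absorbs every exponential `exp (r |x|)`. -/
theorem exists_mul_sub_rpow_le {p : ℝ} (hp : 1 < p) {μ : ℝ} (hμ : 0 < μ) (r : ℝ) :
    ∃ c : ℝ, ∀ x : ℝ, r * |x| - μ * |x| ^ p ≤ c := by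
  have hp1 : 0 < p - 1 := by linarith
  have h1 : Tendsto (fun t : ℝ => t ^ (p - 1)) atTop atTop := tendsto_rpow_atTop hp1
  obtain ⟨T, hT0, hT⟩ : ∃ T : ℝ, 0 < T ∧ ∀ t, T ≤ t → r / μ ≤ t ^ (p - 1) := by
    obtain ⟨T, hT⟩ := eventually_atTop.1 (h1.eventually_ge_atTop (r / μ))
    exact ⟨max T 1, by positivity, fun t ht => hT t ((le_max_left _ _).trans ht)⟩
  refine ⟨|r| * T, fun x => ?_⟩
  rcases le_total T |x| with h | h
  · have hx : 0 < |x| := hT0.trans_le h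
    have h2 := (div_le_iff₀ hμ).1 (hT _ h)
    have h3 : |x| ^ p = |x| ^ (p - 1) * |x| := by
      rw [← Real.rpow_add_one hx.ne', sub_add_cancel]
    rw [h3]
    have : 0 ≤ |r| * T := by positivity
    nlinarith
  · have h2 : 0 ≤ μ * |x| ^ p := by positivity
    have h3 : r * |x| ≤ |r| * T := mul_le_mul (le_abs_self r) h (abs_nonneg _) (abs_nonneg _)
    linarith

theorem memLp_exp_neg_abs : MemLp (fun x : ℝ => Real.exp (-|x|)) 2 volume := by
  rw [memLp_two_iff_integrable_sq (Measurable.aestronglyMeasurable (by fun_prop))]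
  have h1 : (fun x : ℝ => Real.exp (-|x|) ^ 2) = fun x : ℝ => Real.exp (-2 * |x|) := by
    ext x
    rw [← Real.exp_nat_mul]
    congr 1
    push_cast
    ring
  rw [h1]
  rw [← integrableOn_univ, ← Set.Iic_union_Ioi (a := (0 : ℝ))]
  refine IntegrableOn.union ?_ ?_
  · refine (integrableOn_exp_mul_Iic two_pos 0).congr_fun (fun x hx => ?_) measurableSet_Iic
    rw [abs_of_nonpos hx, neg_mul_neg]
  · refine (integrableOn_exp_mul_Ioi (neg_lt_zero.2 two_pos) 0).congr_fun (fun x hx => ?_)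
      measurableSet_Ioi
    rw [abs_of_pos hx]

/-- A function with `e^{μ |x| ^ p} f ∈ L²` is integrable against every exponential. -/
theorem integrable_exp_mul_of_memLp_exp {p : ℝ} (hp : 1 < p) {μ : ℝ} (hμ : 0 < μ) {f : ℝ → ℂ}
    (hf : MemLp (fun x : ℝ => ((Real.exp (μ * |x| ^ p) : ℝ) : ℂ) * f x) 2 volume) (r : ℝ) :
    Integrable (fun x => Real.exp (r * |x|) * ‖f x‖) volume := by
  obtain ⟨c, hc⟩ := exists_mul_sub_rpow_le hp hμ (r + 1)
  have h1 := (memLp_exp_neg_abs.integrable_mul hf.norm).const_mul (Real.exp c)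
  have hfm : AEStronglyMeasurable f volume := by
    have h2 : AEStronglyMeasurable (fun x : ℝ => ((Real.exp (-(μ * |x| ^ p)) : ℝ) : ℂ) *
        (((Real.exp (μ * |x| ^ p) : ℝ) : ℂ) * f x)) volume :=
      AEStronglyMeasurable.mul (Measurable.aestronglyMeasurable (by fun_prop)) hf.1
    refine h2.congr (Eventually.of_forall fun x => ?_)
    dsimp only
    rw [← mul_assoc, ← Complex.ofReal_mul, ← Real.exp_add, neg_add_cancel, Real.exp_zero,
      Complex.ofReal_one, one_mul]
  refine h1.mono' (AEStronglyMeasurable.mul (Measurable.aestronglyMeasurable (by fun_prop))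
    hfm.norm) (Eventually.of_forall fun x => ?_)
  rw [Real.norm_of_nonneg (by positivity), Pi.mul_apply, norm_mul, Complex.norm_real,
    Real.norm_of_nonneg (Real.exp_pos _).le, ← mul_assoc, ← mul_assoc, ← Real.exp_add,
    ← Real.exp_add]
  gcongr
  have := hc x
  linarith

/-- A function integrable against every exponential has an entire Fourier transform. -/
theorem differentiable_fourier_of_integrable_exp {f : ℝ → ℂ} (hfm : AEStronglyMeasurable f volume)
    (hf : ∀ r : ℝ, Integrable (fun x => Real.exp (r * |x|) * ‖f x‖) volume) :
    Differentiable ℂ fun ζ : ℂ => ∫ x : ℝ, Complex.exp (-Complex.I * (x * ζ)) * f x := by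
  intro ζ
  have hnorm : ∀ (z : ℂ) (x : ℝ), ‖Complex.exp (-Complex.I * (x * z))‖ ≤
      Real.exp (‖z‖ * |x|) := by
    intro z x
    rw [Complex.norm_exp]
    refine Real.exp_le_exp.2 ((Complex.re_le_norm _).trans (le_of_eq ?_))
    rw [norm_mul, norm_neg, Complex.norm_I, one_mul, norm_mul, Complex.norm_real,
      Real.norm_eq_abs, mul_comm]
  have hm : ∀ z : ℂ, AEStronglyMeasurable (fun x : ℝ => Complex.exp (-Complex.I * (x * z)) * f x)
      volume := fun z =>
    AEStronglyMeasurable.mul (Measurable.aestronglyMeasurable (by fun_prop)) hfm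
  refine (hasDerivAt_integral_of_dominated_loc_of_deriv_le
    (F' := fun z x => -Complex.I * x * (Complex.exp (-Complex.I * (x * z)) * f x))
    (bound := fun x => Real.exp ((‖ζ‖ + 2) * |x|) * ‖f x‖)
    (Metric.ball_mem_nhds ζ one_pos) (Eventually.of_forall hm) ?_ ?_ ?_ (hf _) ?_).2.differentiableAt
  · refine (hf ‖ζ‖).mono' (hm ζ) (Eventually.of_forall fun x => ?_)
    rw [norm_mul]
    gcongr
    exact hnorm ζ x
  · exact AEStronglyMeasurable.mul (Measurable.aestronglyMeasurable (by fun_prop)) (hm ζ)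
  · refine Eventually.of_forall fun x z hz => ?_
    have hz' : ‖z‖ ≤ ‖ζ‖ + 1 := by
      have h1 := norm_le_norm_add_norm_sub' z ζ
      have h2 := mem_ball_iff_norm.1 hz
      linarith
    rw [norm_mul, norm_mul, norm_neg, Complex.norm_I, one_mul, norm_mul, Complex.norm_real,
      Real.norm_eq_abs, ← mul_assoc]
    gcongr
    calc |x| * ‖Complex.exp (-Complex.I * (x * z))‖
        ≤ Real.exp |x| * Real.exp ((‖ζ‖ + 1) * |x|) := by
          gcongr
          · exact (by linarith : |x| ≤ |x| + 1).trans (Real.add_one_le_exp _)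
          · refine (hnorm z x).trans (Real.exp_le_exp.2 ?_)
            gcongr
      _ = Real.exp ((‖ζ‖ + 2) * |x|) := by
          rw [← Real.exp_add]
          congr 1
          ring
  · refine Eventually.of_forall fun x z _ => ?_
    have h1 : HasDerivAt (fun z : ℂ => -Complex.I * (x * z)) (-Complex.I * x) z := by
      simpa using ((hasDerivAt_id z).const_mul (x : ℂ)).const_mul (-Complex.I)
    convert! h1.cexp.mul_const (f x) using 1
    ring

end PowerCurve

end

theorem theorem4 (p : ℝ) (hp : 1 < p) (f : ℝ → ℂ) (hf : PowerCurve.IsExtremizer p f) :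
    (∃ μ₀ : ℝ, 0 < μ₀ ∧
      MemLp (fun x : ℝ => ((Real.exp (μ₀ * |x| ^ p) : ℝ) : ℂ) * f x) 2 volume) ∧
    (Integrable f volume ∧
      ∃ F : ℂ → ℂ, Differentiable ℂ F ∧ ∀ ξ : ℝ, F (ξ : ℂ) = PowerCurve.fourier f ξ) := by
  obtain ⟨μ₀, hμ₀, hdecay⟩ := hf.exists_memLp_exp hp
  have hexp := PowerCurve.integrable_exp_mul_of_memLp_exp hp hμ₀ hdecay
  refine ⟨⟨μ₀, hμ₀, hdecay⟩, (hexp 0).mono' hf.memLp.1 (Eventually.of_forall fun x => by simp),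
    _, PowerCurve.differentiable_fourier_of_integrable_exp hf.memLp.1 hexp, fun ξ => ?_⟩
  simp only [PowerCurve.fourier, Complex.ofReal_mul]
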